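/- Let $p$ be an odd prime and let $n,k\geq 1$ be integers. Let $T(n,k)=\mathbb Z/p[\xi_i \mid k\leq i\leq n+k-1]$ be the Hopf algebra with inner degrees $|\xi_i|=2(p-1)(1+p+\cdots+p^{i-1})$ and coproduct $$\Delta(\xi_i)=\xi_i\otimes 1+\sum_{k\leq r\leq i-k}\xi_r\otimes \xi_{i-r}^{p^r}+1\otimes \xi_i .$$ Let $S(n,k)=S(n)/(t_s\mid s<k)=\mathbb Z/p[t_s\mid s\geq k]/(t_s^{p^n}-t_s)$, where $S(n)=\mathbb Z/p\otimes_{K(n)_*}K(n)_*K(n)\otimes_{K(n)_*}\mathbb Z/p$ is the $n$-th Morava stabilizer algebra (with $v_n\mapsto 1$), and let $\Phi:T(n,k)\to S(n,k)$, $\xi_i\mapsto t_i$, be the reduction map. Give $T(n,k)$ the May filtration with $M(\xi_i^{p^j})=2i-1$, and $S(n,k)$ the May filtration with $M(t_s^{p^j})=2s-1$ for $k\leq s\leq n+k-1$ and $M(t_s^{p^j})=\max\{2s-1,\ pM(t_{s-n}^{p^{j+n-1}})+1\}$ for $s\geq n+k$. In both cases the filtration of a monomial is obtained by writing exponents $p$-adically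 (a factor $x^{e}$, $x=\xi_i$ or $t_s$, $e=\sum_j e_jp^j$ with $0\leq e_j<p$, contributes $\sum_j e_jM(x^{p^j})$), and the filtration of a generator $[\beta_1|\cdots|\beta_s]$ of the cobar complex, with all $\beta_l$ monomials, is $\sum_l M(\beta_l)$. Let $(E_r^{s,t,M},d_r)$, $d_r:E_r^{s,t,M}\to E_r^{s+1,t,M-r}$, $r\geq 1$, be the resulting May spectral sequences of the filtered cobar complexes, where $s$ is the cohomological degree, $t$ the inner degree (taken modulo $2(p-1)(1+p+\cdots+p^{n-1})$ for $S(n,k)$) and $M$ the May filtration, and let $\Phi:E_r^{s,t,M}T(n,k)\to E_r^{s,t,M}S(n,k)$ be the map induced by $\Phi$. Let $h'_{i,j}\in E_1^{1,*,2i-1}T(n,k)$, for $k\leq i\leq n+k-1$ and $j\geq 0$, be the class of $[\xi_i^{p^j}]$. Linear combinations of the products $h'_{i_1,j_1}\cdots h'_{i_s,j_s}$ form the exterior part $E[h'_{i,j}]$ of $E_1T(n,k)$. For such a product put $SI(h'_{i_1,j_1}\cdots h'_{i_s,j_s})=i_1+\cdots+i_s$; for an element $g$ of the exterior part, $SI(g)=m$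 means that $g$ is a linear combination of products with $SI=m$. For $t=2(p-1)(c_0+c_1p+\cdots+c_mp^m)$ with $0\leq c_i<p$ put $Sd(t)=c_0+c_1+\cdots+c_m$, and for $g$ of inner degree $t$ put $Sd(g)=Sd(t)$. An element $g\in E_1$ is an infinite cocycle if it survives to every page and $d_r(g)=0$ for all $r\geq 1$. Then: 1. If $t=2(p-1)(c_0+c_1p+\cdots+c_mp^m)$ with $0\leq c_i<p$, and $M<2\,Sd(t)-s$, then $E_1^{s,t,M}T(n,k)=0$. 2. If $g\in E_1^{s,t,M}T(n,k)$ lies in the exterior part, $d_1(g)=0$ and $SI(g)=Sd(g)$, then $g$ is an infinite cocycle in the May spectral sequence for $T(n,k)$, and $\Phi(g)$ is an infinite cocycle in the May spectral sequence for $S(n,k)$. -/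

import Mathlib

/-!
The Hopf algebras `T(n,k)` and `S(n,k)`, their cobar complexes with the May filtration, the pages
and differentials of the May spectral sequences, and the map between them induced by the reduction
`ξ_i ↦ t_i`.
-/

namespace MaySS

open scoped TensorProduct
open Finset

section Witt
variable (p n : ℕ) [Fact p.Prime] {R : Type*} [CommRing R]

/-- For a sequence `f` of Witt vectors, thought of as the formal sum `∑ f(s) S^s` with `S^n = p`, this
is the sum of the terms `f(c), p f(c+n), …, p^q f(c+nq)`, where `s = c + nq` and `c < n`. -/
noncomputable def wittPartial (f : ℕ → WittVector p R) (s : ℕ) : WittVector p R :=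
  ∑ r ∈ range (s / n + 1), f (s % n + n * r) * (p : WittVector p R) ^ r

/-- The `s`-th Teichmuller digit of `∑ f(s) S^s`, `S^n = p`. For a ring `R` of characteristic `p` with
`x^(p^n) = x` for all `x`, the digits `a_s` are the unique elements of `R` with
`∑ f(s) S^s = ∑ [a_s] S^s`; since `p^q [a] = (0, …, 0, a^(p^q), 0, …)` the digit with `s = c + nq`
is the `p^q`-th root of the `q`-th Witt coordinate of the partial sum. -/
noncomputable def hondaDigit (f : ℕ → WittVector p R) (s : ℕ) : R :=
  (wittPartial p n f s).coeff (s / n) ^ p ^ ((n - 1) * (s / n))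

/-- The product `(∑ [a_i] S^i) (∑ [b_j] S^j)`, computed with `S w = Frob(w) S`: the coefficient of `S^s`
is the sum of `[a_i b_j^(p^i)]` over `i + j = s`. -/
noncomputable def twistedProd (a b : ℕ → R) (s : ℕ) : WittVector p R :=
  ∑ x ∈ antidiagonal s, WittVector.teichmuller p (a x.1 * b x.2 ^ p ^ x.1)

theorem map_digit {R' : Type*} [CommRing R'] (φ : R →+* R') (f : ℕ → WittVector p R) (s : ℕ) :
    φ (hondaDigit p n f s) = hondaDigit p n (fun i => WittVector.map φ (f i)) s := by
  simp only [hondaDigit, wittPartial, map_pow]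
  rw [← WittVector.map_coeff]
  simp [map_sum]

theorem map_twMul {R' : Type*} [CommRing R'] (φ : R →+* R') (a b : ℕ → R) (s : ℕ) :
    WittVector.map φ (twistedProd p a b s) = twistedProd p (fun i => φ (a i)) (fun i => φ (b i)) s := by
  simp [twistedProd, map_sum, WittVector.map_teichmuller]

/-- Twisted convolution of sequences of Witt vectors, with `S w = Frob(w) S`. -/
noncomputable def conv (f g : ℕ → WittVector p R) (s : ℕ) : WittVector p R :=
  ∑ x ∈ antidiagonal s, f x.1 * (WittVector.frobenius^[x.1]) (g x.2)

/-- The sequence of Teichmuller representatives. -/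
noncomputable def teich (a : ℕ → R) (s : ℕ) : WittVector p R := WittVector.teichmuller p (a s)

/-- The Witt vector Frobenius as an additive endomorphism. -/
noncomputable def frobEnd : AddMonoid.End (WittVector p R) :=
  (WittVector.frobenius : WittVector p R →+* WittVector p R).toAddMonoidHom

theorem frobEnd_pow (i : ℕ) (x : WittVector p R) :
    (frobEnd p ^ i : AddMonoid.End (WittVector p R)) x = (WittVector.frobenius^[i]) x := by
  induction i generalizing x with
  | zero => rfl
  | succ i ih => rw [pow_succ, Function.iterate_succ_apply, ← ih]; rfl

theorem frob_iter_one (i : ℕ) :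
    (WittVector.frobenius^[i]) (1 : WittVector p R) = 1 := by
  induction i with
  | zero => rfl
  | succ i ih => rw [Function.iterate_succ_apply, map_one, ih]

theorem frob_iter_mul (i : ℕ) (x y : WittVector p R) :
    (WittVector.frobenius^[i]) (x * y) =
      (WittVector.frobenius^[i]) x * (WittVector.frobenius^[i]) y := by
  induction i generalizing x y with
  | zero => rfl
  | succ i ih => rw [Function.iterate_succ_apply, map_mul, ih]; rfl

theorem mulLeft_frobEnd (a : WittVector p R) (i : ℕ) (x : WittVector p R) :
    (AddMonoid.End.mulLeft a * frobEnd p ^ i : AddMonoid.End (WittVector p R)) x =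
      a * (WittVector.frobenius^[i]) x := by
  rw [← frobEnd_pow]; rfl

theorem end_ext {a b : AddMonoid.End (WittVector p R)} (h : ∀ x, a x = b x) : a = b :=
  AddMonoidHom.ext h

theorem end_sum {α : Type*} (t : Finset α) (f : α → AddMonoid.End (WittVector p R))
    (x : WittVector p R) : (∑ i ∈ t, f i) x = ∑ i ∈ t, f i x :=
  AddMonoidHom.finsetSum_apply _ _ _

/-- Twisted power series inside the power series over the additive endomorphisms of Witt vectors. -/
noncomputable def iota (f : ℕ → WittVector p R) : PowerSeries (AddMonoid.End (WittVector p R)) :=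
  PowerSeries.mk fun s => AddMonoid.End.mulLeft (f s) * frobEnd p ^ s

theorem iota_conv (f g : ℕ → WittVector p R) :
    iota p (conv p f g) = iota p f * iota p g := by
  ext s : 1
  refine end_ext p fun x => ?_
  rw [PowerSeries.coeff_mul, end_sum]
  simp only [iota, PowerSeries.coeff_mk]
  rw [mulLeft_frobEnd, conv, Finset.sum_mul]
  refine Finset.sum_congr rfl fun y hy => ?_
  change _ = (AddMonoid.End.mulLeft (f y.1) * frobEnd p ^ y.1 : AddMonoid.End (WittVector p R))
    ((AddMonoid.End.mulLeft (g y.2) * frobEnd p ^ y.2 : AddMonoid.End (WittVector p R)) x)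
  rw [mulLeft_frobEnd, mulLeft_frobEnd, frob_iter_mul, ← Function.iterate_add_apply,
    mem_antidiagonal.1 hy, mul_assoc]

theorem coeff_iota_one (f : ℕ → WittVector p R) (s : ℕ) :
    PowerSeries.coeff s (iota p f) 1 = f s := by
  rw [iota, PowerSeries.coeff_mk, mulLeft_frobEnd, frob_iter_one, mul_one]

theorem iota_injective : Function.Injective (iota p (R := R)) := fun f g h => by
  ext1 s; rw [← coeff_iota_one p f, h, coeff_iota_one]

theorem conv_assoc (f g h : ℕ → WittVector p R) :
    conv p (conv p f g) h = conv p f (conv p g h) :=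
  iota_injective p (by simp [iota_conv, mul_assoc])

/-- Two sequences represent the same element when `S^n = p`: the difference is a multiple of `p - S^n`. -/
def Rel (f g : ℕ → WittVector p R) : Prop :=
  ∃ u, iota p f = iota p g + iota p u * ((p : PowerSeries _) - PowerSeries.X ^ n)

variable {p n}

theorem Rel.conv_right {f f' : ℕ → WittVector p R} (h : Rel p n f f') (g : ℕ → WittVector p R) :
    Rel p n (conv p f g) (conv p f' g) := by
  obtain ⟨u, hu⟩ := h
  refine ⟨conv p u g, ?_⟩
  have hc : Commute ((p : PowerSeries (AddMonoid.End (WittVector p R))) - PowerSeries.X ^ n)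
      (iota p g) := (Nat.cast_commute _ _).sub_left ((PowerSeries.commute_X _).symm.pow_left n)
  rw [iota_conv, iota_conv, iota_conv, hu, add_mul, mul_assoc, mul_assoc, hc.eq]

theorem Rel.conv_left {f f' : ℕ → WittVector p R} (h : Rel p n f f') (g : ℕ → WittVector p R) :
    Rel p n (conv p g f) (conv p g f') := by
  obtain ⟨u, hu⟩ := h
  exact ⟨conv p g u, by rw [iota_conv, iota_conv, iota_conv, hu, mul_add, mul_assoc]⟩

variable [CharP R p]

theorem frob_iter_eq (hR : ∀ x : R, x ^ p ^ n = x) (x : WittVector p R) :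
    (WittVector.frobenius^[n]) x = x := by
  ext i
  rw [WittVector.iterate_frobenius_coeff, hR]

theorem teich_conv (a b : ℕ → R) : conv p (teich p a) (teich p b) = twistedProd p a b := by
  ext1 s
  refine Finset.sum_congr rfl fun x _ => ?_
  have : ∀ (i : ℕ) (y : R), (WittVector.frobenius^[i]) (WittVector.teichmuller p y) =
      WittVector.teichmuller p (y ^ p ^ i) := by
    intro i
    induction i with
    | zero => simp
    | succ i ih =>
      intro y
      have h1 : WittVector.frobenius (WittVector.teichmuller p y) =
          WittVector.teichmuller p (frobenius R p y) := by
        rw [WittVector.frobenius_eq_map_frobenius, WittVector.map_teichmuller]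
      rw [Function.iterate_succ_apply, h1, ih, frobenius_def, ← pow_mul, pow_succ']
  rw [teich, teich, this, map_mul]

theorem rel_iff (hR : ∀ x : R, x ^ p ^ n = x) (f g : ℕ → WittVector p R) :
    Rel p n f g ↔ ∃ u : ℕ → WittVector p R,
      ∀ s, f s = g s + (p * u s - if n ≤ s then u (s - n) else 0) := by
  have key : ∀ u : ℕ → WittVector p R,
      iota p u * ((p : PowerSeries (AddMonoid.End (WittVector p R))) - PowerSeries.X ^ n) =
        iota p (fun s => (p : WittVector p R) * u s - if n ≤ s then u (s - n) else 0) := by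
    intro u
    ext s : 1
    rw [mul_sub, map_sub, PowerSeries.coeff_mul_X_pow', ← Nat.cast_commute, ← nsmul_eq_mul,
      map_nsmul]
    simp only [iota, PowerSeries.coeff_mk]
    refine end_ext p fun x => ?_
    have h1 : ∀ (a b : AddMonoid.End (WittVector p R)), (a - b) x = a x - b x := fun _ _ => rfl
    have h2 : ∀ (a : AddMonoid.End (WittVector p R)), (p • a) x = p * a x := fun a => by
      rw [← nsmul_eq_mul]; rfl
    rw [h1, h2, mulLeft_frobEnd, mulLeft_frobEnd, sub_mul, mul_assoc]
    congr 1
    split_ifs with hs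
    · rw [mulLeft_frobEnd]
      conv_rhs => rw [← Nat.sub_add_cancel hs, Function.iterate_add_apply, frob_iter_eq hR,
        Nat.sub_add_cancel hs]
    · rw [zero_mul]; rfl
  have hadd : ∀ u v : ℕ → WittVector p R, iota p (u + v) = iota p u + iota p v := by
    intro u v; ext s : 1; simp [iota, add_mul]
  constructor
  · rintro ⟨u, hu⟩
    refine ⟨u, fun s => ?_⟩
    rw [key, ← hadd] at hu
    exact congrFun (iota_injective p hu) s
  · rintro ⟨u, hu⟩
    refine ⟨u, ?_⟩
    rw [key, ← hadd]
    congr 1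
    ext1 s; exact hu s


section perfect
variable [NeZero n]

theorem perfectRing_of (hR : ∀ x : R, x ^ p ^ n = x) : PerfectRing R p := by
  have hn : n - 1 + 1 = n := Nat.sub_add_cancel (Nat.one_le_iff_ne_zero.2 (NeZero.ne n))
  constructor
  constructor
  · intro x y h
    have h' : x ^ p = y ^ p := h
    rw [← hR x, ← hR y, ← hn, pow_succ', pow_mul, pow_mul, h']
  · intro x
    refine ⟨x ^ p ^ (n - 1), ?_⟩
    change (x ^ p ^ (n - 1)) ^ p = x
    rw [← pow_mul, ← pow_succ, hn, hR]

theorem dvd_sub_iff (hR : ∀ x : R, x ^ p ^ n = x) (x y : WittVector p R) (m : ℕ) :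
    (p : WittVector p R) ^ m ∣ x - y ↔ ∀ i < m, x.coeff i = y.coeff i := by
  have := perfectRing_of (p := p) hR
  rw [← Ideal.mem_span_singleton, WittVector.mem_span_p_pow_iff_le_coeff_eq_zero,
    ← WittVector.le_coeff_eq_iff_le_sub_coeff_eq_zero]

theorem psum_of_lt (f : ℕ → WittVector p R) {s : ℕ} (h : s < n) : wittPartial p n f s = f s := by
  simp [wittPartial, Nat.div_eq_of_lt h, Nat.mod_eq_of_lt h]

theorem psum_of_le (f : ℕ → WittVector p R) {s : ℕ} (h : n ≤ s) :
    wittPartial p n f s = wittPartial p n f (s - n) + f s * (p : WittVector p R) ^ (s / n) := by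
  have hn : 0 < n := Nat.pos_of_ne_zero (NeZero.ne n)
  have h1 : s / n = (s - n) / n + 1 := by rw [Nat.div_eq_sub_div hn h]
  rw [wittPartial, Finset.sum_range_succ, Nat.mod_add_div, wittPartial, ← Nat.mod_eq_sub_mod h, h1]

theorem digit_congr (hR : ∀ x : R, x ^ p ^ n = x) {f g : ℕ → WittVector p R} (h : Rel p n f g) (s : ℕ) :
    hondaDigit p n f s = hondaDigit p n g s := by
  obtain ⟨u, hu⟩ := (rel_iff hR f g).1 h
  have hn : 0 < n := Nat.pos_of_ne_zero (NeZero.ne n)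
  have key : ∀ s, wittPartial p n f s - wittPartial p n g s = (p : WittVector p R) ^ (s / n + 1) * u s := by
    intro s
    induction s using Nat.strong_induction_on with
    | _ s ih =>
      rcases lt_or_ge s n with hs | hs
      · rw [psum_of_lt f hs, psum_of_lt g hs, hu, if_neg (not_le.2 hs), Nat.div_eq_of_lt hs]
        ring
      · rw [psum_of_le f hs, psum_of_le g hs, hu s, if_pos hs]
        have := ih (s - n) (by omega)
        rw [← Nat.div_eq_sub_div hn hs] at this
        linear_combination this
  rw [hondaDigit, hondaDigit, (dvd_sub_iff hR _ _ _).1 ⟨u s, key s⟩ _ (Nat.lt_succ_self _)]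

theorem psum_teich_coeff (a : ℕ → R) (s i : ℕ) (hi : i ≤ s / n) :
    (wittPartial p n (teich p a) s).coeff i = a (s % n + n * i) ^ p ^ i := by
  rw [wittPartial, WittVector.sum_coeff_eq_coeff_sum]
  · rw [Finset.sum_eq_single i]
    · rw [teich, WittVector.teichmuller_mul_pow_coeff]
    · intro b _ hb
      rw [teich, WittVector.teichmuller_mul_pow_coeff_of_ne _ hb.symm]
    · intro h
      exact absurd (Finset.mem_range.2 (by omega)) h
  · refine fun m => ⟨fun ⟨a', _, ha⟩ ⟨b', _, hb⟩ => Subtype.ext ?_⟩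
    by_contra hab
    have hab : a' ≠ b' := hab
    rcases eq_or_ne m a' with rfl | hm
    · exact hb (WittVector.teichmuller_mul_pow_coeff_of_ne _ hab)
    · exact ha (WittVector.teichmuller_mul_pow_coeff_of_ne _ hm)

theorem pow_pow_mul (hR : ∀ x : R, x ^ p ^ n = x) (x : R) (i : ℕ) : (x ^ p ^ ((n - 1) * i)) ^ p ^ i = x := by
  have hn : n - 1 + 1 = n := Nat.sub_add_cancel (Nat.one_le_iff_ne_zero.2 (NeZero.ne n))
  have h1 : (n - 1) * i + i = n * i := by
    rw [← Nat.succ_mul, Nat.succ_eq_add_one, hn]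
  rw [← pow_mul, ← pow_add, h1]
  induction i with
  | zero => simp
  | succ i ih =>
    have := ih (by rw [← Nat.succ_mul, Nat.succ_eq_add_one, hn])
    rw [Nat.mul_succ, pow_add, pow_mul, this, hR]

theorem digit_teich (hR : ∀ x : R, x ^ p ^ n = x) (a : ℕ → R) (s : ℕ) : hondaDigit p n (teich p a) s = a s := by
  rw [hondaDigit, psum_teich_coeff _ _ _ le_rfl, Nat.mod_add_div, ← pow_mul, mul_comm, pow_mul,
    pow_pow_mul hR]

theorem psum_coeff_le (hR : ∀ x : R, x ^ p ^ n = x) (f : ℕ → WittVector p R) (s : ℕ) : ∀ i ≤ s / n,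
    (wittPartial p n f s).coeff i = (wittPartial p n f (s % n + n * i)).coeff i := by
  have hn : 0 < n := Nat.pos_of_ne_zero (NeZero.ne n)
  induction s using Nat.strong_induction_on with
  | _ s ih =>
    intro i hi
    rcases hi.lt_or_eq with hlt | rfl
    · have hs : n ≤ s := by
        by_contra hh
        rw [Nat.div_eq_of_lt (by omega)] at hlt
        omega
      have h1 : s / n = (s - n) / n + 1 := by rw [Nat.div_eq_sub_div hn hs]
      have h2 : s % n = (s - n) % n := Nat.mod_eq_sub_mod hs
      rw [h2, ← ih (s - n) (by omega) i (by omega)]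
      refine (dvd_sub_iff hR _ _ (s / n)).1 ⟨f s, ?_⟩ i hlt
      rw [psum_of_le f hs]; ring
    · rw [Nat.mod_add_div]

theorem rel_teich_digit (hR : ∀ x : R, x ^ p ^ n = x) (f : ℕ → WittVector p R) : Rel p n (teich p (hondaDigit p n f)) f := by
  have hn : 0 < n := Nat.pos_of_ne_zero (NeZero.ne n)
  have := perfectRing_of (p := p) hR
  have key : ∀ s, (p : WittVector p R) ^ (s / n + 1) ∣
      wittPartial p n (teich p (hondaDigit p n f)) s - wittPartial p n f s := by
    intro s
    rw [dvd_sub_iff hR]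
    intro i hi
    rw [psum_teich_coeff _ _ _ (by omega), psum_coeff_le hR f s i (by omega), hondaDigit]
    have h1 : (s % n + n * i) / n = i := by
      rw [Nat.add_mul_div_left _ _ hn, Nat.div_eq_of_lt (Nat.mod_lt _ hn), zero_add]
    rw [h1, pow_pow_mul hR]
  choose u hu using key
  rw [rel_iff hR]
  refine ⟨u, fun s => ?_⟩
  rcases lt_or_ge s n with hs | hs
  · have := hu s
    rw [psum_of_lt _ hs, psum_of_lt _ hs, Nat.div_eq_of_lt hs] at this
    rw [if_neg (not_le.2 hs)]
    linear_combination this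
  · have h1 := hu s
    have h2 := hu (s - n)
    rw [← Nat.div_eq_sub_div hn hs] at h2
    rw [psum_of_le _ hs, psum_of_le f hs] at h1
    rw [if_pos hs]
    have hcancel : ∀ (m : ℕ) (x : WittVector p R), x * (p : WittVector p R) ^ m = 0 → x = 0 := by
      intro m
      induction m with
      | zero => intro x hx; simpa using hx
      | succ m ih =>
        intro x hx
        rw [pow_succ, ← mul_assoc] at hx
        exact ih x (WittVector.eq_zero_of_p_mul_eq_zero _ hx)
    rw [← sub_eq_zero]
    apply hcancel (s / n)
    linear_combination h1 - h2

theorem digit_assoc (hR : ∀ x : R, x ^ p ^ n = x) (a b c : ℕ → R) (s : ℕ) :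
    hondaDigit p n (twistedProd p (hondaDigit p n (twistedProd p a b)) c) s =
      hondaDigit p n (twistedProd p a (hondaDigit p n (twistedProd p b c))) s := by
  have h1 := (rel_teich_digit hR (twistedProd p a b)).conv_right (teich p c)
  have h2 := (rel_teich_digit hR (twistedProd p b c)).conv_left (teich p a)
  rw [teich_conv, ← teich_conv a b, conv_assoc] at h1
  rw [teich_conv, ← teich_conv b c] at h2
  rw [← teich_conv a b, ← teich_conv b c, digit_congr hR h1, digit_congr hR h2]

end perfect

end Witt

section tensorFacts
variable {p : ℕ} [Fact p.Prime] {n : ℕ} {A B : Type} [CommRing A] [Algebra (ZMod p) A]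
  [CommRing B] [Algebra (ZMod p) B]

theorem charP_of_augmented (ε : A →ₐ[ZMod p] ZMod p) : CharP A p := by
  have : Nontrivial A := ε.toRingHom.domain_nontrivial
  exact charP_of_injective_algebraMap (algebraMap (ZMod p) A).injective p

theorem charP_tensor (ε : A →ₐ[ZMod p] ZMod p) (ε' : B →ₐ[ZMod p] ZMod p) :
    CharP (A ⊗[ZMod p] B) p :=
  charP_of_augmented (Algebra.TensorProduct.lift ε ε' fun _ _ => Commute.all _ _)

theorem fixed_tensor [CharP (A ⊗[ZMod p] B) p] (hA : ∀ x : A, x ^ p ^ n = x)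
    (hB : ∀ x : B, x ^ p ^ n = x) (x : A ⊗[ZMod p] B) : x ^ p ^ n = x := by
  induction x using TensorProduct.induction_on with
  | zero => exact zero_pow (pow_ne_zero _ (Fact.out : p.Prime).ne_zero)
  | tmul a b => rw [Algebra.TensorProduct.tmul_pow, hA, hB]
  | add x y hx hy => rw [add_pow_char_pow, hx, hy]

end tensorFacts

theorem sum_antidiagonal_assoc {M : Type*} [AddCommMonoid M] (F : ℕ → ℕ → ℕ → M) (s : ℕ) :
    ∑ x ∈ antidiagonal s, ∑ y ∈ antidiagonal x.1, F y.1 y.2 x.2 =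
      ∑ x ∈ antidiagonal s, ∑ y ∈ antidiagonal x.2, F x.1 y.1 y.2 := by
  rw [Finset.sum_sigma', Finset.sum_sigma']
  refine Finset.sum_nbij' (fun z => ⟨(z.2.1, z.2.2 + z.1.2), (z.2.2, z.1.2)⟩)
    (fun z => ⟨(z.1.1 + z.2.1, z.2.2), (z.1.1, z.2.1)⟩) ?_ ?_ ?_ ?_ ?_ <;>
  rintro ⟨⟨a, b⟩, ⟨c, d⟩⟩ h <;> simp at h ⊢ <;> omega

section T
variable (p n k : ℕ)

/-- Indices of the generators `ξ_i` of `T(n,k)`: `k ≤ i ≤ n + k - 1`. -/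
abbrev TIdx : Type := {i : ℕ // k ≤ i ∧ i < n + k}

/-- The algebra `T(n,k) = (Z/p)[ξ_i | k ≤ i ≤ n + k - 1]`. -/
def T : Type := MvPolynomial (TIdx n k) (ZMod p)

noncomputable instance : CommRing (T p n k) := inferInstanceAs (CommRing (MvPolynomial _ _))
noncomputable instance : Algebra (ZMod p) (T p n k) :=
  inferInstanceAs (Algebra (ZMod p) (MvPolynomial _ _))

/-- The polynomial generator `ξ_i`. -/
noncomputable def T.gen (i : TIdx n k) : T p n k :=
  (MvPolynomial.X i : MvPolynomial (TIdx n k) (ZMod p))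

/-- The elements `ξ_i` with the conventions `ξ_0 = 1` and `ξ_i = 0` for other `i` outside the range. -/
noncomputable def T.xi (i : ℕ) : T p n k :=
  if i = 0 then 1
  else if h : k ≤ i ∧ i < n + k then T.gen p n k ⟨i, h⟩
  else 0

/-- Algebra maps out of `T(n,k)` are determined by the images of the generators. -/
noncomputable def T.lift {B : Type} [CommRing B] [Algebra (ZMod p) B] (f : TIdx n k → B) :
    T p n k →ₐ[ZMod p] B :=
  (MvPolynomial.aeval f : MvPolynomial (TIdx n k) (ZMod p) →ₐ[ZMod p] B)

/-- The augmentation `ξ_i ↦ 0`. -/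
noncomputable def T.counit : T p n k →ₐ[ZMod p] ZMod p := T.lift p n k fun _ => 0

/-- The coproduct `Δ ξ_i = ∑ ξ_a ⊗ ξ_b^(p^a)` over `a + b = i`; with the conventions for `T.xi` this is
`ξ_i ⊗ 1 + ∑_{k ≤ r ≤ i - k} ξ_r ⊗ ξ_{i-r}^(p^r) + 1 ⊗ ξ_i`. -/
noncomputable def T.comul : T p n k →ₐ[ZMod p] T p n k ⊗[ZMod p] T p n k :=
  T.lift p n k fun i =>
    ∑ x ∈ antidiagonal i.1, T.xi p n k x.1 ⊗ₜ[ZMod p] (T.xi p n k x.2 ^ p ^ x.1)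

variable {p n k}

theorem T.lift_xi [NeZero k] {B : Type} [CommRing B] [Algebra (ZMod p) B] (f : TIdx n k → B)
    (i : TIdx n k) : T.lift p n k f (T.xi p n k i.1) = f i := by
  have h0 : i.1 ≠ 0 := by have := NeZero.ne k; have := i.2.1; omega
  rw [T.xi, if_neg h0, dif_pos i.2]
  exact MvPolynomial.aeval_X f i

theorem T.hom_ext [NeZero k] {B : Type} [CommRing B] [Algebra (ZMod p) B]
    {f g : T p n k →ₐ[ZMod p] B} (h : ∀ i : TIdx n k, f (T.xi p n k i.1) = g (T.xi p n k i.1)) :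
    f = g := by
  refine MvPolynomial.algHom_ext (A := B) fun i => ?_
  have h0 : i.1 ≠ 0 := by have := NeZero.ne k; have := i.2.1; omega
  have := h i
  rw [T.xi, if_neg h0, dif_pos i.2] at this
  exact this

theorem T.counit_xi [NeZero k] (i : ℕ) : T.counit p n k (T.xi p n k i) = if i = 0 then 1 else 0 := by
  by_cases h0 : i = 0
  · simp [T.xi, h0]
  · by_cases h : k ≤ i ∧ i < n + k
    · rw [if_neg h0]; exact T.lift_xi _ ⟨i, h⟩
    · simp [T.xi, h0, h]

theorem T.comul_xi [NeZero k] (i : ℕ) (hi : i < n + k) : T.comul p n k (T.xi p n k i) =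
    ∑ x ∈ antidiagonal i, T.xi p n k x.1 ⊗ₜ[ZMod p] (T.xi p n k x.2 ^ p ^ x.1) := by
  by_cases h : k ≤ i ∧ i < n + k
  · exact T.lift_xi _ ⟨i, h⟩
  · have hk : i < k := by omega
    rcases Nat.eq_zero_or_pos i with rfl | h0
    · simp [T.xi, Algebra.TensorProduct.one_def]
    · rw [Finset.sum_eq_zero, T.xi, if_neg h0.ne', dif_neg h, map_zero]
      rintro ⟨a, b⟩ hx
      have hab : a + b = i := mem_antidiagonal.1 hx
      rcases Nat.eq_zero_or_pos a with rfl | ha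
      · have : T.xi p n k b = 0 := by
          rw [T.xi, if_neg (by omega), dif_neg (by omega)]
        simp [this]
      · have : T.xi p n k a = 0 := by
          rw [T.xi, if_neg (by omega), dif_neg (by omega)]
        simp [this]

/-- `T(n,k)` is a bialgebra (connected graded, hence a Hopf algebra). -/
noncomputable instance T.bialgebra [Fact p.Prime] [NeZero k] : Bialgebra (ZMod p) (T p n k) := by
  have hT : CharP (T p n k) p := charP_of_augmented (T.counit p n k)
  have hTT : CharP (T p n k ⊗[ZMod p] T p n k) p := charP_tensor (T.counit p n k) (T.counit p n k)
  refine Bialgebra.ofAlgHom (T.comul p n k) (T.counit p n k) ?_ ?_ ?_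
  · refine T.hom_ext fun i => ?_
    have h1 : ∀ j ≤ i.1, T.comul p n k (T.xi p n k j) = _ := fun j hj =>
      T.comul_xi j (hj.trans_lt i.2.2)
    simp only [AlgHom.comp_apply, h1 _ le_rfl, map_sum, Algebra.TensorProduct.map_tmul]
    trans ∑ x ∈ antidiagonal i.1, ∑ y ∈ antidiagonal x.1,
      T.xi p n k y.1 ⊗ₜ[ZMod p] ((T.xi p n k y.2 ^ p ^ y.1) ⊗ₜ[ZMod p] (T.xi p n k x.2 ^ p ^ (y.1 + y.2)))
    · refine Finset.sum_congr rfl fun x hx => ?_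
      rw [h1 x.1 (by have := mem_antidiagonal.1 hx; omega), TensorProduct.sum_tmul, map_sum]
      refine Finset.sum_congr rfl fun y hy => ?_
      rw [mem_antidiagonal.1 hy]
      rfl
    · rw [sum_antidiagonal_assoc fun a b c =>
        T.xi p n k a ⊗ₜ[ZMod p] ((T.xi p n k b ^ p ^ a) ⊗ₜ[ZMod p] (T.xi p n k c ^ p ^ (a + b)))]
      refine Finset.sum_congr rfl fun x hx => ?_
      rw [map_pow, h1 x.2 (by have := mem_antidiagonal.1 hx; omega), sum_pow_char_pow,
        TensorProduct.tmul_sum]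
      refine Finset.sum_congr rfl fun y _ => ?_
      rw [Algebra.TensorProduct.tmul_pow, ← pow_mul, ← pow_add, add_comm y.1]
      rfl
  · refine T.hom_ext fun i => ?_
    simp only [AlgHom.comp_apply, T.comul_xi _ i.2.2, map_sum, Algebra.TensorProduct.map_tmul]
    rw [Finset.sum_eq_single (0, i.1)]
    · simp [T.counit_xi]
    · rintro ⟨a, b⟩ hx hne
      have hab : a + b = i.1 := mem_antidiagonal.1 hx
      have : a ≠ 0 := by rintro rfl; exact hne (by rw [← hab, zero_add])
      simp [T.counit_xi, this]
    · simp
  · refine T.hom_ext fun i => ?_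
    simp only [AlgHom.comp_apply, T.comul_xi _ i.2.2, map_sum, Algebra.TensorProduct.map_tmul]
    rw [Finset.sum_eq_single (i.1, 0)]
    · simp [T.counit_xi]
    · rintro ⟨a, b⟩ hx hne
      have hab : a + b = i.1 := mem_antidiagonal.1 hx
      have : b ≠ 0 := by rintro rfl; exact hne (by rw [← hab, add_zero])
      have hp : (0 : ZMod p) ^ p ^ a = 0 := zero_pow (pow_ne_zero _ (Fact.out : p.Prime).ne_zero)
      simp [T.counit_xi, this, hp]
    · simp

end T

section S
variable (p n k : ℕ)

/-- Indices of the generators `t_i` of `S(n,k)`: `k ≤ i`. -/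
abbrev SIdx : Type := {i : ℕ // k ≤ i}

/-- The algebra `S(n,k) = (Z/p)[t_i | i ≥ k] / (t_i^(p^n) - t_i)`. -/
def S : Type := MvPolynomial (SIdx k) (ZMod p) ⧸
  Ideal.span (Set.range fun i : SIdx k =>
    (MvPolynomial.X i ^ p ^ n - MvPolynomial.X i : MvPolynomial (SIdx k) (ZMod p)))

noncomputable instance : CommRing (S p n k) := inferInstanceAs (CommRing (_ ⧸ _))
noncomputable instance : Algebra (ZMod p) (S p n k) :=
  inferInstanceAs (Algebra (ZMod p) (MvPolynomial (SIdx k) (ZMod p) ⧸ _))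

/-- The quotient map onto `S(n,k)`. -/
noncomputable def S.mk : MvPolynomial (SIdx k) (ZMod p) →ₐ[ZMod p] S p n k :=
  Ideal.Quotient.mkₐ (ZMod p) _

/-- The elements `t_i` of `S(n,k)`, with `t_0 = 1` and `t_i = 0` for `0 < i < k`. -/
noncomputable def S.t (i : ℕ) : S p n k :=
  if i = 0 then 1 else if h : k ≤ i then S.mk p n k (MvPolynomial.X ⟨i, h⟩) else 0

variable {p n k}

/-- Algebra maps out of `S(n,k)`. -/
noncomputable def S.lift {B : Type} [CommRing B] [Algebra (ZMod p) B] (f : SIdx k → B)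
    (hf : ∀ i, f i ^ p ^ n = f i) : S p n k →ₐ[ZMod p] B :=
  Ideal.Quotient.liftₐ _ (MvPolynomial.aeval f) (fun a ha => by
    have hle : Ideal.span (Set.range fun i : SIdx k =>
        (MvPolynomial.X i ^ p ^ n - MvPolynomial.X i : MvPolynomial (SIdx k) (ZMod p))) ≤
        RingHom.ker (MvPolynomial.aeval f : MvPolynomial (SIdx k) (ZMod p) →ₐ[ZMod p] B) := by
      rw [Ideal.span_le]
      rintro _ ⟨i, rfl⟩
      simp [RingHom.mem_ker, hf]
    exact hle ha)

theorem S.tt_coe [NeZero k] (i : SIdx k) : S.t p n k i.1 = S.mk p n k (MvPolynomial.X i) := by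
  have h0 : i.1 ≠ 0 := by have := NeZero.ne k; have := i.2; omega
  rw [S.t, if_neg h0, dif_pos i.2]

theorem S.lift_tt [NeZero k] {B : Type} [CommRing B] [Algebra (ZMod p) B] (f : SIdx k → B)
    (hf : ∀ i, f i ^ p ^ n = f i) (i : SIdx k) : S.lift f hf (S.t p n k i.1) = f i := by
  rw [S.tt_coe]
  exact MvPolynomial.aeval_X f i

theorem S.hom_ext [NeZero k] {B : Type} [CommRing B] [Algebra (ZMod p) B]
    {f g : S p n k →ₐ[ZMod p] B} (h : ∀ i : SIdx k, f (S.t p n k i.1) = g (S.t p n k i.1)) :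
    f = g := by
  refine Ideal.Quotient.algHom_ext _ (MvPolynomial.algHom_ext fun i => ?_)
  have := h i
  rw [S.tt_coe] at this
  exact this

/-- The augmentation `t_i ↦ 0`. -/
noncomputable def S.counit [Fact p.Prime] : S p n k →ₐ[ZMod p] ZMod p :=
  S.lift (fun _ => 0) fun _ => zero_pow (pow_ne_zero _ (Fact.out : p.Prime).ne_zero)

theorem S.counit_tt [Fact p.Prime] [NeZero k] (i : ℕ) :
    (S.counit : S p n k →ₐ[ZMod p] ZMod p) (S.t p n k i) = if i = 0 then 1 else 0 := by
  by_cases h0 : i = 0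
  · simp [S.t, h0]
  · by_cases h : k ≤ i
    · rw [if_neg h0]; exact S.lift_tt _ _ ⟨i, h⟩
    · simp [S.t, h0, h]

instance S.charP [Fact p.Prime] : CharP (S p n k) p := charP_of_augmented S.counit

instance S.charP₂ [Fact p.Prime] : CharP (S p n k ⊗[ZMod p] S p n k) p :=
  charP_tensor S.counit S.counit

instance S.charP₃ [Fact p.Prime] :
    CharP (S p n k ⊗[ZMod p] (S p n k ⊗[ZMod p] S p n k)) p :=
  charP_tensor S.counit (Algebra.TensorProduct.lift S.counit S.counit fun _ _ => Commute.all _ _)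

theorem S.pow_eq [Fact p.Prime] (x : S p n k) : x ^ p ^ n = x := by
  obtain ⟨y, rfl⟩ := Ideal.Quotient.mk_surjective x
  change S.mk p n k y ^ p ^ n = S.mk p n k y
  induction y using MvPolynomial.induction_on with
  | C a =>
    rw [← map_pow, ← map_pow]
    congr 2
    exact ZMod.pow_card_pow a
  | add f g hf hg => rw [map_add, add_pow_char_pow, hf, hg]
  | mul_X f i hf =>
    rw [map_mul, mul_pow, hf, ← map_pow]
    congr 1
    exact Ideal.Quotient.eq.2 (Ideal.subset_span ⟨i, rfl⟩)

theorem S.pow_eq₂ [Fact p.Prime] (x : S p n k ⊗[ZMod p] S p n k) : x ^ p ^ n = x :=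
  fixed_tensor S.pow_eq S.pow_eq x

theorem S.pow_eq₃ [Fact p.Prime] (x : S p n k ⊗[ZMod p] (S p n k ⊗[ZMod p] S p n k)) :
    x ^ p ^ n = x :=
  fixed_tensor S.pow_eq S.pow_eq₂ x

variable (p n k) in
/-- The elements `Δ(t_s)` of the Morava stabilizer algebra. In `K(n)_*K(n)` with `v_n = 1` they are
determined by `∑^F Δ(t_s) = ∑^F t_i ⊗ t_j^(p^i)`, where `F` is the Honda formal group law of height
`n` (Hazewinkel generators). As `∑^F a_s x^(p^s)` with `a_s^(p^n) = a_s` corresponds to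
`∑ [a_s] S^s` with `S^n = p` and `S w = Frob(w) S`, this says that the `Δ(t_s)` are the Teichmuller
digits of `(∑ [t_i ⊗ 1] S^i) (∑ [1 ⊗ t_j] S^j)`. For `s < n + k` the result is
`∑ t_i ⊗ t_j^(p^i)` (see `S.diag_eq`); the first carry contributes `-b_{s-n,n-1}`. -/
noncomputable def S.diag [Fact p.Prime] (s : ℕ) : S p n k ⊗[ZMod p] S p n k :=
  hondaDigit p n (twistedProd p (fun i => S.t p n k i ⊗ₜ[ZMod p] 1) (fun i => (1 : S p n k) ⊗ₜ[ZMod p] S.t p n k i)) s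

/-- The coproduct of `S(n,k)`. -/
noncomputable def S.comul [Fact p.Prime] : S p n k →ₐ[ZMod p] S p n k ⊗[ZMod p] S p n k :=
  S.lift (fun i => S.diag p n k i.1) fun _ => S.pow_eq₂ _

theorem digit_congr_le {p n : ℕ} [Fact p.Prime] [NeZero n] {R : Type*} [CommRing R]
    {f g : ℕ → WittVector p R} {s : ℕ}
    (h : ∀ i ≤ s, f i = g i) : hondaDigit p n f s = hondaDigit p n g s := by
  rw [hondaDigit, hondaDigit, wittPartial, wittPartial]
  congr 2
  refine Finset.sum_congr rfl fun r hr => ?_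
  have h1 : n * r ≤ n * (s / n) := Nat.mul_le_mul_left _ (by have := mem_range.1 hr; omega)
  rw [h _ (by have := Nat.mod_add_div s n; omega)]

theorem S.twMul_of_lt [Fact p.Prime] [NeZero k] {i : ℕ} (hi : i < k) :
    twistedProd p (fun i => S.t p n k i ⊗ₜ[ZMod p] (1 : S p n k))
      (fun i => (1 : S p n k) ⊗ₜ[ZMod p] S.t p n k i) i =
    teich p (fun i => if i = 0 then 1 else 0) i := by
  rw [twistedProd, teich]
  rcases Nat.eq_zero_or_pos i with rfl | h0
  · simp [S.t, ← Algebra.TensorProduct.one_def]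
  · rw [if_neg h0.ne', WittVector.teichmuller_zero]
    refine Finset.sum_eq_zero ?_
    rintro ⟨a, b⟩ hx
    have hab : a + b = i := mem_antidiagonal.1 hx
    rcases Nat.eq_zero_or_pos a with rfl | ha
    · have : S.t p n k b = 0 := by rw [S.t, if_neg (by omega), dif_neg (by omega)]
      simp [this, WittVector.teichmuller_zero]
    · have : S.t p n k a = 0 := by rw [S.t, if_neg (by omega), dif_neg (by omega)]
      simp [this, WittVector.teichmuller_zero]

theorem S.diag_of_lt [Fact p.Prime] [NeZero n] [NeZero k] {s : ℕ} (hs : s < k) :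
    S.diag p n k s = if s = 0 then 1 else 0 := by
  rw [S.diag, digit_congr_le (g := teich p fun i => if i = 0 then 1 else 0), digit_teich S.pow_eq₂]
  exact fun i hi => S.twMul_of_lt (by omega)

theorem S.comul_tt [Fact p.Prime] [NeZero n] [NeZero k] (s : ℕ) :
    (S.comul : S p n k →ₐ[ZMod p] _) (S.t p n k s) = S.diag p n k s := by
  by_cases h : k ≤ s
  · exact S.lift_tt _ _ ⟨s, h⟩
  · rw [S.diag_of_lt (by omega)]
    by_cases h0 : s = 0 <;> simp [S.t, h0, h]

/-- `S(n,k)` is a bialgebra. -/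
noncomputable instance S.bialgebra [Fact p.Prime] [NeZero n] [NeZero k] :
    Bialgebra (ZMod p) (S p n k) := by
  have map_diag : ∀ {B : Type} [CommRing B] [Algebra (ZMod p) B]
      (φ : S p n k ⊗[ZMod p] S p n k →ₐ[ZMod p] B) (s : ℕ), φ (S.diag p n k s) =
      hondaDigit p n (twistedProd p (fun i => φ (S.t p n k i ⊗ₜ[ZMod p] (1 : S p n k)))
        (fun i => φ ((1 : S p n k) ⊗ₜ[ZMod p] S.t p n k i))) s := by
    intro B _ _ φ s
    change φ.toRingHom _ = _
    rw [S.diag, map_digit]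
    simp only [map_twMul]
    rfl
  refine Bialgebra.ofAlgHom S.comul S.counit ?_ ?_ ?_
  · refine S.hom_ext fun i => ?_
    have e1 : ∀ j, ((Algebra.TensorProduct.assoc (ZMod p) (ZMod p) (ZMod p) (S p n k) (S p n k)
        (S p n k)).toAlgHom.comp (Algebra.TensorProduct.map S.comul (.id (ZMod p) (S p n k))))
        (S.t p n k j ⊗ₜ[ZMod p] (1 : S p n k)) = hondaDigit p n (twistedProd p (fun i => S.t p n k i ⊗ₜ[ZMod p] (1 : S p n k ⊗[ZMod p] S p n k))
          (fun i => (1 : S p n k) ⊗ₜ[ZMod p] (S.t p n k i ⊗ₜ[ZMod p] (1 : S p n k)))) j := by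
      intro j
      rw [AlgHom.comp_apply, Algebra.TensorProduct.map_tmul, S.comul_tt]
      exact map_diag (((Algebra.TensorProduct.assoc (ZMod p) (ZMod p) (ZMod p) (S p n k)
        (S p n k) (S p n k)).toAlgHom).comp Algebra.TensorProduct.includeLeft) j
    have e2 : ∀ j, (Algebra.TensorProduct.map (.id (ZMod p) (S p n k)) S.comul)
        ((1 : S p n k) ⊗ₜ[ZMod p] S.t p n k j) = hondaDigit p n (twistedProd p
          (fun i => (1 : S p n k) ⊗ₜ[ZMod p] (S.t p n k i ⊗ₜ[ZMod p] (1 : S p n k)))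
          (fun i => (1 : S p n k) ⊗ₜ[ZMod p] ((1 : S p n k) ⊗ₜ[ZMod p] S.t p n k i))) j := by
      intro j
      rw [Algebra.TensorProduct.map_tmul, S.comul_tt]
      exact map_diag (Algebra.TensorProduct.includeRight :
        S p n k ⊗[ZMod p] S p n k →ₐ[ZMod p] S p n k ⊗[ZMod p] (S p n k ⊗[ZMod p] S p n k)) j
    rw [← AlgHom.comp_assoc, AlgHom.comp_apply, AlgHom.comp_apply (Algebra.TensorProduct.map _ _),
      S.comul_tt, map_diag, map_diag]
    simp only [e1, e2]
    have e3 : ∀ j, ((Algebra.TensorProduct.assoc (ZMod p) (ZMod p) (ZMod p) (S p n k) (S p n k)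
        (S p n k)).toAlgHom.comp (Algebra.TensorProduct.map S.comul (.id (ZMod p) (S p n k))))
        ((1 : S p n k) ⊗ₜ[ZMod p] S.t p n k j) = 1 ⊗ₜ[ZMod p] ((1 : S p n k) ⊗ₜ[ZMod p] S.t p n k j) := by
      intro j
      rw [AlgHom.comp_apply, Algebra.TensorProduct.map_tmul, map_one]
      rfl
    have e4 : ∀ j, (Algebra.TensorProduct.map (.id (ZMod p) (S p n k)) S.comul)
        (S.t p n k j ⊗ₜ[ZMod p] (1 : S p n k)) = S.t p n k j ⊗ₜ[ZMod p] (1 : S p n k ⊗[ZMod p] S p n k) := by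
      intro j
      rw [Algebra.TensorProduct.map_tmul, map_one]
      rfl
    simp only [e3, e4]
    exact digit_assoc S.pow_eq₃ _ _ _ _
  · refine S.hom_ext fun i => ?_
    rw [AlgHom.comp_apply, S.comul_tt, map_diag]
    have h1 : twistedProd p (fun i => (Algebra.TensorProduct.map S.counit (.id (ZMod p) (S p n k)))
          (S.t p n k i ⊗ₜ[ZMod p] (1 : S p n k)))
        (fun i => (Algebra.TensorProduct.map S.counit (.id (ZMod p) (S p n k)))
          ((1 : S p n k) ⊗ₜ[ZMod p] S.t p n k i)) =
        fun i => WittVector.map (Algebra.TensorProduct.lid (ZMod p) (S p n k)).symm.toRingHom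
          (teich p (S.t p n k) i) := by
      funext j
      rw [twistedProd, Finset.sum_eq_single (0, j)]
      · simp [S.counit_tt, teich, WittVector.map_teichmuller]
      · rintro ⟨a, b⟩ hx hne
        have hab : a + b = j := mem_antidiagonal.1 hx
        have : a ≠ 0 := by rintro rfl; exact hne (by rw [← hab, zero_add])
        simp [S.counit_tt, this, WittVector.teichmuller_zero]
      · simp
    rw [h1, ← map_digit, digit_teich S.pow_eq]
    rfl
  · refine S.hom_ext fun i => ?_
    rw [AlgHom.comp_apply, S.comul_tt, map_diag]
    have h1 : twistedProd p (fun i => (Algebra.TensorProduct.map (.id (ZMod p) (S p n k)) S.counit)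
          (S.t p n k i ⊗ₜ[ZMod p] (1 : S p n k)))
        (fun i => (Algebra.TensorProduct.map (.id (ZMod p) (S p n k)) S.counit)
          ((1 : S p n k) ⊗ₜ[ZMod p] S.t p n k i)) =
        fun i => WittVector.map (Algebra.TensorProduct.rid (ZMod p) (ZMod p)
          (S p n k)).symm.toRingHom (teich p (S.t p n k) i) := by
      funext j
      rw [twistedProd, Finset.sum_eq_single (j, 0)]
      · simp [S.counit_tt, teich, WittVector.map_teichmuller]
      · rintro ⟨a, b⟩ hx hne
        have hab : a + b = j := mem_antidiagonal.1 hx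
        have : b ≠ 0 := by rintro rfl; exact hne (by rw [← hab, add_zero])
        have hp : p ^ a ≠ 0 := pow_ne_zero _ (Fact.out : p.Prime).ne_zero
        simp [S.counit_tt, this, WittVector.teichmuller_zero]
        rw [zero_pow hp, mul_zero]
      · simp
    rw [h1, ← map_digit, digit_teich S.pow_eq]
    rfl

end S

section pages

/-- A cochain complex of `K`-modules `C^0 → C^1 → …` with an inner grading by `G` and an increasing
filtration: `fil s t M` is the part of filtration `≤ M` of the inner degree `t` part of `C^s`. -/
structure FilteredCochain (K : Type) [CommRing K] (G : Type) where
  C : ℕ → ModuleCat.{0} K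
  d : ∀ s, C s →ₗ[K] C (s + 1)
  d_comp_d : ∀ s x, d (s + 1) (d s x) = 0
  fil : ∀ s, G → ℤ → Submodule K (C s)
  mono : ∀ s t, Monotone (fil s t)

namespace FilteredCochain
variable {K : Type} [CommRing K] {G G' : Type}

section
variable (X : FilteredCochain K G)

/-- `Z_r^{s,t,M}`: the elements of filtration `≤ M` whose differential has filtration `≤ M - r`. -/
def Z (r : ℤ) (s : ℕ) (t : G) (M : ℤ) : Submodule K (X.C s) :=
  X.fil s t M ⊓ (X.fil (s + 1) t (M - r)).comap (X.d s)

/-- `d(Z_r^{s-1,t,M})`, inside `C^s`. -/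
def dZ (r : ℤ) : ∀ (s : ℕ) (_ : G) (_ : ℤ), Submodule K (X.C s)
  | 0, _, _ => ⊥
  | s + 1, t, M => (X.Z r s t M).map (X.d s)

/-- The denominator `Z_{r-1}^{s,t,M-1} + d(Z_{r-1}^{s-1,t,M+r-1})` of the `r`-th page. -/
def den (r : ℤ) (s : ℕ) (t : G) (M : ℤ) : Submodule K (X.C s) :=
  X.Z (r - 1) s t (M - 1) ⊔ X.dZ (r - 1) s t (M + r - 1)

/-- The term `E_r^{s,t,M}` of the spectral sequence of the filtration,
`Z_r^{s,t,M} / (Z_{r-1}^{s,t,M-1} + d(Z_{r-1}^{s-1,t,M+r-1}))`. For `r = 1` this is the cohomology of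
the quotient complex `F^M / F^{M-1}`. -/
abbrev Page (r : ℕ) (s : ℕ) (t : G) (M : ℤ) : Type :=
  X.Z r s t M ⧸ (X.den r s t M).comap (X.Z r s t M).subtype

/-- The class in `E_r` of an element of `Z_r`. -/
def cls {r s : ℕ} {t : G} {M : ℤ} (z : X.Z r s t M) : X.Page r s t M := Submodule.Quotient.mk z

/-- The differential of the complex as a map `Z_r^{s,t,M} → Z_r^{s+1,t,M-r}`. -/
def dRestrict (r : ℤ) (s : ℕ) (t : G) (M : ℤ) : X.Z r s t M →ₗ[K] X.Z r (s + 1) t (M - r) :=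
  (X.d s).restrict fun x hx => ⟨hx.2, by
    change X.d (s + 1) (X.d s x) ∈ X.fil (s + 1 + 1) t (M - r - r)
    rw [X.d_comp_d]; exact Submodule.zero_mem _⟩

theorem d_dZ (r : ℤ) : ∀ (s : ℕ) (t : G) (M : ℤ), ∀ x ∈ X.dZ r s t M, X.d s x = 0
  | 0, _, _, x, hx => by rw [(Submodule.mem_bot K).1 hx, map_zero]
  | s + 1, _, _, _, hx => by
    obtain ⟨y, _, rfl⟩ := hx
    exact X.d_comp_d s y

/-- The differential `d_r : E_r^{s,t,M} → E_r^{s+1,t,M-r}`. -/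
def pageDiff (r : ℕ) (s : ℕ) (t : G) (M : ℤ) : X.Page r s t M →ₗ[K] X.Page r (s + 1) t (M - r) :=
  Submodule.mapQ _ _ (X.dRestrict r s t M) (by
    intro x hx
    obtain ⟨a, ha, b, hb, hab⟩ := Submodule.mem_sup.1 (Submodule.mem_comap.1 hx)
    refine Submodule.mem_comap.2 (Submodule.mem_comap.2 (Submodule.mem_sup_right ?_))
    refine ⟨a, ?_, ?_⟩
    · rwa [sub_add_cancel]
    · change X.d s a = X.d s x.1
      have h : a + b = x.1 := hab
      rw [← h, map_add, X.d_dZ _ _ _ _ b hb, add_zero])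

/-- `g ∈ E_1` is an infinite (permanent) cocycle: there are `γ_r ∈ E_r^{s,t,M}` with `γ_1 = g` such that,
for all `r ≥ 1`, `d_r γ_r = 0` and `γ_{r+1}` is the class of the cocycle `γ_r` in
`H(E_r, d_r) = E_{r+1}` (that is, both are represented by one element of `Z_{r+1} ⊆ Z_r`). -/
def IsInfiniteCocycle {X : FilteredCochain K G} {s : ℕ} {t : G} {M : ℤ} (g : X.Page 1 s t M) :
    Prop :=
  ∃ γ : ∀ r : ℕ, X.Page r s t M, γ 1 = g ∧ ∀ r ≥ 1, X.pageDiff r s t M (γ r) = 0 ∧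
    ∃ (z : X.Z r s t M) (z' : X.Z (r + 1 : ℕ) s t M), (z : X.C s) = z' ∧
      X.cls z = γ r ∧ X.cls z' = γ (r + 1)

end

/-- Maps of filtered complexes, covering a map `γ` of the inner gradings. -/
structure Hom (X : FilteredCochain K G) (Y : FilteredCochain K G') (γ : G → G') where
  f : ∀ s, X.C s →ₗ[K] Y.C s
  comm : ∀ s x, f (s + 1) (X.d s x) = Y.d s (f s x)
  fil_le : ∀ s t M, X.fil s t M ≤ (Y.fil s (γ t) M).comap (f s)

namespace Hom
variable {X : FilteredCochain K G} {Y : FilteredCochain K G'} {γ : G → G'} (F : X.Hom Y γ)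

theorem map_Z {r : ℤ} {s : ℕ} {t : G} {M : ℤ} {x : X.C s} (hx : x ∈ X.Z r s t M) :
    F.f s x ∈ Y.Z r s (γ t) M :=
  ⟨F.fil_le _ _ _ hx.1, by
    change Y.d s (F.f s x) ∈ Y.fil (s + 1) (γ t) (M - r)
    rw [← F.comm]; exact F.fil_le _ _ _ hx.2⟩

theorem map_dZ {r : ℤ} : ∀ {s : ℕ} {t : G} {M : ℤ} {x : X.C s}, x ∈ X.dZ r s t M →
    F.f s x ∈ Y.dZ r s (γ t) M
  | 0, _, _, x, hx => by
    rw [(Submodule.mem_bot K).1 hx, map_zero]; exact Submodule.zero_mem _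
  | s + 1, _, _, _, hx => by
    obtain ⟨y, hy, rfl⟩ := hx
    exact ⟨F.f s y, F.map_Z hy, (F.comm s y).symm⟩

/-- The induced map on `E_r`-terms. -/
def pageMap (r : ℕ) (s : ℕ) (t : G) (M : ℤ) : X.Page r s t M →ₗ[K] Y.Page r s (γ t) M :=
  Submodule.mapQ _ _ ((F.f s).restrict fun _ hx => F.map_Z hx) (by
    intro x hx
    obtain ⟨a, ha, b, hb, hab⟩ := Submodule.mem_sup.1 (Submodule.mem_comap.1 hx)
    refine Submodule.mem_comap.2 (Submodule.mem_comap.2 ?_)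
    have h : a + b = x.1 := hab
    change F.f s x.1 ∈ _
    rw [← h, map_add]
    exact Submodule.add_mem_sup (F.map_Z ha) (F.map_dZ hb))

end Hom
end FilteredCochain
end pages

section cobar

section coalg
variable {K V : Type} [CommRing K] [AddCommGroup V] [Module K V]

variable (K V) in
/-- The tensor powers `V ⊗ (V ⊗ (… ⊗ K))`. -/
noncomputable def Tens : ℕ → ModuleCat.{0} K
  | 0 => ModuleCat.of K K
  | s + 1 => ModuleCat.of K (V ⊗[K] Tens s)

/-- The element `[a_1 | a_2 | … | a_s]`. -/
noncomputable def bar : ∀ {s : ℕ}, (Fin s → V) → Tens K V s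
  | 0, _ => (1 : K)
  | _ + 1, a => a 0 ⊗ₜ[K] bar (Fin.tail a)

/-- Inductive step for the cobar differential: `v ⊗ m ↦ - δ(v) ⊗ m - v ⊗ e(m)`. -/
noncomputable def cobarStep (δ : V →ₗ[K] V ⊗[K] V) {M : Type} [AddCommGroup M] [Module K M]
    (e : M →ₗ[K] V ⊗[K] M) : V ⊗[K] M →ₗ[K] V ⊗[K] (V ⊗[K] M) :=
  -((TensorProduct.assoc K V V M).toLinearMap ∘ₗ δ.rTensor M) - e.lTensor V

/-- The cobar differential
`d[a_1 | … | a_s] = ∑_i (-1)^i [a_1 | … | δ(a_i) | … | a_s]`, with `d = 0` on `C^0`. -/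
noncomputable def cobarD (δ : V →ₗ[K] V ⊗[K] V) : ∀ s, Tens K V s →ₗ[K] Tens K V (s + 1)
  | 0 => 0
  | s + 1 => cobarStep δ (cobarD δ s)

theorem cobarStep_tmul (δ : V →ₗ[K] V ⊗[K] V) {M : Type} [AddCommGroup M] [Module K M]
    (e : M →ₗ[K] V ⊗[K] M) (v : V) (m : M) : cobarStep δ e (v ⊗ₜ[K] m) =
      -(TensorProduct.assoc K V V M (δ v ⊗ₜ[K] m)) - v ⊗ₜ[K] e m := rfl

theorem cobarStep_cobarStep (δ : V →ₗ[K] V ⊗[K] V)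
    (hδ : ∀ v, TensorProduct.assoc K V V V (δ.rTensor V (δ v)) = δ.lTensor V (δ v))
    {M : Type} [AddCommGroup M] [Module K M] (e : M →ₗ[K] V ⊗[K] M)
    (he : ∀ m, cobarStep δ e (e m) = 0) (x : V ⊗[K] M) :
    cobarStep δ (cobarStep δ e) (cobarStep δ e x) = 0 := by
  have key : ∀ (w : V ⊗[K] V) (m : M),
      cobarStep δ (cobarStep δ e) (TensorProduct.assoc K V V M (w ⊗ₜ[K] m)) =
        -((TensorProduct.assoc K V V M).toLinearMap.lTensor V (TensorProduct.assoc K V (V ⊗[K] V) M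
          (TensorProduct.assoc K V V V (δ.rTensor V w) ⊗ₜ[K] m))) +
        (TensorProduct.assoc K V V M).toLinearMap.lTensor V (TensorProduct.assoc K V (V ⊗[K] V) M
          (δ.lTensor V w ⊗ₜ[K] m)) + TensorProduct.assoc K V V (V ⊗[K] M) (w ⊗ₜ[K] e m) := by
    intro w m
    induction w using TensorProduct.induction_on with
    | zero => simp
    | add w w' h h' =>
      rw [TensorProduct.add_tmul, map_add, map_add, h, h']
      simp only [map_add, TensorProduct.add_tmul]
      abel
    | tmul a b =>
      have h1 : ∀ y : V ⊗[K] V, TensorProduct.assoc K V V (V ⊗[K] M) (y ⊗ₜ[K] (b ⊗ₜ[K] m)) =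
          (TensorProduct.assoc K V V M).toLinearMap.lTensor V
            (TensorProduct.assoc K V (V ⊗[K] V) M
              (TensorProduct.assoc K V V V (y ⊗ₜ[K] b) ⊗ₜ[K] m)) := by
        intro y
        induction y using TensorProduct.induction_on with
        | zero => simp
        | tmul c d => rfl
        | add y y' h h' => simp only [map_add, TensorProduct.add_tmul, h, h']
      rw [TensorProduct.assoc_tmul, cobarStep_tmul, cobarStep_tmul, h1, LinearMap.rTensor_tmul,
        LinearMap.lTensor_tmul, TensorProduct.tmul_sub, TensorProduct.tmul_neg]
      simp only [TensorProduct.assoc_tmul, LinearMap.lTensor_tmul, LinearEquiv.coe_coe]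
      abel
  induction x using TensorProduct.induction_on with
  | zero => simp
  | add x y hx hy => rw [map_add, map_add, hx, hy, add_zero]
  | tmul v m =>
    rw [cobarStep_tmul, map_sub, map_neg, key, hδ, cobarStep_tmul, he, TensorProduct.tmul_zero]
    abel

theorem cobarD_cobarD (δ : V →ₗ[K] V ⊗[K] V)
    (hδ : ∀ v, TensorProduct.assoc K V V V (δ.rTensor V (δ v)) = δ.lTensor V (δ v)) :
    ∀ (s : ℕ) (x : Tens K V s), cobarD δ (s + 1) (cobarD δ s x) = 0
  | 0, x => by
    change cobarD δ 1 0 = 0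
    exact map_zero _
  | s + 1, x => cobarStep_cobarStep δ hδ (cobarD δ s) (cobarD_cobarD δ hδ s) x

theorem map_cobarStep {W : Type} [AddCommGroup W] [Module K W] (f : V →ₗ[K] W)
    (δ : V →ₗ[K] V ⊗[K] V) (δ' : W →ₗ[K] W ⊗[K] W)
    (h : ∀ v, TensorProduct.map f f (δ v) = δ' (f v))
    {M N : Type} [AddCommGroup M] [Module K M] [AddCommGroup N] [Module K N] (g : M →ₗ[K] N)
    (e : M →ₗ[K] V ⊗[K] M) (e' : N →ₗ[K] W ⊗[K] N)
    (he : ∀ m, TensorProduct.map f g (e m) = e' (g m)) (x : V ⊗[K] M) :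
    TensorProduct.map f (TensorProduct.map f g) (cobarStep δ e x) =
      cobarStep δ' e' (TensorProduct.map f g x) := by
  induction x using TensorProduct.induction_on with
  | zero => simp
  | add x y hx hy => simp only [map_add, hx, hy]
  | tmul v m =>
    have h1 : ∀ y : V ⊗[K] V, TensorProduct.map f (TensorProduct.map f g)
        (TensorProduct.assoc K V V M (y ⊗ₜ[K] m)) =
        TensorProduct.assoc K W W N (TensorProduct.map f f y ⊗ₜ[K] g m) := by
      intro y
      induction y using TensorProduct.induction_on with
      | zero => simp
      | tmul c d => rfl
      | add y y' h h' => simp only [map_add, TensorProduct.add_tmul, h, h']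
    rw [cobarStep_tmul, map_sub, map_neg, h1, h, TensorProduct.map_tmul, TensorProduct.map_tmul,
      cobarStep_tmul, he]

/-- The map on tensor powers induced by a linear map. -/
noncomputable def tensMap {W : Type} [AddCommGroup W] [Module K W] (f : V →ₗ[K] W) :
    ∀ s, Tens K V s →ₗ[K] Tens K W s
  | 0 => (LinearMap.id : K →ₗ[K] K)
  | s + 1 => (TensorProduct.map f (tensMap f s) : V ⊗[K] Tens K V s →ₗ[K] W ⊗[K] Tens K W s)

theorem tensMap_bar {W : Type} [AddCommGroup W] [Module K W] (f : V →ₗ[K] W) :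
    ∀ {s : ℕ} (a : Fin s → V), tensMap f s (bar a) = bar fun i => f (a i)
  | 0, _ => rfl
  | _ + 1, a => by
    change f (a 0) ⊗ₜ[K] tensMap f _ (bar (Fin.tail a)) = _
    rw [tensMap_bar]; rfl

theorem tensMap_cobarD {W : Type} [AddCommGroup W] [Module K W] (f : V →ₗ[K] W)
    (δ : V →ₗ[K] V ⊗[K] V) (δ' : W →ₗ[K] W ⊗[K] W)
    (h : ∀ v, TensorProduct.map f f (δ v) = δ' (f v)) :
    ∀ (s : ℕ) (x : Tens K V s), tensMap f (s + 1) (cobarD δ s x) = cobarD δ' s (tensMap f s x)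
  | 0, x => by
    change tensMap f 1 0 = 0
    exact map_zero _
  | s + 1, x => map_cobarStep f δ δ' h (tensMap f s) (cobarD δ s) (cobarD δ' s)
      (tensMap_cobarD f δ δ' h s) x

end coalg

variable (K A : Type) [CommRing K] [CommRing A] [Bialgebra K A]

/-- The augmentation ideal. -/
abbrev Aug : Submodule K A := LinearMap.ker (Coalgebra.counit (R := K) (A := A))

/-- The projection `a ↦ a - ε(a)` onto the augmentation ideal (the identity on the augmentation ideal). -/
noncomputable def augProj : A →ₗ[K] Aug K A :=
  (LinearMap.id - Algebra.linearMap K A ∘ₗ Coalgebra.counit).codRestrict _ fun a => by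
    simp [LinearMap.mem_ker]

/-- The reduced coproduct `a ↦ Δ(a) - a ⊗ 1 - 1 ⊗ a` of the augmentation ideal: the projection of
`Δ(a)`, which annihilates `A ⊗ 1` and `1 ⊗ A`. -/
noncomputable def redComul : Aug K A →ₗ[K] Aug K A ⊗[K] Aug K A :=
  TensorProduct.map (augProj K A) (augProj K A) ∘ₗ Coalgebra.comul ∘ₗ (Aug K A).subtype

theorem augProj_one : augProj K A 1 = 0 := by
  refine Subtype.ext ?_
  change (1 : A) - algebraMap K A (Coalgebra.counit 1) = 0
  simp

theorem redComul_augProj (a : A) : redComul K A (augProj K A a) =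
    TensorProduct.map (augProj K A) (augProj K A) (Coalgebra.comul a) := by
  have h : (augProj K A a : A) = a - algebraMap K A (Coalgebra.counit a) := rfl
  rw [redComul, LinearMap.comp_apply, LinearMap.comp_apply, Submodule.subtype_apply, h, map_sub,
    map_sub, Bialgebra.comul_algebraMap, Algebra.algebraMap_eq_smul_one, map_smul,
    Algebra.TensorProduct.one_def, TensorProduct.map_tmul, augProj_one, TensorProduct.tmul_zero,
    smul_zero]
  exact sub_zero (TensorProduct.map (augProj K A) (augProj K A) (Coalgebra.comul a))

theorem redComul_coassoc (v : Aug K A) :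
    TensorProduct.assoc K (Aug K A) (Aug K A) (Aug K A)
      ((redComul K A).rTensor (Aug K A) (redComul K A v)) =
    (redComul K A).lTensor (Aug K A) (redComul K A v) := by
  have h1 : ∀ y : A ⊗[K] A, (redComul K A).rTensor (Aug K A)
      (TensorProduct.map (augProj K A) (augProj K A) y) =
      TensorProduct.map (TensorProduct.map (augProj K A) (augProj K A)) (augProj K A)
        (Coalgebra.comul.rTensor A y) := by
    intro y
    induction y using TensorProduct.induction_on with
    | zero => simp
    | add x y hx hy => simp only [map_add, hx, hy]
    | tmul a b => simp [redComul_augProj]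
  have h2 : ∀ y : A ⊗[K] A, (redComul K A).lTensor (Aug K A)
      (TensorProduct.map (augProj K A) (augProj K A) y) =
      TensorProduct.map (augProj K A) (TensorProduct.map (augProj K A) (augProj K A))
        (Coalgebra.comul.lTensor A y) := by
    intro y
    induction y using TensorProduct.induction_on with
    | zero => simp
    | add x y hx hy => simp only [map_add, hx, hy]
    | tmul a b => simp [redComul_augProj]
  have h3 : redComul K A v = TensorProduct.map (augProj K A) (augProj K A)
    (Coalgebra.comul (v : A)) := rfl
  rw [h3, h1, h2, ← Coalgebra.coassoc_apply, TensorProduct.map_map_assoc]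

/-- The monomial with exponents `e` in the generators `gen`. -/
noncomputable def mono {A σ : Type} [CommRing A] (gen : σ → A) (e : σ →₀ ℕ) : A :=
  e.prod fun i m => gen i ^ m

/-- The inner degree of a monomial. -/
def monoDeg {σ G : Type} [AddCommMonoid G] (deg : σ → G) (e : σ →₀ ℕ) : G :=
  e.sum fun i m => m • deg i

/-- The May filtration of a monomial `∏ x_i^(e_i)`, where `x_i^(p^j)` has filtration `wt i` for all `j`:
the sum of `wt i` times the sum of the `p`-adic digits of `e_i`. -/
def monoMay (p : ℕ) {σ : Type} (wt : σ → ℕ) (e : σ →₀ ℕ) : ℕ :=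
  e.sum fun i m => (p.digits m).sum * wt i

/-- The span of all `[β_1 | … | β_s]` with `β_l` nontrivial monomials, of total inner degree `t` and of
total May filtration `≤ M`. -/
noncomputable def cobarFil {σ G : Type} [AddCommMonoid G] (p : ℕ) (gen : σ → A) (deg : σ → G)
    (wt : σ → ℕ) (s : ℕ) (t : G) (M : ℤ) : Submodule K (Tens K (Aug K A) s) :=
  Submodule.span K {x | ∃ e : Fin s → (σ →₀ ℕ), (∀ l, e l ≠ 0) ∧
    ∑ l, monoDeg deg (e l) = t ∧ ((∑ l, monoMay p wt (e l) : ℕ) : ℤ) ≤ M ∧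
    x = bar fun l => augProj K A (mono gen (e l))}

/-- The cobar complex with its May filtration. -/
noncomputable def mayComplex {σ G : Type} [AddCommMonoid G] (p : ℕ) (gen : σ → A) (deg : σ → G)
    (wt : σ → ℕ) : FilteredCochain K G where
  C := Tens K (Aug K A)
  d := cobarD (redComul K A)
  d_comp_d := cobarD_cobarD _ (redComul_coassoc K A)
  fil := cobarFil K A p gen deg wt
  mono _ _ _ _ h := Submodule.span_mono fun _ ⟨e, h0, h1, h2, h3⟩ => ⟨e, h0, h1, h2.trans h, h3⟩


variable {K A}

/-- The map of augmentation ideals induced by a bialgebra map. -/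
noncomputable def augMap {B : Type} [CommRing B] [Bialgebra K B] (φ : A →ₐc[K] B) :
    Aug K A →ₗ[K] Aug K B :=
  (φ : A →ₗ[K] B).restrict fun a ha => by
    have h : Coalgebra.counit (R := K) a = 0 := ha
    change Coalgebra.counit (R := K) (φ a) = 0
    rw [CoalgHomClass.counit_comp_apply, h]

theorem augMap_augProj {B : Type} [CommRing B] [Bialgebra K B] (φ : A →ₐc[K] B) (a : A) :
    augMap φ (augProj K A a) = augProj K B (φ a) := by
  refine Subtype.ext ?_
  change φ (a - algebraMap K A (Coalgebra.counit a)) =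
    φ a - algebraMap K B (Coalgebra.counit (φ a))
  rw [CoalgHomClass.counit_comp_apply, map_sub]
  exact congrArg (φ a - ·) (AlgHomClass.commutes φ _)

theorem augMap_redComul {B : Type} [CommRing B] [Bialgebra K B] (φ : A →ₐc[K] B)
    (v : Aug K A) :
    TensorProduct.map (augMap φ) (augMap φ) (redComul K A v) = redComul K B (augMap φ v) := by
  have h1 : ∀ y : A ⊗[K] A, TensorProduct.map (augMap φ) (augMap φ)
      (TensorProduct.map (augProj K A) (augProj K A) y) =
      TensorProduct.map (augProj K B) (augProj K B)
        (TensorProduct.map (φ : A →ₗ[K] B) (φ : A →ₗ[K] B) y) := by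
    intro y
    induction y using TensorProduct.induction_on with
    | zero => simp
    | add x y hx hy => simp only [map_add, hx, hy]
    | tmul a b => simp [augMap_augProj]
  have h3 : redComul K A v = TensorProduct.map (augProj K A) (augProj K A)
    (Coalgebra.comul (v : A)) := rfl
  have h4 : redComul K B (augMap φ v) = TensorProduct.map (augProj K B) (augProj K B)
    (Coalgebra.comul (φ (v : A))) := rfl
  rw [h3, h4, h1, ← CoalgHomClass.map_comp_comul_apply]

/-- A bialgebra map that sends generators to generators, compatibly with degrees and May filtrations,
induces a map of filtered cobar complexes. -/
noncomputable def mayHom {B σ σ' G G' : Type} [CommRing B] [Bialgebra K B] [AddCommMonoid G]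
    [AddCommMonoid G'] (p : ℕ) {gen : σ → A} {deg : σ → G} {wt : σ → ℕ} {gen' : σ' → B}
    {deg' : σ' → G'} {wt' : σ' → ℕ} (φ : A →ₐc[K] B) (ι : σ → σ') (hι : Function.Injective ι)
    (γ : G →+ G') (hgen : ∀ i, φ (gen i) = gen' (ι i)) (hdeg : ∀ i, deg' (ι i) = γ (deg i))
    (hwt : ∀ i, wt' (ι i) = wt i) :
    (mayComplex K A p gen deg wt).Hom (mayComplex K B p gen' deg' wt') γ where
  f := tensMap (augMap φ)
  comm := tensMap_cobarD _ _ _ (augMap_redComul φ)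
  fil_le s t M := by
    refine Submodule.span_le.2 ?_
    rintro _ ⟨e, h0, h1, h2, rfl⟩
    refine Submodule.subset_span ⟨fun l => (e l).mapDomain ι, fun l hl => h0 l ?_, ?_, ?_, ?_⟩
    · exact Finsupp.mapDomain_injective hι (hl.trans Finsupp.mapDomain_zero.symm)
    · rw [← h1, map_sum]
      refine Finset.sum_congr rfl fun l _ => ?_
      rw [monoDeg, monoDeg, Finsupp.sum_mapDomain_index_inj hι, Finsupp.sum, Finsupp.sum, map_sum]
      simp [hdeg]
    · refine le_trans (le_of_eq ?_) h2
      refine congrArg _ (Finset.sum_congr rfl fun l _ => ?_)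
      rw [monoMay, monoMay, Finsupp.sum_mapDomain_index_inj hι]
      simp [hwt]
    · refine (tensMap_bar _ _).trans ?_
      congr 1
      funext l
      rw [augMap_augProj, mono, mono, Finsupp.prod_mapDomain_index_inj hι, Finsupp.prod,
        Finsupp.prod, map_prod]
      simp [hgen]

end cobar

section main
variable (p n k : ℕ)

theorem digit_congr_last [Fact p.Prime] [NeZero n] {R : Type*} [CommRing R] [CharP R p]
    (hR : ∀ x : R, x ^ p ^ n = x) {f g : ℕ → WittVector p R} {s : ℕ} (h : ∀ j, j + n ≤ s → f j = g j)
    (hs : (f s).coeff 0 = (g s).coeff 0) : hondaDigit p n f s = hondaDigit p n g s := by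
  have hd : (p : WittVector p R) ∣ f s - g s := by
    rw [← pow_one (p : WittVector p R), dvd_sub_iff hR]
    intro i hi
    rwa [Nat.lt_one_iff.1 hi]
  have hd' : (p : WittVector p R) ^ (s / n + 1) ∣ wittPartial p n f s - wittPartial p n g s := by
    rw [wittPartial, wittPartial, Finset.sum_range_succ, Finset.sum_range_succ, Nat.mod_add_div]
    have : ∑ r ∈ range (s / n), f (s % n + n * r) * (p : WittVector p R) ^ r =
        ∑ r ∈ range (s / n), g (s % n + n * r) * (p : WittVector p R) ^ r := by
      refine Finset.sum_congr rfl fun r hr => ?_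
      have h1 : n * (r + 1) ≤ n * (s / n) := Nat.mul_le_mul_left _ (mem_range.1 hr)
      rw [Nat.mul_succ] at h1
      rw [h _ (by have := Nat.mod_add_div s n; omega)]
    rw [this, add_sub_add_left_eq_sub, ← sub_mul, pow_succ']
    exact mul_dvd_mul_right hd _
  rw [hondaDigit, hondaDigit, (dvd_sub_iff hR _ _ _).1 hd' _ (Nat.lt_succ_self _)]

variable {p n k}

theorem S.diag_eq [Fact p.Prime] [NeZero n] [NeZero k] {s : ℕ} (hs : s < n + k) :
    S.diag p n k s =
      ∑ x ∈ antidiagonal s, S.t p n k x.1 ⊗ₜ[ZMod p] (S.t p n k x.2 ^ p ^ x.1) := by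
  have hn : 0 < n := Nat.pos_of_ne_zero (NeZero.ne n)
  rw [S.diag, digit_congr_last p n S.pow_eq₂ (g := teich p fun j => if j = s then
    ∑ x ∈ antidiagonal s, S.t p n k x.1 ⊗ₜ[ZMod p] (S.t p n k x.2 ^ p ^ x.1) else
      if j = 0 then 1 else 0), digit_teich S.pow_eq₂, if_pos rfl]
  · intro j hj
    rw [S.twMul_of_lt (by omega), teich, teich, if_neg (by omega : j ≠ s)]
  · rw [teich, if_pos rfl, WittVector.teichmuller_coeff_zero, twistedProd]
    change WittVector.constantCoeff _ = _
    rw [map_sum]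
    refine Finset.sum_congr rfl fun x _ => ?_
    rw [Algebra.TensorProduct.tmul_pow, Algebra.TensorProduct.tmul_mul_tmul, one_pow, mul_one,
      one_mul]
    exact WittVector.teichmuller_coeff_zero p _

variable (p n k)

/-- The algebra map `T(n,k) → S(n,k)`, `ξ_i ↦ t_i`. -/
noncomputable def phiAlgHom [NeZero k] : T p n k →ₐ[ZMod p] S p n k :=
  T.lift p n k fun i => S.t p n k i.1

theorem redAlgHom_xi [NeZero k] {i : ℕ} (hi : i < n + k) :
    phiAlgHom p n k (T.xi p n k i) = S.t p n k i := by
  by_cases h : k ≤ i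
  · exact T.lift_xi _ ⟨i, h, hi⟩
  · by_cases h0 : i = 0
    · simp [T.xi, S.t, h0]
    · simp [T.xi, S.t, h0, h]

/-- The reduction map `Φ : T(n,k) → S(n,k)`, `ξ_i ↦ t_i`, as a map of bialgebras. -/
noncomputable def Phi [Fact p.Prime] [NeZero n] [NeZero k] : T p n k →ₐc[ZMod p] S p n k :=
  BialgHom.ofAlgHom (phiAlgHom p n k)
    (T.hom_ext fun i => by
      change S.counit (phiAlgHom p n k _) = T.counit p n k _
      rw [redAlgHom_xi _ _ _ i.2.2, S.counit_tt, T.counit_xi])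
    (T.hom_ext fun i => by
      change Algebra.TensorProduct.map (phiAlgHom p n k) (phiAlgHom p n k) (T.comul p n k _) =
        S.comul (phiAlgHom p n k _)
      rw [redAlgHom_xi _ _ _ i.2.2, S.comul_tt, S.diag_eq i.2.2, T.comul_xi _ i.2.2, map_sum]
      refine Finset.sum_congr rfl fun x hx => ?_
      have hx' := mem_antidiagonal.1 hx
      have := i.2.2
      rw [Algebra.TensorProduct.map_tmul, map_pow, redAlgHom_xi _ _ _ (by omega),
        redAlgHom_xi _ _ _ (by omega)])

/-- The inner degree `2(p-1)(1 + p + … + p^(i-1))` of `ξ_i` and `t_i`. -/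
def innerDeg (i : ℕ) : ℕ := 2 * (p - 1) * ∑ l ∈ range i, p ^ l

/-- The May filtration of `t_s^(p^j)` (it does not depend on `j`): `2s-1` for `s ≤ n + k - 1`, and
`max (2s-1) (p M(t_{s-n}) + 1)` for `s ≥ n + k`. -/
def mayWeight (s : ℕ) : ℕ :=
  if _h : 0 < n ∧ n + k ≤ s then max (2 * s - 1) (p * mayWeight (s - n) + 1) else 2 * s - 1
termination_by s

/-- The cobar complex of `T(n,k)` with the May filtration `M(ξ_i^(p^j)) = 2i - 1`; its pages are the
terms `E_r^{s,t,M} T(n,k)`. -/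
noncomputable def mayT [Fact p.Prime] [NeZero k] : FilteredCochain (ZMod p) ℕ :=
  mayComplex (ZMod p) (T p n k) p (fun i : TIdx n k => T.xi p n k i.1) (fun i => innerDeg p i.1)
    (fun i => 2 * i.1 - 1)

/-- The cobar complex of `S(n,k)` with the May filtration; its pages are the terms
`E_r^{s,t,M} S(n,k)`. The inner degree is taken modulo `2(p-1)(1 + p + … + p^(n-1))`. -/
noncomputable def mayS [Fact p.Prime] [NeZero n] [NeZero k] :
    FilteredCochain (ZMod p) (ZMod (2 * (p - 1) * ∑ l ∈ range n, p ^ l)) :=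
  mayComplex (ZMod p) (S p n k) p (fun i : SIdx k => S.t p n k i.1)
    (fun i => (innerDeg p i.1 : ZMod _)) (fun i => mayWeight p n k i.1)

theorem mayWeight_of_lt {i : ℕ} (h : i < n + k) : mayWeight p n k i = 2 * i - 1 := by
  rw [mayWeight, dif_neg (by omega)]

/-- The map of filtered cobar complexes induced by `Φ`; its page maps are `Φ : E_r T(n,k) → E_r S(n,k)`. -/
noncomputable def mayPhi [Fact p.Prime] [NeZero n] [NeZero k] :
    (mayT p n k).Hom (mayS p n k)
      (Nat.castAddMonoidHom (ZMod (2 * (p - 1) * ∑ l ∈ range n, p ^ l))) :=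
  mayHom (K := ZMod p) (A := T p n k) (B := S p n k) (σ := TIdx n k) (σ' := SIdx k)
    p (gen := fun i => T.xi p n k i.1) (deg := fun i => innerDeg p i.1)
    (wt := fun i => 2 * i.1 - 1) (gen' := fun i => S.t p n k i.1)
    (deg' := fun i => (innerDeg p i.1 : ZMod (2 * (p - 1) * ∑ l ∈ range n, p ^ l)))
    (wt' := fun i => mayWeight p n k i.1)
    (Phi p n k) (fun i => ⟨i.1, i.2.1⟩)
    (fun _ _ h => Subtype.ext (congrArg (fun i : SIdx k => i.1) h))
    (Nat.castAddMonoidHom (ZMod (2 * (p - 1) * ∑ l ∈ range n, p ^ l)))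
    (fun i => redAlgHom_xi p n k i.2.2) (fun _ => rfl)
    (fun i => mayWeight_of_lt p n k i.2.2)

/-- The cobar element `[ξ_{i_1}^(p^{j_1}) | … | ξ_{i_s}^(p^{j_s})]`, for `I = ((i_1,j_1), …, (i_s,j_s))`. -/
noncomputable def exteriorBar [Fact p.Prime] [NeZero k] {s : ℕ} (I : Fin s → TIdx n k × ℕ) :
    (mayT p n k).C s :=
  (bar fun l => augProj (ZMod p) (T p n k) (T.xi p n k (I l).1.1 ^ p ^ (I l).2) :
    Tens (ZMod p) (Aug (ZMod p) (T p n k)) s)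

theorem digits_pow_sum {p : ℕ} (hp : 1 < p) (j : ℕ) : (p.digits (p ^ j)).sum = 1 := by
  have := Nat.digits_base_pow_mul (k := j) hp (m := 1) one_pos
  rw [mul_one] at this
  rw [this, Nat.digits_of_lt p 1 one_ne_zero hp]
  simp only [List.sum_append, List.sum_replicate, List.sum_cons, List.sum_nil, smul_zero,
    zero_add, add_zero]

theorem hBar_mem_fil [Fact p.Prime] [NeZero k] {s : ℕ} (I : Fin s → TIdx n k × ℕ) :
    exteriorBar p n k I ∈ (mayT p n k).fil s (∑ l, p ^ (I l).2 * innerDeg p (I l).1)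
      ((∑ l, (2 * (I l).1.1 - 1) : ℕ) : ℤ) := by
  have hp1 : 1 < p := (Fact.out : p.Prime).one_lt
  change exteriorBar p n k I ∈ cobarFil (ZMod p) (T p n k) p (fun i : TIdx n k => T.xi p n k i.1)
    (fun i => innerDeg p i.1) (fun i => 2 * i.1 - 1) s _ _
  refine Submodule.subset_span
    ⟨fun l => Finsupp.single (I l).1 (p ^ (I l).2), fun l h => ?_, ?_, ?_, ?_⟩
  · exact pow_ne_zero _ (by omega : p ≠ 0) (Finsupp.single_eq_zero.1 h)
  · simp [monoDeg]
  · simp [monoMay, digits_pow_sum hp1]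
  · simp [exteriorBar, mono]

theorem tmul_mem_cobarFil {K A σ G : Type} [CommRing K] [CommRing A] [Bialgebra K A]
    [AddCommMonoid G] {p : ℕ} {gen : σ → A} {deg : σ → G} {wt : σ → ℕ} {s : ℕ} {t t' : G}
    {M M' : ℤ} {e : σ →₀ ℕ} (he : e ≠ 0) (ht : monoDeg deg e + t' = t)
    (hM : monoMay p wt e + M' ≤ M) {x : Tens K (Aug K A) s}
    (hx : x ∈ cobarFil K A p gen deg wt s t' M') :
    (augProj K A (mono gen e) ⊗ₜ[K] x : Aug K A ⊗[K] Tens K (Aug K A) s) ∈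
      cobarFil K A p gen deg wt (s + 1) t M := by
  let f : Tens K (Aug K A) s →ₗ[K] Tens K (Aug K A) (s + 1) :=
    TensorProduct.mk K (Aug K A) (Tens K (Aug K A) s) (augProj K A (mono gen e))
  suffices h : cobarFil K A p gen deg wt s t' M' ≤
      (cobarFil K A p gen deg wt (s + 1) t M).comap f from h hx
  refine Submodule.span_le.2 ?_
  rintro _ ⟨e', h0, h1, h2, rfl⟩
  refine Submodule.subset_span ⟨Fin.cons e e', ?_, ?_, ?_, ?_⟩
  · exact Fin.cases he h0
  · rw [Fin.sum_univ_succ]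
    simpa [h1] using ht
  · rw [Fin.sum_univ_succ]
    simp only [Fin.cons_zero, Fin.cons_succ]
    push_cast at h2 ⊢
    omega
  · change augProj K A (mono gen e) ⊗ₜ[K] bar _ = _ ⊗ₜ[K] bar _
    rfl

theorem innerDeg_add (a b : ℕ) : innerDeg p (a + b) = innerDeg p a + p ^ a * innerDeg p b := by
  rw [innerDeg, innerDeg, innerDeg, Finset.sum_range_add]
  simp only [pow_add, ← Finset.mul_sum]
  ring

theorem redComul_xi [Fact p.Prime] [NeZero k] (i : TIdx n k) (j : ℕ) :
    redComul (ZMod p) (T p n k) (augProj (ZMod p) (T p n k) (T.xi p n k i.1 ^ p ^ j)) =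
      ∑ x ∈ antidiagonal i.1, augProj (ZMod p) (T p n k) (T.xi p n k x.1 ^ p ^ j) ⊗ₜ[ZMod p]
        augProj (ZMod p) (T p n k) (T.xi p n k x.2 ^ p ^ (x.1 + j)) := by
  have hTT : CharP (T p n k ⊗[ZMod p] T p n k) p := charP_tensor (T.counit p n k) (T.counit p n k)
  rw [redComul_augProj]
  change TensorProduct.map _ _ (T.comul p n k _) = _
  rw [map_pow, T.comul_xi _ i.2.2, sum_pow_char_pow, map_sum]
  refine Finset.sum_congr rfl fun x _ => ?_
  rw [Algebra.TensorProduct.tmul_pow, TensorProduct.map_tmul, ← pow_mul, ← pow_add]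

theorem cobarD_hBar_mem [Fact p.Prime] [NeZero k] : ∀ {s : ℕ} (I : Fin s → TIdx n k × ℕ),
    cobarD (redComul (ZMod p) (T p n k)) s (exteriorBar p n k I) ∈
      (mayT p n k).fil (s + 1) (∑ l, p ^ (I l).2 * innerDeg p (I l).1)
        (((∑ l, (2 * (I l).1.1 - 1) : ℕ) : ℤ) - 1)
  | 0, _ => Submodule.zero_mem _
  | s + 1, I => by
    have hp1 : 1 < p := (Fact.out : p.Prime).one_lt
    have hp0 : ∀ m, p ^ m ≠ 0 := fun m => pow_ne_zero _ (by omega)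
    have hk := NeZero.ne k
    rcases hI : I 0 with ⟨⟨i, hi⟩, j⟩
    have ih := cobarD_hBar_mem (Fin.tail I)
    have hfil := hBar_mem_fil p n k (Fin.tail I)
    rw [Fin.sum_univ_succ, Fin.sum_univ_succ, hI]
    have hmono : ∀ (a : TIdx n k) (m : ℕ), T.xi p n k a.1 ^ m =
        mono (fun i : TIdx n k => T.xi p n k i.1) (Finsupp.single a m) := by
      intro a m; simp [mono]
    have hsplit : cobarD (redComul (ZMod p) (T p n k)) (s + 1) (exteriorBar p n k I) =
        cobarStep (redComul (ZMod p) (T p n k)) (cobarD (redComul (ZMod p) (T p n k)) s)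
          (augProj (ZMod p) (T p n k) (T.xi p n k i ^ p ^ j) ⊗ₜ[ZMod p]
            (bar fun l => augProj (ZMod p) (T p n k)
              (T.xi p n k (Fin.tail I l).1.1 ^ p ^ (Fin.tail I l).2))) := by
      have h0 : T.xi p n k i ^ p ^ j = T.xi p n k (I 0).1.1 ^ p ^ (I 0).2 := by rw [hI]
      rw [h0]
      rfl
    have hsplit' := hsplit.trans (cobarStep_tmul _ _ _ _)
    rw [hsplit']
    refine Submodule.sub_mem _ (Submodule.neg_mem _ ?_) ?_
    · rw [redComul_xi p n k ⟨i, hi⟩ j, TensorProduct.sum_tmul, map_sum]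
      refine Submodule.sum_mem _ ?_
      rintro ⟨a, b⟩ hx
      have hab : a + b = i := mem_antidiagonal.1 hx
      have hzero : ∀ c < k, ∀ m, augProj (ZMod p) (T p n k) (T.xi p n k c ^ p ^ m) = 0 := by
        intro c hc m
        by_cases h0 : c = 0
        · rw [T.xi, if_pos h0, one_pow, augProj_one]
        · rw [T.xi, if_neg h0, dif_neg (by omega), zero_pow (hp0 m), map_zero]
      rw [TensorProduct.assoc_tmul]
      by_cases ha : a < k
      · rw [hzero a ha, TensorProduct.zero_tmul]; exact Submodule.zero_mem _
      by_cases hb : b < k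
      · rw [hzero b hb, TensorProduct.zero_tmul, TensorProduct.tmul_zero]
        exact Submodule.zero_mem _
      have ha' : k ≤ a ∧ a < n + k := by omega
      have hb' : k ≤ b ∧ b < n + k := by omega
      rw [hmono ⟨a, ha'⟩, hmono ⟨b, hb'⟩]
      refine tmul_mem_cobarFil (M' := (2 * b - 1 : ℕ) +
        ((∑ l, (2 * (Fin.tail I l).1.1 - 1) : ℕ) : ℤ))
        (t' := p ^ (a + j) * innerDeg p b +
          ∑ l, p ^ (Fin.tail I l).2 * innerDeg p (Fin.tail I l).1) ?_ ?_ ?_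
        (tmul_mem_cobarFil ?_ ?_ ?_ hfil)
      · exact fun h => hp0 _ (Finsupp.single_eq_zero.1 h)
      · simp only [monoDeg, smul_eq_mul, Finsupp.sum_single_index, zero_mul, ← hab, innerDeg_add]
        simp only [Fin.tail]
        ring
      · simp only [monoMay, Finsupp.sum_single_index, Nat.digits_zero, List.sum_nil, zero_mul,
          digits_pow_sum hp1, one_mul]
        simp only [Fin.tail]
        push_cast
        omega
      · exact fun h => hp0 _ (Finsupp.single_eq_zero.1 h)
      · simp [monoDeg]
      · simp [monoMay, digits_pow_sum hp1]
    · rw [hmono ⟨i, hi⟩]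
      refine tmul_mem_cobarFil ?_ ?_ ?_ ih
      · exact fun h => hp0 _ (Finsupp.single_eq_zero.1 h)
      · simp [monoDeg, Fin.tail]
      · simp only [monoMay, Finsupp.sum_single_index, Nat.digits_zero, List.sum_nil, zero_mul,
          digits_pow_sum hp1, one_mul]
        simp only [Fin.tail]
        push_cast
        omega

theorem hBar_mem_Z [Fact p.Prime] [NeZero k] {s : ℕ} (I : Fin s → TIdx n k × ℕ) :
    exteriorBar p n k I ∈ (mayT p n k).Z (1 : ℕ) s (∑ l, p ^ (I l).2 * innerDeg p (I l).1)
      ((∑ l, (2 * (I l).1.1 - 1) : ℕ) : ℤ) :=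
  ⟨hBar_mem_fil p n k I, cobarD_hBar_mem p n k I⟩

/-- The monomial `h'_{i_1,j_1} ⋯ h'_{i_s,j_s}` in `E_1^{s,t,M} T(n,k)`. Here `h'_{i,j}` is the class of
`[ξ_i^(p^j)]`, and the product of `E_1` is induced by juxtaposition in the cobar complex. -/
noncomputable def exteriorMonomial [Fact p.Prime] [NeZero k] {s t : ℕ} {M : ℤ} (I : Fin s → TIdx n k × ℕ)
    (ht : ∑ l, p ^ (I l).2 * innerDeg p (I l).1 = t)
    (hM : ((∑ l, (2 * (I l).1.1 - 1) : ℕ) : ℤ) = M) : (mayT p n k).Page 1 s t M :=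
  (mayT p n k).cls ⟨exteriorBar p n k I, by subst ht hM; exact hBar_mem_Z p n k I⟩

/-- The linear combinations of monomials `h'_{i_1,j_1} ⋯ h'_{i_s,j_s}` in `E_1^{s,t,M} T(n,k)` whose sum
of indices `SI = i_1 + … + i_s` equals `m`: the elements `g` of `E[h'_{i,j}] ∩ E_1^{s,t,M}` with
`SI(g) = m`. -/
noncomputable def exteriorPart [Fact p.Prime] [NeZero k] (s t : ℕ) (M : ℤ) (m : ℕ) :
    Submodule (ZMod p) ((mayT p n k).Page 1 s t M) :=
  Submodule.span (ZMod p) {g | ∃ (I : Fin s → TIdx n k × ℕ)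
    (ht : ∑ l, p ^ (I l).2 * innerDeg p (I l).1 = t)
    (hM : ((∑ l, (2 * (I l).1.1 - 1) : ℕ) : ℤ) = M),
    ∑ l, (I l).1.1 = m ∧ g = exteriorMonomial p n k I ht hM}

/-- The sum of degree: `Sd(t) = c_0 + … + c_m` for `t = 2(p-1)(c_0 + c_1 p + … + c_m p^m)`, `0 ≤ c_i < p`. -/
def Sd (t : ℕ) : ℕ := (p.digits (t / (2 * (p - 1)))).sum

end main

end MaySS

/-!
Everything rests on the vanishing of `E_1^{s,t,M} T(n,k)` for `M < 2 Sd(t) - s`. A nonzero element `g`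
of the exterior part has `M = 2 SI(g) - s`, so that `SI(g) = Sd(t)` puts the targets `E_r^{s+1,t,M-r}` of
all `d_r g` with `r ≥ 2` in the vanishing range. Hence a representative of `g` can be corrected page by
page (`FilteredCochain.isInfiniteCocycle_of_subsingleton`), and `Φ(g)` is an infinite cocycle because
`Φ` is a map of filtered complexes.

For the vanishing, write each exponent `p`-adically: the monomials `∏ (ξ_i^(p^j))^(a (i, j))` with all
`a (i, j) < p` form a basis of `T(n,k)`, and modulo lower May filtration each `ξ_i^(p^j)` is primitive. So
the associated graded coalgebra is a tensor product of truncated polynomial coalgebras of height `p`, and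
in the basis of divided powers `γ_a` its coproduct is `γ_a ↦ ∑ γ_b ⊗ γ_c` over `b + c = a`
(`dualPair_comul`). In coordinates, the top filtration part of the cobar differential becomes the
alternating sum `wordD` over the ways to add neighbouring letters of a word
(`wordCoeff_cobarD`), and it preserves the total exponent `a` of a word.

The cohomology of this complex is `E[h_{i,j}] ⊗ P[b_{i,j}]`, but only its vanishing in low degrees is
needed. It follows from comodule coefficients: for a set `V` of variables, let the coefficients be the
truncated polynomials on `V`. When `V` contains all variables that occur, the coefficients are cofree and the
complex is contractible (`isAcyclicAt_of_support`). Removing a variable `x` from `V` costs two long exact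
sequences, which trade degree `s` and total exponent `a` for `s - 1`, `a - x` and for `s - 2`, `a - p x`
(`isAcyclicAt_of_insert`); these are the contributions of `h` and of `b`. The bound `2 Sd - M` grows by at
most `1` with a variable `x` and by at most `2` with `x^p`, by subadditivity of `p`-adic digit sums, so it
bounds the degree of the cohomology from below (`isAcyclicAt_of_lt`, `isAcyclicAt_T`).
-/

namespace MaySS

/-! ### Cochains on words -/

section words
variable {X K : Type*} [AddCommMonoid X]

/-- Adding `f` to the first letter of a word, the coefficient `n` counting as the last letter. -/
def mergeHead (f : X) (c : List X → X → K) : List X → X → K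
  | [], n => c [] (f + n)
  | g :: l, n => c ((f + g) :: l) n

theorem mergeHead_mergeHead (f g : X) (c : List X → X → K) (l : List X) (n : X) :
    mergeHead g (mergeHead f c) l n = mergeHead (f + g) c l n := by
  cases l <;> simp only [mergeHead, add_assoc]

variable [CommRing K]

/-- The differential on cochains `c(f_1, …, f_s; n)`: the alternating sum over the ways to add two
neighbouring letters, without the term that drops the first letter. There is no side condition on the sums:
on cochains supported on reduced words (`IsSupported`) the sums that are not reduced contribute zero. -/
def wordD : (List X → X → K) → List X → X → K
  | _, [], _ => 0
  | c, f :: l, n => -mergeHead f c l n - wordD (fun l' => c (f :: l')) l n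

theorem wordD_sub (c c' : List X → X → K) (l : List X) (n : X) :
    wordD (fun l n => c l n - c' l n) l n = wordD c l n - wordD c' l n := by
  induction l generalizing c c' with
  | nil => simp [wordD]
  | cons f l ih =>
    rw [wordD, wordD, wordD, ih (fun l' => c (f :: l')) fun l' => c' (f :: l')]
    cases l <;> simp only [mergeHead] <;> ring

theorem wordD_const_mul (a : K) (c : List X → X → K) (l : List X) (n : X) :
    wordD (fun l n => a * c l n) l n = a * wordD c l n := by
  induction l generalizing c with
  | nil => simp [wordD]
  | cons f l ih =>
    rw [wordD, wordD, ih fun l' => c (f :: l')]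
    cases l <;> simp only [mergeHead] <;> ring

theorem wordD_shift (c : List X → X → K) (b : X) (l : List X) (n : X) :
    wordD (fun l n => c l (n + b)) l n = wordD c l (n + b) := by
  induction l generalizing c with
  | nil => simp [wordD]
  | cons f l ih =>
    rw [wordD, wordD, ih fun l' => c (f :: l')]
    cases l <;> simp only [mergeHead, add_assoc]

theorem wordD_zero (l : List X) (n : X) : wordD (fun _ _ => (0 : K)) l n = 0 := by
  simpa using wordD_const_mul (0 : K) (fun _ _ => (0 : K)) l n

theorem mergeHead_wordD (f : X) (c : List X → X → K) (l : List X) (n : X) :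
    mergeHead f (wordD c) l n = wordD (mergeHead f c) l n := by
  cases l with
  | nil => rfl
  | cons g l =>
    rw [mergeHead, wordD, wordD, mergeHead_mergeHead]
    rfl

theorem wordD_wordD (c : List X → X → K) (l : List X) (n : X) : wordD (wordD c) l n = 0 := by
  induction l generalizing c with
  | nil => rfl
  | cons f l ih =>
    have h : (fun l' => wordD c (f :: l')) = fun l' n' =>
        (-1 : K) * mergeHead f c l' n' - wordD (fun l' => c (f :: l')) l' n' := by
      funext l' n'
      rw [wordD]; ring
    rw [wordD, mergeHead_wordD, h,
      wordD_sub (fun l' n' => (-1 : K) * mergeHead f c l' n') (wordD fun l' => c (f :: l')),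
      wordD_const_mul, ih]
    ring

/-- The last letter can be moved to the coefficient, at the cost of one term. -/
theorem wordD_append_singleton (c : List X → X → K) (l : List X) (n m : X) :
    wordD c (l ++ [n]) m =
      wordD (fun l' n' => c (l' ++ [n']) m) l n + (-1) ^ (l.length + 1) * c l (n + m) := by
  induction l generalizing c with
  | nil => simp [wordD, mergeHead]
  | cons f l ih =>
    rw [List.cons_append, wordD, wordD, ih fun l' => c (f :: l')]
    cases l <;> simp only [mergeHead, List.nil_append, List.cons_append, List.length_cons,
      List.length_nil] <;> ring

end words

section support
variable {σ K : Type*} [CommRing K]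

/-- `wordD c` at a word without letter `0` only involves words without letter `0`, of the same total
and of length one less. -/
theorem wordD_congr {c c' : List (σ →₀ ℕ) → (σ →₀ ℕ) → K} {l : List (σ →₀ ℕ)} {n : σ →₀ ℕ}
    (hl : 0 ∉ l) (h : ∀ l' n', 0 ∉ l' → l'.length + 1 = l.length → l'.sum + n' = l.sum + n →
      n ≤ n' → c l' n' = c' l' n') : wordD c l n = wordD c' l n := by
  induction l generalizing c c' with
  | nil => rfl
  | cons f l ih =>
    rw [List.mem_cons, not_or] at hl
    rw [wordD, wordD]
    congr 1
    · congr 1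
      cases l with
      | nil =>
        exact h [] (f + n) (by simp) (by simp) (by simp) (self_le_add_left _ _)
      | cons g l =>
        rw [List.mem_cons, not_or] at hl
        refine h ((f + g) :: l) n ?_ (by simp) (by simp [add_assoc]) le_rfl
        rw [List.mem_cons, not_or]
        exact ⟨fun h0 => hl.1 (by rw [eq_comm, add_eq_zero] at h0; exact h0.1.symm), hl.2.2⟩
    · refine ih hl.2 fun l' n' h0 h1 h2 h3 => h (f :: l') n' ?_ (by simpa using h1) ?_ h3
      · rw [List.mem_cons, not_or]; exact ⟨hl.1, h0⟩
      · simp only [List.sum_cons, add_assoc, h2]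

/-- All exponents are less than `p`, and those outside `V` vanish. -/
def IsReduced (p : ℕ) (V : Set σ) (a : σ →₀ ℕ) : Prop := ∀ x, a x < p ∧ (x ∉ V → a x = 0)

/-- The cochain is supported on words of reduced monomials with coefficients in the monomials on
the variables in `V`. -/
def IsSupported (p : ℕ) (V : Set σ) (c : List (σ →₀ ℕ) → (σ →₀ ℕ) → K) : Prop :=
  ∀ l n, c l n ≠ 0 → (∀ f ∈ l, IsReduced p Set.univ f) ∧ IsReduced p V n

variable {p : ℕ} {V : Set σ}

theorem IsReduced.of_le {a b : σ →₀ ℕ} (h : IsReduced p V b) (hab : a ≤ b) : IsReduced p V a :=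
  fun x => ⟨(hab x).trans_lt (h x).1, fun hx => Nat.le_zero.1 ((hab x).trans_eq ((h x).2 hx))⟩

theorem IsSupported.wordD {c : List (σ →₀ ℕ) → (σ →₀ ℕ) → K} (h : IsSupported p V c) :
    IsSupported p V (wordD c) := by
  intro l n
  induction l generalizing c with
  | nil => intro h0; exact absurd rfl h0
  | cons f l ih =>
    intro h0
    by_cases h1 : mergeHead f c l n = 0
    · have h2 : MaySS.wordD (fun l' => c (f :: l')) l n ≠ 0 := by
        intro h2; rw [MaySS.wordD, h1, h2] at h0; simp at h0
      have h3 := ih (c := fun l' => c (f :: l'))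
        (fun l' n' hc => ⟨fun g hg => (h _ _ hc).1 g (List.mem_cons_of_mem _ hg), (h _ _ hc).2⟩) h2
      refine ⟨List.forall_mem_cons.2 ⟨?_, h3.1⟩, h3.2⟩
      by_contra hf
      have h4 : (fun l' => c (f :: l')) = fun _ _ => 0 := by
        funext l' n'
        by_contra hc
        exact hf ((h _ _ hc).1 f List.mem_cons_self)
      rw [h4, wordD_zero] at h2
      exact h2 rfl
    · cases l with
      | nil =>
        have h2 := (h _ _ h1).2
        refine ⟨?_, h2.of_le (self_le_add_left _ _)⟩
        simp only [List.mem_singleton, forall_eq]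
        have h3 := h2.of_le (self_le_add_right f n)
        exact fun x => ⟨(h3 x).1, fun hx => absurd (Set.mem_univ x) hx⟩
      | cons g l =>
        have h2 := h _ _ h1
        have h3 := List.forall_mem_cons.1 h2.1
        exact ⟨List.forall_mem_cons.2 ⟨h3.1.of_le (self_le_add_right _ _),
          List.forall_mem_cons.2 ⟨h3.1.of_le (self_le_add_left _ _), h3.2⟩⟩, h2.2⟩

theorem IsSupported.sub {c c' : List (σ →₀ ℕ) → (σ →₀ ℕ) → K} (h : IsSupported p V c)
    (h' : IsSupported p V c') : IsSupported p V fun l n => c l n - c' l n := by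
  intro l n h0
  by_cases h1 : c l n = 0
  · exact h' _ _ fun h2 => h0 (by simp [h1, h2])
  · exact h _ _ h1

variable (K p V) in
/-- The cochains with coefficients in the monomials on `V` have no cohomology in degree `s` and in
multidegrees belonging to `P`. For `s = 0` a coboundary is zero. -/
def IsAcyclicAt (P : Set (σ →₀ ℕ)) (s : ℕ) : Prop :=
  ∀ c : List (σ →₀ ℕ) → (σ →₀ ℕ) → K, IsSupported p V c →
    (∀ l n, 0 ∉ l → l.length = s + 1 → l.sum + n ∈ P → MaySS.wordD c l n = 0) →
    ∃ y, IsSupported p V y ∧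
      ∀ l n, 0 ∉ l → l.length = s → l.sum + n ∈ P → c l n = MaySS.wordD y l n

/-- If all multidegrees are nonzero and only involve variables in `V`, then the coefficients are cofree
and moving the last letter to the coefficient is a contraction. -/
theorem isAcyclicAt_of_support {P : Set (σ →₀ ℕ)} (hP : ∀ a ∈ P, ∀ x ∉ V, a x = 0) (s : ℕ)
    (h0 : s = 0 → 0 ∉ P) : IsAcyclicAt K p V P s := by
  classical
  intro c hc hd
  refine ⟨fun l n => if n ≠ 0 ∧ IsReduced p V n then (-1) ^ s * c (l ++ [n]) 0 else 0, ?_, ?_⟩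
  · intro l n h
    dsimp only at h
    split_ifs at h with hn
    · have := (hc _ _ (right_ne_zero_of_mul h)).1
      exact ⟨fun f hf => this f (List.mem_append_left _ hf), hn.2⟩
    · exact absurd rfl h
  intro l n hl hs hn
  have hsign : ((-1 : K) ^ s) * (-1) ^ s = 1 := by rw [← mul_pow]; simp
  by_cases hn0 : n = 0
  · subst hn0
    rcases List.eq_nil_or_concat l with rfl | ⟨l, f, rfl⟩
    · simp only [List.sum_nil, add_zero] at hn
      exact absurd hn (h0 (by simpa using hs.symm))
    · rw [List.concat_eq_append] at *
      have hf : f ≠ 0 := fun h => hl (by simp [h])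
      have hs' : l.length + 1 = s := by simpa using hs
      rw [wordD_append_singleton]
      have h1 : (fun (l' : List (σ →₀ ℕ)) (n' : σ →₀ ℕ) => if (0 : σ →₀ ℕ) ≠ 0 ∧ IsReduced p V 0 then
          (-1 : K) ^ s * c (l' ++ [n'] ++ [0]) 0 else 0) = fun _ _ => 0 := by
        funext l' n'; simp
      rw [h1, wordD_zero, zero_add, hs', add_zero]
      split_ifs with h2
      · rw [← mul_assoc, hsign, one_mul]
      · rw [mul_zero]
        by_contra h3
        refine h2 ⟨hf, fun x => ⟨((hc _ _ h3).1 f (by simp) x).1, fun hx => ?_⟩⟩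
        have := hP _ hn x hx
        simp at this
        exact this.2
  · have key := hd (l ++ [n]) 0 (by simp [hl, Ne.symm hn0]) (by simp [hs]) (by simpa using hn)
    rw [wordD_append_singleton, add_zero, hs] at key
    have h1 : MaySS.wordD (fun l n => if n ≠ 0 ∧ IsReduced p V n then
        (-1) ^ s * c (l ++ [n]) 0 else 0) l n =
        MaySS.wordD (fun l' n' => (-1) ^ s * c (l' ++ [n']) 0) l n := by
      refine wordD_congr hl fun l' n' _ _ h2 h3 => ?_
      have hn' : n' ≠ 0 := fun h => hn0 (le_antisymm (h ▸ h3) (by simp))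
      split_ifs with h4
      · rfl
      · by_contra h5
        have h6 : c (l' ++ [n']) 0 ≠ 0 := fun h => h5 (by simp [h])
        refine h4 ⟨hn', fun x => ⟨((hc _ _ h6).1 n' (by simp) x).1, fun hx => ?_⟩⟩
        have := hP _ hn x hx
        rw [← h2] at this
        simp at this
        exact this.2
    rw [h1, wordD_const_mul]
    linear_combination -(-1) ^ s * key - (c l n) * hsign

open Classical in
/-- Removing one variable `x` from the coefficients: the coefficient comodules on `V` and on `V ∪ {x}`
are linked by two short exact sequences, whose connecting maps lower the multidegree by `x` and by
`(p - 1) x`. -/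
theorem isAcyclicAt_of_insert {x : σ} (hx : x ∉ V) (hp : 0 < p) {P : Set (σ →₀ ℕ)} {s : ℕ}
    (h0 : IsAcyclicAt K p (insert x V) P s)
    (h1 : ∀ s', s = s' + 1 →
      IsAcyclicAt K p (insert x V) {b | b + Finsupp.single x 1 ∈ P} s')
    (h2 : ∀ s', s = s' + 2 → IsAcyclicAt K p V {b | b + Finsupp.single x p ∈ P} s') :
    IsAcyclicAt K p V P s := by
  intro c hc hd
  have hins : ∀ n : σ →₀ ℕ, IsReduced p V n ↔ IsReduced p (insert x V) n ∧ n x = 0 := by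
    refine fun n => ⟨fun h => ⟨fun y => ⟨(h y).1, fun hy => (h y).2 fun hyV => hy (Or.inr hyV)⟩,
      (h x).2 hx⟩, fun h y => ⟨(h.1 y).1, fun hy => ?_⟩⟩
    by_cases hyx : y = x
    · rw [hyx, h.2]
    · exact (h.1 y).2 fun h3 => h3.elim hyx hy
  obtain ⟨y, hy, hcy⟩ := h0 c (fun l n h => ⟨(hc l n h).1, ((hins n).1 (hc l n h).2).1⟩) hd
  -- A primitive of `c` that vanishes where `x` divides the coefficient restricts to one on `V`.
  have finish : ∀ y' : List (σ →₀ ℕ) → (σ →₀ ℕ) → K, IsSupported p (insert x V) y' →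
      (∀ l n, 0 ∉ l → l.length + 1 = s → l.sum + n ∈ P → n x ≠ 0 → y' l n = 0) →
      (∀ l n, 0 ∉ l → l.length = s → l.sum + n ∈ P → c l n = MaySS.wordD y' l n) →
      ∃ y, IsSupported p V y ∧
        ∀ l n, 0 ∉ l → l.length = s → l.sum + n ∈ P → c l n = MaySS.wordD y l n := by
    intro y' hy' hz hcy'
    refine ⟨fun l n => if n x = 0 then y' l n else 0, fun l n h => ?_, fun l n hl hs hn => ?_⟩
    · dsimp only at h
      split_ifs at h with h3
      · exact ⟨(hy' _ _ h).1, (hins n).2 ⟨(hy' _ _ h).2, h3⟩⟩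
      · exact absurd rfl h
    · rw [hcy' l n hl hs hn]
      refine wordD_congr hl fun l' n' hl' h3 h4 _ => ?_
      split_ifs with h5
      · rfl
      · exact hz l' n' hl' (h3.trans hs) (h4 ▸ hn) h5
  rcases s with _ | s
  · exact finish y hy (fun l n _ h => absurd h (Nat.succ_ne_zero _)) hcy
  -- The part of `y` divisible by `x`, divided by `x`.
  set z : List (σ →₀ ℕ) → (σ →₀ ℕ) → K := fun l n => y l (n + Finsupp.single x 1) with hz
  have hzs : IsSupported p (insert x V) z := fun l n h =>
    ⟨(hy _ _ h).1, (hy _ _ h).2.of_le (self_le_add_right _ _)⟩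
  have hzd : ∀ l n, 0 ∉ l → l.length = s + 1 → l.sum + n ∈ {b | b + Finsupp.single x 1 ∈ P} →
      MaySS.wordD z l n = 0 := by
    intro l n hl hs hn
    rw [hz, wordD_shift, ← hcy l _ hl hs (by rwa [← add_assoc])]
    by_contra h
    have := ((hins _).1 (hc _ _ h).2).2
    simp at this
  obtain ⟨u, hu, hzu⟩ := h1 s rfl z hzs hzd
  have hdiv : ∀ (m : ℕ) (n : σ →₀ ℕ), m ≤ n x → ∃ n', n = n' + Finsupp.single x m := by
    intro m n hm
    refine ⟨n - Finsupp.single x m, (tsub_add_cancel_of_le ?_).symm⟩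
    rwa [Finsupp.single_le_iff]
  rcases s with _ | s
  · refine finish y hy (fun l n hl hs hn hnx => ?_) hcy
    obtain rfl : l = [] := List.length_eq_zero_iff.1 (by omega)
    obtain ⟨n', rfl⟩ := hdiv 1 n (Nat.one_le_iff_ne_zero.2 hnx)
    exact hzu [] n' hl rfl (by simpa using hn)
  -- The part of `u` with `x`-exponent `p - 1`.
  set w : List (σ →₀ ℕ) → (σ →₀ ℕ) → K := fun l n => u l (n + Finsupp.single x (p - 1)) with hw
  have hpp : ∀ n : σ →₀ ℕ, n + Finsupp.single x (p - 1) + Finsupp.single x 1 =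
      n + Finsupp.single x p := by
    intro n
    rw [add_assoc, ← Finsupp.single_add, Nat.sub_add_cancel hp]
  have hws : IsSupported p V w := fun l n h => by
    have h3 := hu _ _ h
    refine ⟨h3.1, (hins n).2 ⟨h3.2.of_le (self_le_add_right _ _), ?_⟩⟩
    have := (h3.2 x).1
    simp at this
    omega
  have hwd : ∀ l n, 0 ∉ l → l.length = s + 1 → l.sum + n ∈ {b | b + Finsupp.single x p ∈ P} →
      MaySS.wordD w l n = 0 := by
    intro l n hl hs hn
    rw [hw, wordD_shift, ← hzu l _ hl hs
      (by change _ ∈ P; rw [← add_assoc, hpp]; exact hn)]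
    by_contra h
    have := ((hy _ _ h).2 x).1
    rw [hpp] at this
    simp at this
  obtain ⟨v, hv, hwv⟩ := h2 s rfl w hws hwd
  set v' : List (σ →₀ ℕ) → (σ →₀ ℕ) → K := fun l n =>
    if p - 1 ≤ n x then v l (n - Finsupp.single x (p - 1)) else 0 with hv'
  have hvshift : (fun l n => v' l (n + Finsupp.single x (p - 1))) = v := by
    funext l n
    simp only [hv', Finsupp.add_apply, Finsupp.single_eq_same, le_add_iff_nonneg_left, zero_le,
      if_true, add_tsub_cancel_right]
  have hv's : IsSupported p (insert x V) v' := by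
    intro l n h
    simp only [hv'] at h
    split_ifs at h with h3
    · obtain ⟨n', rfl⟩ := hdiv _ _ h3
      rw [add_tsub_cancel_right] at h
      have h4 := hv _ _ h
      refine ⟨h4.1, fun j => ⟨?_, fun hj => ?_⟩⟩
      · by_cases hjx : j = x
        · subst hjx
          have := (h4.2 j).2 hx
          simp [this]; omega
        · have := (h4.2 j).1
          simpa [Finsupp.single_apply, Ne.symm hjx] using this
      · have hjx : x ≠ j := fun h => hj (Or.inl h.symm)
        have := (h4.2 j).2 fun h => hj (Or.inr h)
        simp [this, hjx]
    · exact absurd rfl h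
  set u' : List (σ →₀ ℕ) → (σ →₀ ℕ) → K := fun l n => u l n - MaySS.wordD v' l n with hu'
  have hu's : IsSupported p (insert x V) u' := hu.sub hv's.wordD
  have hutop : ∀ l n, 0 ∉ l → l.length = s → l.sum + n ∈ {b | b + Finsupp.single x p ∈ P} →
      u' l (n + Finsupp.single x (p - 1)) = 0 := by
    intro l n hl hs hn
    simp only [hu']
    rw [← wordD_shift, hvshift, ← hwv l n hl hs hn, sub_self]
  have hdu' : ∀ l n, MaySS.wordD u' l n = MaySS.wordD u l n := by
    intro l n
    rw [hu', wordD_sub, wordD_wordD, sub_zero]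
  set q : List (σ →₀ ℕ) → (σ →₀ ℕ) → K := fun l n =>
    if 1 ≤ n x ∧ n x < p then u' l (n - Finsupp.single x 1) else 0 with hq
  have hqs : IsSupported p (insert x V) q := by
    intro l n h
    simp only [hq] at h
    split_ifs at h with h3
    · obtain ⟨n', rfl⟩ := hdiv _ _ h3.1
      rw [add_tsub_cancel_right] at h
      have h4 := hu's _ _ h
      refine ⟨h4.1, fun j => ⟨?_, fun hj => ?_⟩⟩
      · by_cases hjx : j = x
        · subst hjx; exact h3.2
        · have := (h4.2 j).1
          simpa [Finsupp.single_apply, Ne.symm hjx] using this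
      · have hjx : x ≠ j := fun h => hj (Or.inl h.symm)
        simp [(h4.2 j).2 hj, hjx]
    · exact absurd rfl h
  refine finish (fun l n => y l n - MaySS.wordD q l n) (hy.sub hqs.wordD)
    (fun l n hl hs hn hnx => ?_) fun l n hl hs hn => ?_
  · obtain ⟨n', rfl⟩ := hdiv 1 n (Nat.one_le_iff_ne_zero.2 hnx)
    have h3 : MaySS.wordD (fun l n => q l (n + Finsupp.single x 1)) l n' =
        MaySS.wordD u' l n' := by
      refine wordD_congr hl fun l' m hl' h4 h5 _ => ?_
      simp only [hq, Finsupp.add_apply, Finsupp.single_eq_same, add_tsub_cancel_right]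
      split_ifs with h6
      · rfl
      · by_cases hm : p - 1 ≤ m x
        · obtain ⟨m', rfl⟩ := hdiv _ _ hm
          refine (hutop l' m' hl' (by omega) ?_).symm
          change _ ∈ P
          rw [← hpp, add_assoc l'.sum, add_assoc l'.sum, ← add_assoc l'.sum, h5, add_assoc]
          exact hn
        · omega
    have h4 : y l (n' + Finsupp.single x 1) = z l n' := rfl
    rw [← wordD_shift, h3, hdu', h4, hzu l n' hl (by omega)
      (by change _ ∈ P; rwa [add_assoc]), sub_self]
  · rw [wordD_sub, wordD_wordD, sub_zero]
    exact hcy l n hl hs hn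

/-- Vanishing below a bound `S` on multidegrees which increases by at most `1` with each variable and by
at most `2` with each `p`-th power of a variable. -/
theorem isAcyclicAt_of_lt (hp : 0 < p) (S : (σ →₀ ℕ) → ℤ) (hS0 : S 0 ≤ 0)
    (hS1 : ∀ a x, S (a + Finsupp.single x 1) ≤ S a + 1)
    (hSp : ∀ a x, S (a + Finsupp.single x p) ≤ S a + 2) (U : Finset σ) (s : ℕ) :
    ∀ (V : Finset σ), V ⊆ U → ∀ P : Set (σ →₀ ℕ), (∀ a ∈ P, ∀ x ∉ U, a x = 0) →
      (∀ a ∈ P, (s : ℤ) < S a) → IsAcyclicAt K p (V : Set σ) P s := by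
  classical
  induction s using Nat.strong_induction_on with
  | _ s ihs =>
  intro V hV
  induction hm : (U \ V).card generalizing V with
  | zero =>
    obtain rfl : V = U := le_antisymm hV (Finset.sdiff_eq_empty_iff_subset.1
      (Finset.card_eq_zero.1 hm))
    intro P hP hPS
    refine isAcyclicAt_of_support (by simpa using hP) s ?_
    rintro rfl h
    have := hPS 0 h
    push_cast at this
    omega
  | succ m ih =>
    intro P hP hPS
    obtain ⟨x, hx⟩ := Finset.card_pos.1 (by omega : 0 < (U \ V).card)
    have hxU := Finset.mem_sdiff.1 hx
    have hins : insert x V ⊆ U := Finset.insert_subset hxU.1 hV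
    refine isAcyclicAt_of_insert (x := x) (by simpa using hxU.2) hp ?_ ?_ ?_
    · rw [← Finset.coe_insert]
      refine ih (insert x V) hins ?_ P hP hPS
      rw [Finset.sdiff_insert, Finset.card_erase_of_mem hx, hm, Nat.add_sub_cancel]
    · rintro s' rfl
      rw [← Finset.coe_insert]
      refine ihs s' (by omega) _ hins _ (fun a ha y hy => ?_) fun a ha => ?_
      · have := hP _ ha y hy
        simp at this
        exact this.1
      · have h3 := hPS _ ha
        have h4 := hS1 a x
        push_cast at h3
        omega
    · rintro s' rfl
      refine ihs s' (by omega) _ hV _ (fun a ha y hy => ?_) fun a ha => ?_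
      · have := hP _ ha y hy
        simp at this
        exact this.1
      · have h3 := hPS _ ha
        have h4 := hSp a x
        push_cast at h3
        omega

end support
end MaySS

namespace MaySS

/-! ### Filtered cochain complexes -/

namespace FilteredCochain
variable {K : Type} [CommRing K] {G G' : Type} {X : FilteredCochain K G}

theorem cls_eq_cls {r s : ℕ} {t : G} {M : ℤ} {z z' : X.Z r s t M} :
    X.cls z = X.cls z' ↔ (z : X.C s) - z' ∈ X.den r s t M :=
  Submodule.Quotient.eq _

theorem cls_eq_zero {r s : ℕ} {t : G} {M : ℤ} {z : X.Z r s t M} :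
    X.cls z = 0 ↔ (z : X.C s) ∈ X.den r s t M :=
  Submodule.Quotient.mk_eq_zero _

theorem dZ_mono_of_one_le {r : ℤ} (hr : 1 ≤ r) : ∀ (s : ℕ) (t : G) (M : ℤ) (x : X.C s),
    x ∈ X.dZ 0 s t M → x ∈ X.dZ (r - 1) s t (M + r - 1)
  | 0, _, _, _, hx => hx
  | s + 1, t, M, x, hx => by
    obtain ⟨y, hy, rfl⟩ := hx
    refine ⟨y, ⟨X.mono _ _ (by omega) hy.1, ?_⟩, rfl⟩
    have h : X.d s y ∈ X.fil (s + 1) t (M - 0) := hy.2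
    change X.d s y ∈ X.fil (s + 1) t (M + r - 1 - (r - 1))
    rwa [show M + r - 1 - (r - 1) = M - 0 by ring]

/-- A term that vanishes on the first page vanishes on all pages. -/
theorem subsingleton_page {s : ℕ} {t : G} {M : ℤ} (h : Subsingleton (X.Page 1 s t M)) {r : ℕ}
    (hr : 1 ≤ r) : Subsingleton (X.Page r s t M) := by
  refine subsingleton_of_forall_eq 0 fun g => ?_
  obtain ⟨z, rfl⟩ := Submodule.Quotient.mk_surjective _ g
  refine cls_eq_zero.2 ?_
  have hz1 : (z : X.C s) ∈ X.Z (1 : ℕ) s t M :=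
    ⟨z.2.1, X.mono _ _ (by push_cast; omega) z.2.2⟩
  have h1 : (z : X.C s) ∈ X.den (1 : ℕ) s t M :=
    (cls_eq_zero (r := 1) (z := (⟨z, hz1⟩ : X.Z (1 : ℕ) s t M))).1 (Subsingleton.elim _ 0)
  obtain ⟨a, ha, b, hb, hab⟩ := Submodule.mem_sup.1 h1
  refine Submodule.mem_sup.2 ⟨a, ⟨ha.1, ?_⟩, b, ?_, hab⟩
  · change X.d s a ∈ X.fil (s + 1) t (M - 1 - ((r : ℤ) - 1))
    have h2 : X.d s a = X.d s z := by
      rw [← hab, map_add, X.d_dZ _ _ _ _ b hb, add_zero]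
    have h3 : X.d s z ∈ X.fil (s + 1) t (M - r) := z.2.2
    rw [h2, show M - 1 - ((r : ℤ) - 1) = M - r by ring]
    exact h3
  · refine dZ_mono_of_one_le (by omega) s t M b ?_
    simpa using hb

/-- An element whose differential vanishes on page `r` has a representative that survives to page
`r + 1`. -/
theorem exists_lift_of_pageDiff_eq_zero {r s : ℕ} {t : G} {M : ℤ} (z : X.Z r s t M)
    (hz : X.pageDiff r s t M (X.cls z) = 0) :
    ∃ z' : X.Z (r + 1 : ℕ) s t M, ∃ z'' : X.Z r s t M, (z'' : X.C s) = z' ∧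
      X.cls z'' = X.cls z := by
  have h : X.d s z ∈ X.den r (s + 1) t (M - r) :=
    (cls_eq_zero (z := X.dRestrict r s t M z)).1 hz
  obtain ⟨a, ha, b, ⟨y, hy, rfl⟩, hab⟩ := Submodule.mem_sup.1 h
  have hM : M - r + r - 1 = M - 1 := by ring
  rw [hM] at hy
  have hy1 : y ∈ X.fil s t M := X.mono _ _ (by omega) hy.1
  have hd : X.d s ((z : X.C s) - y) = a := by rw [map_sub, ← hab, add_sub_cancel_right]
  refine ⟨⟨(z : X.C s) - y, Submodule.sub_mem _ z.2.1 hy1, ?_⟩,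
    ⟨(z : X.C s) - y, Submodule.sub_mem _ z.2.1 hy1, ?_⟩, rfl, ?_⟩
  · change X.d s ((z : X.C s) - y) ∈ X.fil (s + 1) t (M - (r + 1 : ℕ))
    rw [hd]
    exact X.mono _ _ (by push_cast; omega) ha.1
  · change X.d s ((z : X.C s) - y) ∈ X.fil (s + 1) t (M - r)
    rw [hd]
    exact X.mono _ _ (by omega) ha.1
  · rw [cls_eq_cls]
    refine Submodule.mem_sup_left ?_
    change (z : X.C s) - y - z ∈ _
    rw [sub_sub_cancel_left]
    exact Submodule.neg_mem _ hy

/-- A `d_1`-cycle whose possible higher differentials land in zero groups is an infinite cocycle. -/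
theorem isInfiniteCocycle_of_subsingleton {s : ℕ} {t : G} {M : ℤ} (g : X.Page 1 s t M)
    (hg : X.pageDiff 1 s t M g = 0)
    (h : ∀ r : ℕ, 2 ≤ r → Subsingleton (X.Page 1 (s + 1) t (M - r))) : IsInfiniteCocycle g := by
  have hd : ∀ r (z : X.Z (r + 2 : ℕ) s t M), X.pageDiff (r + 2) s t M (X.cls z) = 0 := fun r z => by
    have := subsingleton_page (h (r + 2) (by omega)) (r := r + 2) (by omega)
    exact Subsingleton.elim _ _
  obtain ⟨z₁, rfl⟩ := Submodule.Quotient.mk_surjective _ g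
  obtain ⟨z₂, z₁', e₁, e₂⟩ := exists_lift_of_pageDiff_eq_zero z₁ hg
  choose next prev hn hc using fun r (z : X.Z (r + 2 : ℕ) s t M) =>
    exists_lift_of_pageDiff_eq_zero z (hd r z)
  let ζ : ∀ r : ℕ, X.Z (r + 2 : ℕ) s t M := fun r => Nat.rec z₂ (fun r z => next r z) r
  refine ⟨fun r => match r with
    | 0 => 0
    | 1 => X.cls z₁
    | r + 2 => X.cls (ζ r), rfl, fun r hr => ?_⟩
  match r, hr with
  | 1, _ => exact ⟨hg, z₁', z₂, e₁, e₂, rfl⟩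
  | r + 2, _ => exact ⟨hd r _, prev r (ζ r), next r (ζ r), hn r _, hc r _, rfl⟩

theorem isInfiniteCocycle_zero {s : ℕ} {t : G} {M : ℤ} :
    IsInfiniteCocycle (0 : X.Page 1 s t M) :=
  ⟨fun _ => 0, rfl, fun _ _ => ⟨map_zero _, 0, 0, rfl, rfl, rfl⟩⟩

/-- Maps of filtered complexes preserve infinite cocycles. -/
theorem IsInfiniteCocycle.pageMap {Y : FilteredCochain K G'} {γ : G → G'} (F : X.Hom Y γ)
    {s : ℕ} {t : G} {M : ℤ} {g : X.Page 1 s t M} (hg : IsInfiniteCocycle g) :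
    IsInfiniteCocycle (F.pageMap 1 s t M g) := by
  obtain ⟨c, rfl, h⟩ := hg
  refine ⟨fun r => F.pageMap r s t M (c r), rfl, fun r hr => ?_⟩
  obtain ⟨hd, z, z', e, hz, hz'⟩ := h r hr
  refine ⟨?_, ⟨F.f s z, F.map_Z z.2⟩, ⟨F.f s z', F.map_Z z'.2⟩, congrArg _ e,
    by dsimp only; rw [← hz]; rfl, by dsimp only; rw [← hz']; rfl⟩
  dsimp only
  rw [← hz] at hd ⊢
  have h1 : X.d s z ∈ X.den r (s + 1) t (M - r) :=
    (cls_eq_zero (z := X.dRestrict r s t M z)).1 hd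
  refine (cls_eq_zero (z := Y.dRestrict r s (γ t) M ⟨F.f s z, F.map_Z z.2⟩)).2 ?_
  change Y.d s (F.f s z) ∈ _
  rw [← F.comm]
  obtain ⟨a, ha, b, hb, hab⟩ := Submodule.mem_sup.1 h1
  rw [← hab, map_add]
  exact Submodule.add_mem_sup (F.map_Z ha) (F.map_dZ hb)

end FilteredCochain
end MaySS

namespace MaySS
open Finset

/-! ### Monomials in the `p`-th powers of the generators -/

section digitSums
variable {p : ℕ}

theorem digits_sum_eq (hp : 1 < p) (m : ℕ) :
    (p.digits m).sum = m % p + (p.digits (m / p)).sum := by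
  rcases Nat.eq_zero_or_pos m with rfl | hm
  · simp
  · rw [Nat.digits_def' hp hm, List.sum_cons]

theorem digits_sum_mul_add (hp : 1 < p) (q : ℕ) {r : ℕ} (hr : r < p) :
    (p.digits (p * q + r)).sum = r + (p.digits q).sum := by
  rw [digits_sum_eq hp, Nat.mul_add_mod, Nat.mod_eq_of_lt hr, Nat.mul_add_div (by omega),
    Nat.div_eq_of_lt hr, add_zero]

theorem digits_sum_add_le (hp : 1 < p) (a b : ℕ) :
    (p.digits (a + b)).sum ≤ (p.digits a).sum + (p.digits b).sum := by
  induction hm : a + b using Nat.strong_induction_on generalizing a b with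
  | _ m ih =>
    subst hm
    rcases Nat.eq_zero_or_pos (a + b) with h0 | h0
    · simp [h0]
    have hlt : a / p + b / p < a + b := by
      rcases Nat.eq_zero_or_pos a with rfl | ha
      · simpa using Nat.div_lt_self (by omega : 0 < b) hp
      · exact add_lt_add_of_lt_of_le (Nat.div_lt_self ha hp) (Nat.div_le_self _ _)
    have h1 := ih _ hlt (a / p) (b / p) rfl
    rw [digits_sum_eq hp (a + b), digits_sum_eq hp a, digits_sum_eq hp b]
    have hda := Nat.div_add_mod a p
    have hdb := Nat.div_add_mod b p
    have hra := Nat.mod_lt a (by omega : 0 < p)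
    have hrb := Nat.mod_lt b (by omega : 0 < p)
    rcases lt_or_ge (a % p + b % p) p with h2 | h2
    · rw [Nat.add_div_eq_of_add_mod_lt h2, Nat.add_mod_of_add_mod_lt h2]
      omega
    · have h3 : (a + b) / p = a / p + b / p + 1 := Nat.add_div_eq_of_le_mod_add_mod h2 (by omega)
      have h4 : (a + b) % p + p = a % p + b % p := Nat.add_mod_add_of_le_add_mod h2
      have h5 : a / p + b / p + 1 < a + b := by
        have h6 := Nat.mul_le_mul_right (a / p + b / p) (by omega : 2 ≤ p)
        rw [mul_add p] at h6
        omega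
      have h7 := ih _ h5 (a / p + b / p) 1 rfl
      have h8 : (p.digits 1).sum = 1 := by
        rw [Nat.digits_of_lt p 1 one_ne_zero hp]; simp
      rw [h3]
      omega

theorem digits_sum_pow_mul (hp : 1 < p) (j m : ℕ) :
    (p.digits (p ^ j * m)).sum = (p.digits m).sum := by
  induction j with
  | zero => simp
  | succ j ih =>
    have := digits_sum_mul_add hp (p ^ j * m) (r := 0) (by omega)
    rw [pow_succ', mul_assoc, ← ih]
    simpa using this

theorem digits_sum_repunit_le (hp : 1 < p) (i : ℕ) :
    (p.digits (∑ l ∈ range i, p ^ l)).sum ≤ i := by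
  induction i with
  | zero => simp
  | succ i ih =>
    rw [sum_range_succ]
    refine (digits_sum_add_le hp _ _).trans ?_
    rw [digits_pow_sum hp]
    omega

theorem digits_sum_sum_range (hp : 1 < p) (b : ℕ → ℕ) (hb : ∀ j, b j < p) (J : ℕ) :
    (p.digits (∑ j ∈ range J, b j * p ^ j)).sum = ∑ j ∈ range J, b j := by
  induction J generalizing b with
  | zero => simp
  | succ J ih =>
    have h : ∑ j ∈ range (J + 1), b j * p ^ j =
        p * ∑ j ∈ range J, b (j + 1) * p ^ j + b 0 := by
      rw [sum_range_succ', mul_sum]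
      simp only [pow_zero, mul_one, pow_succ']
      congr 1
      exact sum_congr rfl fun j _ => by ring
    rw [h, digits_sum_mul_add hp _ (hb 0), ih _ fun j => hb (j + 1), sum_range_succ', add_comm]

theorem eq_of_sum_range_eq (hp : 1 < p) {b c : ℕ → ℕ} (hb : ∀ j, b j < p) (hc : ∀ j, c j < p)
    {J : ℕ} (h : ∑ j ∈ range J, b j * p ^ j = ∑ j ∈ range J, c j * p ^ j) :
    ∀ j < J, b j = c j := by
  induction J generalizing b c with
  | zero => intro j hj; omega
  | succ J ih =>
    have h' : ∀ b : ℕ → ℕ, ∑ j ∈ range (J + 1), b j * p ^ j =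
        p * ∑ j ∈ range J, b (j + 1) * p ^ j + b 0 := by
      intro b
      rw [sum_range_succ', mul_sum]
      simp only [pow_zero, mul_one, pow_succ']
      congr 1
      exact sum_congr rfl fun j _ => by ring
    rw [h', h'] at h
    have h0 : b 0 = c 0 := by
      have := congrArg (· % p) h
      simpa [Nat.mod_eq_of_lt (hb 0), Nat.mod_eq_of_lt (hc 0)] using this
    rw [h0, Nat.add_right_cancel_iff] at h
    have h2 := ih (fun j => hb (j + 1)) (fun j => hc (j + 1))
      (Nat.eq_of_mul_eq_mul_left (by omega) h)
    rintro (_ | j) hj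
    · exact h0
    · exact h2 j (by omega)

end digitSums

section digits
variable {ι : Type} (p : ℕ)

/-- The exponents of `∏ (x_i^(p^j))^(a (i, j))`, a monomial in the `p`-th powers of the generators. -/
noncomputable def digitVal : ((ι × ℕ) →₀ ℕ) →+ (ι →₀ ℕ) :=
  Finsupp.liftAddHom fun x => (Finsupp.singleAddHom x.1).comp (AddMonoidHom.mulRight (p ^ x.2))

/-- The total weight of `∏ (x_i^(p^j))^(a (i, j))`, where each `x_i^(p^j)` has weight `wt i`. -/
noncomputable def digitWt (wt : ι → ℕ) : ((ι × ℕ) →₀ ℕ) →+ ℕ :=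
  Finsupp.liftAddHom fun x => AddMonoidHom.mulRight (wt x.1)

theorem digitVal_single (x : ι × ℕ) (m : ℕ) :
    digitVal p (Finsupp.single x m) = Finsupp.single x.1 (m * p ^ x.2) := by
  simp [digitVal]

theorem digitWt_single (wt : ι → ℕ) (x : ι × ℕ) (m : ℕ) :
    digitWt wt (Finsupp.single x m) = m * wt x.1 := by
  simp [digitWt]

theorem exists_bound (a : (ι × ℕ) →₀ ℕ) : ∃ J, ∀ J' ≥ J, ∀ x, J' ≤ x.2 → a x = 0 := by
  refine ⟨a.support.sup Prod.snd + 1, fun J' hJ x hx => ?_⟩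
  by_contra h
  have := Finset.le_sup (f := Prod.snd) (Finsupp.mem_support_iff.2 h)
  omega

variable {p}

theorem digitVal_apply [Fintype ι] {a : (ι × ℕ) →₀ ℕ} {J : ℕ} (hJ : ∀ x, J ≤ x.2 → a x = 0) (i : ι) :
    digitVal p a i = ∑ j ∈ range J, a (i, j) * p ^ j := by
  classical
  have h : digitVal p a = a.sum fun x m => Finsupp.single x.1 (m * p ^ x.2) := rfl
  rw [h, Finsupp.sum_of_support_subset _ (s := univ ×ˢ range J), Finsupp.finsetSum_apply,
    Finset.sum_product, Finset.sum_eq_single i]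
  · simp
  · intro i' _ hi'
    exact Finset.sum_eq_zero fun j _ => Finsupp.single_eq_of_ne hi'.symm
  · simp
  · intro x hx
    simp only [mem_product, mem_univ, true_and, mem_range]
    by_contra h
    exact Finsupp.mem_support_iff.1 hx (hJ x (by omega))
  · simp

theorem digitWt_eq [Fintype ι] (wt : ι → ℕ) {a : (ι × ℕ) →₀ ℕ} {J : ℕ} (hJ : ∀ x, J ≤ x.2 → a x = 0) :
    digitWt wt a = ∑ i, (∑ j ∈ range J, a (i, j)) * wt i := by
  classical
  have h : digitWt wt a = a.sum fun x m => m * wt x.1 := rfl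
  rw [h, Finsupp.sum_of_support_subset _ (s := univ ×ˢ range J), Finset.sum_product]
  · simp [Finset.sum_mul]
  · intro x hx
    simp only [mem_product, mem_univ, true_and, mem_range]
    by_contra h
    exact Finsupp.mem_support_iff.1 hx (hJ x (by omega))
  · simp

/-- For reduced `a` the May filtration is the weight, since the `a (i, j)` are the `p`-adic digits of the
exponents. -/
theorem monoMay_digitVal [Fintype ι] (hp : 1 < p) (wt : ι → ℕ) {a : (ι × ℕ) →₀ ℕ} (ha : IsReduced p Set.univ a) :
    monoMay p wt (digitVal p a) = digitWt wt a := by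
  obtain ⟨J, hJ⟩ := exists_bound a
  rw [digitWt_eq wt (hJ J le_rfl), monoMay, Finsupp.sum_fintype _ _ (by simp)]
  refine Finset.sum_congr rfl fun i _ => ?_
  rw [digitVal_apply (hJ J le_rfl), digits_sum_sum_range hp _ fun j => (ha (i, j)).1]

theorem digitVal_injOn [Fintype ι] (hp : 1 < p) {a b : (ι × ℕ) →₀ ℕ} (ha : IsReduced p Set.univ a)
    (hb : IsReduced p Set.univ b) (h : digitVal p a = digitVal p b) : a = b := by
  obtain ⟨J, hJ⟩ := exists_bound a
  obtain ⟨J', hJ'⟩ := exists_bound b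
  have h1 := hJ (max J J') (le_max_left _ _)
  have h2 := hJ' (max J J') (le_max_right _ _)
  ext ⟨i, j⟩
  rcases le_or_gt (max J J') j with hj | hj
  · rw [h1 _ hj, h2 _ hj]
  · have h3 := DFunLike.congr_fun h i
    rw [digitVal_apply h1, digitVal_apply h2] at h3
    exact eq_of_sum_range_eq hp (fun j => (ha (i, j)).1) (fun j => (hb (i, j)).1) h3 j hj

theorem exists_digitVal_eq [Fintype ι] (hp : 1 < p) (e : ι →₀ ℕ) :
    ∃ a : (ι × ℕ) →₀ ℕ, IsReduced p Set.univ a ∧ digitVal p a = e := by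
  classical
  have hlt : ∀ i, ∀ j, (univ.sup e) + 1 ≤ j → e i < p ^ j := by
    intro i j hj
    have h1 : e i ≤ univ.sup e := Finset.le_sup (mem_univ i)
    exact (by omega : e i < j).trans (Nat.lt_pow_self hp)
  let a : (ι × ℕ) →₀ ℕ := Finsupp.onFinset (univ ×ˢ range (univ.sup e + 1))
    (fun x => e x.1 / p ^ x.2 % p) (by
      intro x hx
      simp only [mem_product, mem_univ, true_and, mem_range]
      by_contra h
      exact hx (by rw [Nat.div_eq_of_lt (hlt _ _ (by omega)), Nat.zero_mod]))
  refine ⟨a, fun x => ⟨Nat.mod_lt _ (by omega), fun h => absurd (Set.mem_univ x) h⟩, ?_⟩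
  ext i
  rw [digitVal_apply (J := univ.sup e + 1)]
  · have : ∀ J, ∑ j ∈ range J, a (i, j) * p ^ j = e i % p ^ J := by
      intro J
      induction J with
      | zero => simp [Nat.mod_one]
      | succ J ih => rw [sum_range_succ, ih, Nat.mod_pow_succ, mul_comm]; rfl
    rw [this, Nat.mod_eq_of_lt (hlt i _ le_rfl)]
  · intro x hx
    change e x.1 / p ^ x.2 % p = 0
    rw [Nat.div_eq_of_lt (hlt _ _ hx), Nat.zero_mod]

theorem monoMay_add_le (hp : 1 < p) (wt : ι → ℕ) (e e' : ι →₀ ℕ) :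
    monoMay p wt (e + e') ≤ monoMay p wt e + monoMay p wt e' := by
  classical
  simp only [monoMay]
  rw [Finsupp.sum_of_support_subset _ Finsupp.support_add _ (by simp),
    Finsupp.sum_of_support_subset e (s := e.support ∪ e'.support) subset_union_left _ (by simp),
    Finsupp.sum_of_support_subset e' (s := e.support ∪ e'.support) subset_union_right _ (by simp),
    ← Finset.sum_add_distrib]
  refine Finset.sum_le_sum fun i _ => ?_
  rw [← add_mul]
  exact Nat.mul_le_mul_right _ (digits_sum_add_le hp _ _)

end digits

theorem monoDeg_add {ι G : Type} [AddCommMonoid G] (deg : ι → G) (e e' : ι →₀ ℕ) :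
    monoDeg deg (e + e') = monoDeg deg e + monoDeg deg e' := by
  classical
  exact Finsupp.sum_add_index' (fun _ => zero_smul _ _) fun _ _ _ => add_smul _ _ _

theorem finite_setOf_length_eq {α : Type*} {F : Set α} (hF : F.Finite) (s : ℕ) :
    {l : List α | l.length = s ∧ ∀ f ∈ l, f ∈ F}.Finite := by
  have := hF.to_subtype
  refine ((List.finite_length_eq F s).image (List.map Subtype.val)).subset ?_
  rintro l ⟨hl, h⟩
  lift l to List F using h
  exact ⟨l, by simpa using hl, rfl⟩

/-- Induction on a finitely supported function, one variable at a time. -/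
theorem finsupp_induction_single {α : Type*} {P : (α →₀ ℕ) → Prop} (h0 : P 0)
    (h1 : ∀ a x, P a → P (a + Finsupp.single x 1)) (a : α →₀ ℕ) : P a := by
  have key : ∀ (x : α) (m : ℕ) (a : α →₀ ℕ), P a → P (a + Finsupp.single x m) := by
    intro x m
    induction m with
    | zero => intro a ha; simpa using ha
    | succ m ih =>
      intro a ha
      rw [Finsupp.single_add, ← add_assoc]
      exact h1 _ _ (ih a ha)
  induction a using Finsupp.induction with
  | zero => exact h0
  | single_add x m a _ _ ih => rw [add_comm]; exact key x m a ih

end MaySS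

namespace MaySS
open scoped TensorProduct
open Finset

/-! ### The coproduct of `T(n,k)` modulo lower filtration -/

section factorial
variable (p : ℕ) {α : Type*}

/-- The product of the factorials of the exponents, the denominator of a divided power. -/
noncomputable def digitFactorial (a : α →₀ ℕ) : ZMod p := a.prod fun _ m => (m.factorial : ZMod p)

theorem digitFactorial_add_single (a : α →₀ ℕ) (x : α) :
    digitFactorial p (a + Finsupp.single x 1) = (a x + 1 : ℕ) * digitFactorial p a := by
  classical
  have h : ∀ b : α →₀ ℕ, b.support ⊆ insert x a.support →
      digitFactorial p b = ∏ y ∈ insert x a.support, ((b y).factorial : ZMod p) := fun b hb =>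
    Finsupp.prod_of_support_subset _ hb _ (by simp)
  rw [h a (subset_insert _ _), h (a + Finsupp.single x 1),
    ← Finset.mul_prod_erase _ _ (mem_insert_self x _), ← Finset.mul_prod_erase _ _ (mem_insert_self x _),
    ← mul_assoc]
  · congr 1
    · simp [Nat.factorial_succ]
    · refine Finset.prod_congr rfl fun y hy => ?_
      rw [Finsupp.add_apply, Finsupp.single_eq_of_ne (ne_of_mem_erase hy), add_zero]
  · refine Finsupp.support_add.trans (union_subset (subset_insert _ _) ?_)
    exact Finsupp.support_single_subset.trans (by simp)

theorem digitFactorial_ne_zero [Fact p.Prime] {a : α →₀ ℕ} (ha : IsReduced p Set.univ a) :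
    digitFactorial p a ≠ 0 := by
  refine Finset.prod_ne_zero_iff.2 fun x _ => ?_
  rw [Ne, ZMod.natCast_eq_zero_iff, (Fact.out : p.Prime).dvd_factorial]
  exact not_le.2 (ha x).1

end factorial

instance (n k : ℕ) : Fintype (TIdx n k) :=
  Fintype.subtype (Ico k (n + k)) (by simp)

section T
variable (p n k : ℕ)

/-- The monomial with exponents `e` in the generators `ξ_i`. -/
noncomputable def xiMono (e : TIdx n k →₀ ℕ) : T p n k := mono (fun i : TIdx n k => T.xi p n k i.1) e

/-- The monomial `∏ (ξ_i^(p^j))^(a (i, j))`. -/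
noncomputable def digitMono (a : (TIdx n k × ℕ) →₀ ℕ) : T p n k := xiMono p n k (digitVal p a)

variable {n k} in
/-- The inner degree of `∏ (ξ_i^(p^j))^(a (i, j))`. -/
noncomputable def digitDeg (a : (TIdx n k × ℕ) →₀ ℕ) : ℕ :=
  monoDeg (fun i : TIdx n k => innerDeg p i.1) (digitVal p a)

variable {n k} in
/-- The May filtration of `∏ (ξ_i^(p^j))^(a (i, j))`, for reduced `a`. -/
noncomputable def mayWt : ((TIdx n k × ℕ) →₀ ℕ) →+ ℕ := digitWt fun i : TIdx n k => 2 * i.1 - 1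

variable {p n k}

theorem digitDeg_add (a b : (TIdx n k × ℕ) →₀ ℕ) :
    digitDeg p (a + b) = digitDeg p a + digitDeg p b := by
  rw [digitDeg, map_add, monoDeg_add]; rfl

theorem digitDeg_single (x : TIdx n k × ℕ) (m : ℕ) :
    digitDeg p (Finsupp.single x m) = m * p ^ x.2 * innerDeg p x.1 := by
  rw [digitDeg, digitVal_single, monoDeg, Finsupp.sum_single_index (by simp), smul_eq_mul]

theorem xiMono_zero : xiMono p n k 0 = 1 := by simp [xiMono, mono]

theorem xiMono_add (e e' : TIdx n k →₀ ℕ) :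
    xiMono p n k (e + e') = xiMono p n k e * xiMono p n k e' := by
  classical
  exact Finsupp.prod_add_index' (fun _ => pow_zero _) fun _ _ _ => pow_add _ _ _

theorem xiMono_single (i : TIdx n k) (m : ℕ) :
    xiMono p n k (Finsupp.single i m) = T.xi p n k i.1 ^ m := by
  rw [xiMono, mono, Finsupp.prod_single_index (by simp)]

theorem digitMono_zero : digitMono p n k 0 = 1 := by rw [digitMono, map_zero, xiMono_zero]

theorem digitMono_add (a b : (TIdx n k × ℕ) →₀ ℕ) :
    digitMono p n k (a + b) = digitMono p n k a * digitMono p n k b := by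
  rw [digitMono, map_add, xiMono_add]; rfl

section coeff
variable [NeZero k]

theorem xiMono_eq_monomial (e : TIdx n k →₀ ℕ) :
    xiMono p n k e = (MvPolynomial.monomial e (1 : ZMod p) : MvPolynomial (TIdx n k) (ZMod p)) := by
  have h : (fun i : TIdx n k => T.xi p n k i.1) =
      fun i => (MvPolynomial.X i : MvPolynomial (TIdx n k) (ZMod p)) := by
    funext i
    have h0 : i.1 ≠ 0 := by have := NeZero.ne k; have := i.2.1; omega
    rw [T.xi, if_neg h0, dif_pos i.2]
    rfl
  rw [xiMono, h, MvPolynomial.monomial_eq, map_one, one_mul]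
  rfl

end coeff

variable (p n k) in
/-- The coefficient of a monomial, as a linear functional. -/
noncomputable def xiCoeff (e : TIdx n k →₀ ℕ) : T p n k →ₗ[ZMod p] ZMod p :=
  (MvPolynomial.lcoeff (ZMod p) e : MvPolynomial (TIdx n k) (ZMod p) →ₗ[ZMod p] ZMod p)

open Classical in
theorem xiCoeff_xiMono [NeZero k] (e e' : TIdx n k →₀ ℕ) :
    xiCoeff p n k e (xiMono p n k e') = if e' = e then 1 else 0 := by
  rw [xiMono_eq_monomial]
  exact MvPolynomial.coeff_monomial _ _ _

variable (p n k) in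
open Classical in
/-- The functional dual to the divided power `∏ (ξ_i^(p^j))^(a (i, j)) / a (i, j)!` among the monomials;
it is zero if `a` is not reduced. -/
noncomputable def dualCoeff (a : (TIdx n k × ℕ) →₀ ℕ) : T p n k →ₗ[ZMod p] ZMod p :=
  if IsReduced p Set.univ a then digitFactorial p a • xiCoeff p n k (digitVal p a) else 0

theorem dualCoeff_of_not_isReduced {a : (TIdx n k × ℕ) →₀ ℕ} (ha : ¬IsReduced p Set.univ a) :
    dualCoeff p n k a = 0 := if_neg ha

open Classical in
theorem dualCoeff_xiMono [NeZero k] {a : (TIdx n k × ℕ) →₀ ℕ} (ha : IsReduced p Set.univ a)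
    (e : TIdx n k →₀ ℕ) : dualCoeff p n k a (xiMono p n k e) =
      if e = digitVal p a then digitFactorial p a else 0 := by
  rw [dualCoeff, if_pos ha, LinearMap.smul_apply, xiCoeff_xiMono]
  split_ifs <;> simp

variable [Fact p.Prime]

open Classical in
theorem dualCoeff_digitMono [NeZero k] (a : (TIdx n k × ℕ) →₀ ℕ) {b : (TIdx n k × ℕ) →₀ ℕ}
    (hb : IsReduced p Set.univ b) : dualCoeff p n k a (digitMono p n k b) =
      if a = b then digitFactorial p a else 0 := by
  by_cases ha : IsReduced p Set.univ a
  · rw [digitMono, dualCoeff_xiMono ha]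
    congr 1
    exact propext ⟨fun h => (digitVal_injOn (Fact.out : p.Prime).one_lt hb ha h).symm, fun h => h ▸ rfl⟩
  · rw [dualCoeff_of_not_isReduced ha, if_neg (fun h : a = b => ha (h ▸ hb)), LinearMap.zero_apply]

/-- Multiplication by `ξ_i^(p^j)` is dual to a derivation, as long as no carry occurs. -/
theorem dualCoeff_mul_single [NeZero k] (b : (TIdx n k × ℕ) →₀ ℕ) {a : (TIdx n k × ℕ) →₀ ℕ} {x : TIdx n k × ℕ}
    (ha : IsReduced p Set.univ (a + Finsupp.single x 1)) :
    dualCoeff p n k b (digitMono p n k a * digitMono p n k (Finsupp.single x 1)) =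
      b x * dualCoeff p n k (b - Finsupp.single x 1) (digitMono p n k a) := by
  rw [← digitMono_add, dualCoeff_digitMono _ ha,
    dualCoeff_digitMono _ (ha.of_le (self_le_add_right _ _))]
  rcases Nat.eq_zero_or_pos (b x) with hb | hb
  · rw [hb, Nat.cast_zero, zero_mul, if_neg]
    rintro rfl
    simp at hb
  · obtain ⟨c, rfl⟩ : ∃ c, b = c + Finsupp.single x 1 :=
      ⟨b - Finsupp.single x 1, (tsub_add_cancel_of_le (by rwa [Finsupp.single_le_iff])).symm⟩
    rw [add_tsub_cancel_right]
    simp only [add_left_inj]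
    split_ifs with h
    · rw [digitFactorial_add_single]; simp
    · simp

variable (p n k)

/-- The pairing of two dual functionals with an element of `T ⊗ T`. -/
noncomputable def dualPair (b c : (TIdx n k × ℕ) →₀ ℕ) :
    T p n k ⊗[ZMod p] T p n k →ₗ[ZMod p] ZMod p :=
  LinearMap.mul' (ZMod p) (ZMod p) ∘ₗ TensorProduct.map (dualCoeff p n k b) (dualCoeff p n k c)

/-- The elements of inner degree `t` and of May filtration at most `m` in `T ⊗ T`. -/
noncomputable def tensorFil (t : ℕ) (m : ℤ) : Submodule (ZMod p) (T p n k ⊗[ZMod p] T p n k) :=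
  Submodule.span (ZMod p) {y | ∃ e e' : TIdx n k →₀ ℕ,
    monoDeg (fun i : TIdx n k => innerDeg p i.1) e +
      monoDeg (fun i : TIdx n k => innerDeg p i.1) e' = t ∧
    ((monoMay p (fun i : TIdx n k => 2 * i.1 - 1) e +
      monoMay p (fun i : TIdx n k => 2 * i.1 - 1) e' : ℕ) : ℤ) ≤ m ∧
    y = xiMono p n k e ⊗ₜ[ZMod p] xiMono p n k e'}

/-- The elements of `T ⊗ T` which, up to lower filtration, lie in the multidegree `a`. -/
noncomputable def leadingPart (a : (TIdx n k × ℕ) →₀ ℕ) :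
    Submodule (ZMod p) (T p n k ⊗[ZMod p] T p n k) :=
  Submodule.span (ZMod p) {y | ∃ b c, b + c = a ∧
    y = digitMono p n k b ⊗ₜ[ZMod p] digitMono p n k c} ⊔
  tensorFil p n k (digitDeg p a) (mayWt a - 1)

variable {p n k}

theorem dualPair_tmul (b c : (TIdx n k × ℕ) →₀ ℕ) (u v : T p n k) :
    dualPair p n k b c (u ⊗ₜ[ZMod p] v) = dualCoeff p n k b u * dualCoeff p n k c v := rfl

theorem monoMay_digitVal_le (a : (TIdx n k × ℕ) →₀ ℕ) :
    monoMay p (fun i : TIdx n k => 2 * i.1 - 1) (digitVal p a) ≤ mayWt a := by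
  induction a using finsupp_induction_single with
  | h0 => simp [monoMay]
  | h1 a x ih =>
    rw [map_add, map_add]
    refine (monoMay_add_le (Fact.out : p.Prime).one_lt _ _ _).trans (add_le_add ih (le_of_eq ?_))
    rw [digitVal_single, mayWt, digitWt_single, monoMay, Finsupp.sum_single_index (by simp), one_mul,
      digits_pow_sum (Fact.out : p.Prime).one_lt]

theorem tensorFil_mono (t : ℕ) {m m' : ℤ} (h : m ≤ m') : tensorFil p n k t m ≤ tensorFil p n k t m' :=
  Submodule.span_mono fun _ ⟨e, e', h1, h2, h3⟩ => ⟨e, e', h1, h2.trans h, h3⟩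

theorem mul_mem_tensorFil {t t' : ℕ} {m m' : ℤ} {u v : T p n k ⊗[ZMod p] T p n k}
    (hu : u ∈ tensorFil p n k t m) (hv : v ∈ tensorFil p n k t' m') :
    u * v ∈ tensorFil p n k (t + t') (m + m') := by
  have h := Submodule.mul_mem_mul hu hv
  rw [tensorFil, tensorFil, Submodule.span_mul_span] at h
  refine Submodule.span_le.2 ?_ h
  rintro _ ⟨_, ⟨e, e', h1, h2, rfl⟩, _, ⟨f, f', h3, h4, rfl⟩, rfl⟩
  refine Submodule.subset_span ⟨e + f, e' + f', ?_, ?_, ?_⟩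
  · rw [monoDeg_add, monoDeg_add, ← h1, ← h3]; ring
  · have h5 := monoMay_add_le (Fact.out : p.Prime).one_lt (fun i : TIdx n k => 2 * i.1 - 1) e f
    have h6 := monoMay_add_le (Fact.out : p.Prime).one_lt (fun i : TIdx n k => 2 * i.1 - 1) e' f'
    push_cast at h2 h4 ⊢
    omega
  · rw [xiMono_add, xiMono_add]
    exact Algebra.TensorProduct.tmul_mul_tmul _ _ _ _

theorem leadingPart_le_tensorFil (a : (TIdx n k × ℕ) →₀ ℕ) :
    leadingPart p n k a ≤ tensorFil p n k (digitDeg p a) (mayWt a) := by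
  refine sup_le (Submodule.span_le.2 ?_) (tensorFil_mono _ (by omega))
  rintro _ ⟨b, c, rfl, rfl⟩
  refine Submodule.subset_span ⟨_, _, (digitDeg_add b c).symm, ?_, rfl⟩
  rw [map_add]
  exact_mod_cast add_le_add (monoMay_digitVal_le b) (monoMay_digitVal_le c)

theorem dualPair_eq_zero [NeZero k] {t : ℕ} {m : ℤ} {b c : (TIdx n k × ℕ) →₀ ℕ}
    (h : m < (mayWt b + mayWt c : ℕ)) {u : T p n k ⊗[ZMod p] T p n k} (hu : u ∈ tensorFil p n k t m) :
    dualPair p n k b c u = 0 := by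
  suffices hle : tensorFil p n k t m ≤ LinearMap.ker (dualPair p n k b c) from hle hu
  refine Submodule.span_le.2 ?_
  rintro _ ⟨e, e', h1, h2, rfl⟩
  change dualPair p n k b c _ = 0
  rw [dualPair_tmul]
  by_contra h3
  have key : ∀ (b : (TIdx n k × ℕ) →₀ ℕ) (e : TIdx n k →₀ ℕ),
      dualCoeff p n k b (xiMono p n k e) ≠ 0 →
      monoMay p (fun i : TIdx n k => 2 * i.1 - 1) e = mayWt b := by
    intro b e hb
    by_cases hred : IsReduced p Set.univ b
    · rw [dualCoeff_xiMono hred] at hb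
      split_ifs at hb with he
      · rw [he, monoMay_digitVal (Fact.out : p.Prime).one_lt _ hred]; rfl
      · exact absurd rfl hb
    · rw [dualCoeff_of_not_isReduced hred] at hb
      exact absurd rfl hb
  rw [key b e (left_ne_zero_of_mul h3), key c e' (right_ne_zero_of_mul h3)] at h2
  omega

/-- Up to lower filtration, `ξ_i^(p^j)` is primitive. -/
theorem comul_single [NeZero k] (x : TIdx n k × ℕ) :
    ∃ τ ∈ tensorFil p n k (digitDeg p (Finsupp.single x 1)) (mayWt (Finsupp.single x 1) - 1),
      T.comul p n k (digitMono p n k (Finsupp.single x 1)) =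
        digitMono p n k (Finsupp.single x 1) ⊗ₜ[ZMod p] 1 +
          1 ⊗ₜ[ZMod p] digitMono p n k (Finsupp.single x 1) + τ := by
  obtain ⟨⟨i, hi⟩, j⟩ := x
  have hk := NeZero.ne k
  have hp1 : 1 < p := (Fact.out : p.Prime).one_lt
  have hp0 : ∀ m, p ^ m ≠ 0 := fun m => pow_ne_zero _ (by omega)
  have hTT : CharP (T p n k ⊗[ZMod p] T p n k) p := charP_tensor (T.counit p n k) (T.counit p n k)
  rw [digitMono, digitVal_single, one_mul, xiMono_single, map_pow, T.comul_xi _ hi.2, sum_pow_char_pow,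
    ← Finset.add_sum_erase _ _ (HasAntidiagonal.mem_antidiagonal.2 (add_zero i) : (i, 0) ∈ antidiagonal i),
    ← Finset.add_sum_erase _ _ (mem_erase.2 ⟨by simp; omega, HasAntidiagonal.mem_antidiagonal.2 (zero_add i)⟩ :
      (0, i) ∈ (antidiagonal i).erase (i, 0)), ← add_assoc]
  refine ⟨_, ?_, congrArg₂ _ (congrArg₂ _ ?_ ?_) rfl⟩
  · refine Submodule.sum_mem _ ?_
    rintro ⟨a, b⟩ hx
    simp only [mem_erase, HasAntidiagonal.mem_antidiagonal, Ne, Prod.mk.injEq] at hx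
    have hzero : ∀ c < k, c ≠ 0 → T.xi p n k c = 0 := by
      intro c hc h0
      rw [T.xi, if_neg h0, dif_neg (by omega)]
    by_cases ha : a < k
    · rw [hzero a ha (by omega), TensorProduct.zero_tmul, zero_pow (hp0 _)]
      exact Submodule.zero_mem _
    by_cases hb : b < k
    · rw [hzero b hb (by omega), zero_pow (hp0 _), TensorProduct.tmul_zero, zero_pow (hp0 _)]
      exact Submodule.zero_mem _
    refine Submodule.subset_span ⟨Finsupp.single ⟨a, by omega⟩ (p ^ j),
      Finsupp.single ⟨b, by omega⟩ (p ^ (a + j)), ?_, ?_, ?_⟩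
    · rw [digitDeg_single]
      simp only [monoDeg, smul_eq_mul, Finsupp.sum_single_index, zero_mul, ← hx.2.2, innerDeg_add]
      ring
    · rw [mayWt, digitWt_single]
      simp only [monoMay, Finsupp.sum_single_index, Nat.digits_zero, List.sum_nil, zero_mul,
        digits_pow_sum hp1, one_mul]
      omega
    · rw [xiMono_single, xiMono_single, Algebra.TensorProduct.tmul_pow, ← pow_mul, ← pow_add]
  · rw [Algebra.TensorProduct.tmul_pow]; simp [T.xi]
  · rw [Algebra.TensorProduct.tmul_pow]; simp [T.xi]

theorem digitMono_tmul_one_mem (x : TIdx n k × ℕ) :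
    digitMono p n k (Finsupp.single x 1) ⊗ₜ[ZMod p] (1 : T p n k) ∈
      tensorFil p n k (digitDeg p (Finsupp.single x 1)) (mayWt (Finsupp.single x 1)) :=
  leadingPart_le_tensorFil _ <| Submodule.mem_sup_left <| Submodule.subset_span
    ⟨Finsupp.single x 1, 0, add_zero _, by rw [digitMono_zero]⟩

theorem one_tmul_digitMono_mem (x : TIdx n k × ℕ) :
    (1 : T p n k) ⊗ₜ[ZMod p] digitMono p n k (Finsupp.single x 1) ∈
      tensorFil p n k (digitDeg p (Finsupp.single x 1)) (mayWt (Finsupp.single x 1)) :=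
  leadingPart_le_tensorFil _ <| Submodule.mem_sup_left <| Submodule.subset_span
    ⟨0, Finsupp.single x 1, zero_add _, by rw [digitMono_zero]⟩

theorem mul_tmul_one_mem_leadingPart {a : (TIdx n k × ℕ) →₀ ℕ} (x : TIdx n k × ℕ)
    {u : T p n k ⊗[ZMod p] T p n k} (hu : u ∈ leadingPart p n k a) :
    u * (digitMono p n k (Finsupp.single x 1) ⊗ₜ[ZMod p] 1) ∈
        leadingPart p n k (a + Finsupp.single x 1) ∧
      u * (1 ⊗ₜ[ZMod p] digitMono p n k (Finsupp.single x 1)) ∈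
        leadingPart p n k (a + Finsupp.single x 1) := by
  have hF : ∀ w ∈ tensorFil p n k (digitDeg p (Finsupp.single x 1)) (mayWt (Finsupp.single x 1)),
      ∀ v ∈ tensorFil p n k (digitDeg p a) (mayWt a - 1),
      v * w ∈ leadingPart p n k (a + Finsupp.single x 1) := by
    intro w hw v hv
    refine Submodule.mem_sup_right ?_
    have := mul_mem_tensorFil hv hw
    rw [digitDeg_add, map_add]
    push_cast
    rwa [sub_add_eq_add_sub] at this
  have hS : ∀ w : T p n k ⊗[ZMod p] T p n k, (∀ b c, b + c = a →
      digitMono p n k b ⊗ₜ[ZMod p] digitMono p n k c * w ∈ leadingPart p n k (a + Finsupp.single x 1)) →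
      w ∈ tensorFil p n k (digitDeg p (Finsupp.single x 1)) (mayWt (Finsupp.single x 1)) →
      u * w ∈ leadingPart p n k (a + Finsupp.single x 1) := by
    intro w hw hw'
    suffices h : leadingPart p n k a ≤
      (leadingPart p n k (a + Finsupp.single x 1)).comap (LinearMap.mulRight (ZMod p) w) from h hu
    refine sup_le (Submodule.span_le.2 ?_) fun v hv => hF w hw' v hv
    rintro _ ⟨b, c, hbc, rfl⟩
    exact hw b c hbc
  refine ⟨hS _ (fun b c hbc => ?_) (digitMono_tmul_one_mem x),
    hS _ (fun b c hbc => ?_) (one_tmul_digitMono_mem x)⟩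
  · refine Submodule.mem_sup_left (Submodule.subset_span
      ⟨b + Finsupp.single x 1, c, by rw [← hbc, add_right_comm], ?_⟩)
    rw [Algebra.TensorProduct.tmul_mul_tmul, mul_one, digitMono_add]
  · refine Submodule.mem_sup_left (Submodule.subset_span
      ⟨b, c + Finsupp.single x 1, by rw [← hbc, add_assoc], ?_⟩)
    rw [Algebra.TensorProduct.tmul_mul_tmul, mul_one, digitMono_add]

theorem mul_mem_leadingPart {a : (TIdx n k × ℕ) →₀ ℕ} {b : (TIdx n k × ℕ) →₀ ℕ}
    {u v : T p n k ⊗[ZMod p] T p n k} (hu : u ∈ leadingPart p n k a)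
    (hv : v ∈ tensorFil p n k (digitDeg p b) (mayWt b - 1)) :
    u * v ∈ tensorFil p n k (digitDeg p (a + b)) (mayWt (a + b) - 1) := by
  have := mul_mem_tensorFil (leadingPart_le_tensorFil a hu) hv
  rw [digitDeg_add, map_add]
  push_cast
  rwa [← add_sub_assoc] at this

/-- Up to lower filtration, the coproduct preserves the multidegree. -/
theorem comul_mem_leadingPart [NeZero k] (a : (TIdx n k × ℕ) →₀ ℕ) :
    T.comul p n k (digitMono p n k a) ∈ leadingPart p n k a := by
  induction a using finsupp_induction_single with
  | h0 =>
    rw [digitMono_zero, map_one]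
    exact Submodule.mem_sup_left (Submodule.subset_span
      ⟨0, 0, add_zero _, by rw [digitMono_zero, Algebra.TensorProduct.one_def]⟩)
  | h1 a x ih =>
    obtain ⟨τ, hτ, h⟩ := comul_single (p := p) x
    rw [digitMono_add, map_mul, h, mul_add, mul_add]
    have h3 := mul_tmul_one_mem_leadingPart x ih
    exact Submodule.add_mem _ (Submodule.add_mem _ h3.1 h3.2)
      (Submodule.mem_sup_right (mul_mem_leadingPart ih hτ))

theorem dualPair_mul_tmul_one [NeZero k] {a b c : (TIdx n k × ℕ) →₀ ℕ} {x : TIdx n k × ℕ}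
    (ha : IsReduced p Set.univ (a + Finsupp.single x 1))
    (hw : mayWt (a + Finsupp.single x 1) ≤ mayWt b + mayWt c) {u : T p n k ⊗[ZMod p] T p n k}
    (hu : u ∈ leadingPart p n k a) :
    dualPair p n k b c (u * (digitMono p n k (Finsupp.single x 1) ⊗ₜ[ZMod p] 1)) =
      b x * dualPair p n k (b - Finsupp.single x 1) c u := by
  suffices h : leadingPart p n k a ≤ LinearMap.eqLocus
      (dualPair p n k b c ∘ₗ LinearMap.mulRight (ZMod p) (digitMono p n k (Finsupp.single x 1) ⊗ₜ[ZMod p] 1))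
      ((b x : ZMod p) • dualPair p n k (b - Finsupp.single x 1) c) from h hu
  refine sup_le (Submodule.span_le.2 ?_) fun v hv => ?_
  · rintro _ ⟨b', c', rfl, rfl⟩
    change dualPair p n k b c (_ * _) = b x * _
    rw [Algebra.TensorProduct.tmul_mul_tmul, mul_one, dualPair_tmul, dualPair_tmul,
      dualCoeff_mul_single _ (ha.of_le ?_), mul_assoc]
    rw [add_right_comm]
    exact self_le_add_right _ _
  · change dualPair p n k b c (_ * _) = b x * _
    rw [map_add] at hw
    rw [dualPair_eq_zero ?_ (mul_mem_tensorFil hv (digitMono_tmul_one_mem x))]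
    · rcases Nat.eq_zero_or_pos (b x) with hb | hb
      · rw [hb, Nat.cast_zero, zero_mul]
      · obtain ⟨d, rfl⟩ : ∃ d, b = d + Finsupp.single x 1 :=
          ⟨b - Finsupp.single x 1, (tsub_add_cancel_of_le (by rwa [Finsupp.single_le_iff])).symm⟩
        rw [add_tsub_cancel_right, dualPair_eq_zero ?_ hv, mul_zero]
        rw [map_add] at hw
        push_cast
        omega
    · push_cast
      omega

theorem dualPair_mul_one_tmul [NeZero k] {a b c : (TIdx n k × ℕ) →₀ ℕ} {x : TIdx n k × ℕ}
    (ha : IsReduced p Set.univ (a + Finsupp.single x 1))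
    (hw : mayWt (a + Finsupp.single x 1) ≤ mayWt b + mayWt c) {u : T p n k ⊗[ZMod p] T p n k}
    (hu : u ∈ leadingPart p n k a) :
    dualPair p n k b c (u * (1 ⊗ₜ[ZMod p] digitMono p n k (Finsupp.single x 1))) =
      c x * dualPair p n k b (c - Finsupp.single x 1) u := by
  suffices h : leadingPart p n k a ≤ LinearMap.eqLocus
      (dualPair p n k b c ∘ₗ LinearMap.mulRight (ZMod p) (1 ⊗ₜ[ZMod p] digitMono p n k (Finsupp.single x 1)))
      ((c x : ZMod p) • dualPair p n k b (c - Finsupp.single x 1)) from h hu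
  refine sup_le (Submodule.span_le.2 ?_) fun v hv => ?_
  · rintro _ ⟨b', c', rfl, rfl⟩
    change dualPair p n k b c (_ * _) = c x * _
    rw [Algebra.TensorProduct.tmul_mul_tmul, mul_one, dualPair_tmul, dualPair_tmul,
      dualCoeff_mul_single _ (ha.of_le ?_), mul_left_comm]
    rw [add_assoc]
    exact self_le_add_left _ _
  · change dualPair p n k b c (_ * _) = c x * _
    rw [map_add] at hw
    rw [dualPair_eq_zero ?_ (mul_mem_tensorFil hv (one_tmul_digitMono_mem x))]
    · rcases Nat.eq_zero_or_pos (c x) with hc | hc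
      · rw [hc, Nat.cast_zero, zero_mul]
      · obtain ⟨d, rfl⟩ : ∃ d, c = d + Finsupp.single x 1 :=
          ⟨c - Finsupp.single x 1, (tsub_add_cancel_of_le (by rwa [Finsupp.single_le_iff])).symm⟩
        rw [add_tsub_cancel_right, dualPair_eq_zero ?_ hv, mul_zero]
        rw [map_add] at hw
        push_cast
        omega
    · push_cast
      omega

open Classical in
/-- On the associated graded coalgebra, the divided powers `γ_a` satisfy `Δ γ_a = ∑ γ_b ⊗ γ_c` over
`b + c = a`. -/
theorem dualPair_comul [NeZero k] {a : (TIdx n k × ℕ) →₀ ℕ} (ha : IsReduced p Set.univ a) :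
    ∀ b c : (TIdx n k × ℕ) →₀ ℕ, mayWt a ≤ mayWt b + mayWt c →
      dualPair p n k b c (T.comul p n k (digitMono p n k a)) =
        if b + c = a then digitFactorial p a else 0 := by
  induction a using finsupp_induction_single with
  | h0 =>
    intro b c _
    rw [digitMono_zero, map_one, Algebra.TensorProduct.one_def, dualPair_tmul,
      ← digitMono_zero (p := p) (n := n) (k := k),
      dualCoeff_digitMono _ ha, dualCoeff_digitMono _ ha]
    by_cases hb : b = 0 <;> by_cases hc : c = 0 <;>
      simp [hb, hc, digitFactorial]
  | h1 a x ih =>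
    intro b c hw
    have ha' := ha.of_le (self_le_add_right _ _)
    have hu := comul_mem_leadingPart (p := p) a
    obtain ⟨τ, hτ, h⟩ := comul_single (p := p) x
    rw [digitMono_add, map_mul, h, mul_add, mul_add, map_add, map_add,
      dualPair_mul_tmul_one ha hw hu, dualPair_mul_one_tmul ha hw hu,
      dualPair_eq_zero (by omega) (mul_mem_leadingPart hu hτ), add_zero]
    rw [map_add] at hw
    have hb : (b x : ZMod p) * dualPair p n k (b - Finsupp.single x 1) c
        (T.comul p n k (digitMono p n k a)) =
        b x * if b + c = a + Finsupp.single x 1 then digitFactorial p a else 0 := by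
      rcases Nat.eq_zero_or_pos (b x) with hb | hb
      · rw [hb, Nat.cast_zero, zero_mul, zero_mul]
      · obtain ⟨d, rfl⟩ : ∃ d, b = d + Finsupp.single x 1 :=
          ⟨b - Finsupp.single x 1, (tsub_add_cancel_of_le (by rwa [Finsupp.single_le_iff])).symm⟩
        rw [map_add] at hw
        rw [add_tsub_cancel_right, ih ha' _ _ (by omega), add_right_comm]
        simp only [add_left_inj]
    have hc : (c x : ZMod p) * dualPair p n k b (c - Finsupp.single x 1)
        (T.comul p n k (digitMono p n k a)) =
        c x * if b + c = a + Finsupp.single x 1 then digitFactorial p a else 0 := by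
      rcases Nat.eq_zero_or_pos (c x) with hc | hc
      · rw [hc, Nat.cast_zero, zero_mul, zero_mul]
      · obtain ⟨d, rfl⟩ : ∃ d, c = d + Finsupp.single x 1 :=
          ⟨c - Finsupp.single x 1, (tsub_add_cancel_of_le (by rwa [Finsupp.single_le_iff])).symm⟩
        rw [map_add] at hw
        rw [add_tsub_cancel_right, ih ha' _ _ (by omega), ← add_assoc]
        simp only [add_left_inj]
    rw [hb, hc, ← add_mul]
    split_ifs with h4
    · have h5 : b x + c x = a x + 1 := by
        have := DFunLike.congr_fun h4 x
        simpa using this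
      rw [digitFactorial_add_single, ← h5, Nat.cast_add]
    · rw [mul_zero]

end T
end MaySS

namespace MaySS
open scoped TensorProduct
open Finset

/-! ### Dual bases of the cobar complex -/

section words
variable (p n k : ℕ)

/-- The words that index a basis of the cobar complex in degree `s`. -/
def IsWord (s : ℕ) (l : List ((TIdx n k × ℕ) →₀ ℕ)) : Prop :=
  l.length = s ∧ 0 ∉ l ∧ ∀ f ∈ l, IsReduced p Set.univ f

variable {p n k}

theorem IsWord.tail {s : ℕ} {a : (TIdx n k × ℕ) →₀ ℕ} {l : List ((TIdx n k × ℕ) →₀ ℕ)}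
    (h : IsWord p n k (s + 1) (a :: l)) :
    a ≠ 0 ∧ IsReduced p Set.univ a ∧ IsWord p n k s l := by
  obtain ⟨h1, h2, h3⟩ := h
  rw [List.mem_cons, not_or] at h2
  rw [List.forall_mem_cons] at h3
  exact ⟨Ne.symm h2.1, h3.1, by simpa using h1, h2.2, h3.2⟩

theorem IsWord.cons {s : ℕ} {a : (TIdx n k × ℕ) →₀ ℕ} {l : List ((TIdx n k × ℕ) →₀ ℕ)}
    (h0 : a ≠ 0) (ha : IsReduced p Set.univ a) (hl : IsWord p n k s l) :
    IsWord p n k (s + 1) (a :: l) :=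
  ⟨by simp [hl.1], by simp [Ne.symm h0, hl.2.1], List.forall_mem_cons.2 ⟨ha, hl.2.2⟩⟩

theorem digitVal_ne_zero [Fact p.Prime] {a : (TIdx n k × ℕ) →₀ ℕ} (h0 : a ≠ 0) (ha : IsReduced p Set.univ a) :
    digitVal p a ≠ 0 := by
  intro h
  refine h0 (digitVal_injOn (Fact.out : p.Prime).one_lt ha (ha.of_le (by simp)) ?_)
  rw [h, map_zero]

variable (p n k) [Fact p.Prime] [NeZero k]

/-- The divided power `∏ (ξ_i^(p^j))^(a (i, j)) / a (i, j)!` in the augmentation ideal. -/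
noncomputable def dividedPower (a : (TIdx n k × ℕ) →₀ ℕ) : Aug (ZMod p) (T p n k) :=
  (digitFactorial p a)⁻¹ • augProj (ZMod p) (T p n k) (digitMono p n k a)

/-- The element `[γ_{a_1} | … | γ_{a_s}]` of the cobar complex, for a word `a_1, …, a_s`; it is zero if the
length of the word is not `s`. -/
noncomputable def wordElt : ∀ s : ℕ, List ((TIdx n k × ℕ) →₀ ℕ) →
    Tens (ZMod p) (Aug (ZMod p) (T p n k)) s
  | 0, [] => (1 : ZMod p)
  | s + 1, a :: l => dividedPower p n k a ⊗ₜ[ZMod p] wordElt s l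
  | 0, _ :: _ => 0
  | _ + 1, [] => 0

/-- The coordinate functional of the cobar complex at a word. -/
noncomputable def wordCoeff : ∀ s : ℕ, List ((TIdx n k × ℕ) →₀ ℕ) →
    (Tens (ZMod p) (Aug (ZMod p) (T p n k)) s →ₗ[ZMod p] ZMod p)
  | 0, [] => (LinearMap.id : ZMod p →ₗ[ZMod p] ZMod p)
  | s + 1, a :: l => (LinearMap.mul' (ZMod p) (ZMod p) ∘ₗ TensorProduct.map
      (dualCoeff p n k a ∘ₗ (Aug (ZMod p) (T p n k)).subtype) (wordCoeff s l) :
      Aug (ZMod p) (T p n k) ⊗[ZMod p] Tens (ZMod p) (Aug (ZMod p) (T p n k)) s →ₗ[ZMod p] ZMod p)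
  | 0, _ :: _ => 0
  | _ + 1, [] => 0

/-- The filtration of the cobar complex of `T(n,k)`: the part of inner degree `t` and May filtration at
most `M`. -/
noncomputable abbrev cobarFilT (s t : ℕ) (M : ℤ) :
    Submodule (ZMod p) (Tens (ZMod p) (Aug (ZMod p) (T p n k)) s) :=
  cobarFil (ZMod p) (T p n k) p (fun i : TIdx n k => T.xi p n k i.1) (fun i => innerDeg p i.1)
    (fun i => 2 * i.1 - 1) s t M

variable {p n k}

theorem cobarFilT_mono (s t : ℕ) {M M' : ℤ} (h : M ≤ M') : cobarFilT p n k s t M ≤ cobarFilT p n k s t M' :=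
  (mayT p n k).mono s t h

theorem wordCoeff_cons_tmul (s : ℕ) (a : (TIdx n k × ℕ) →₀ ℕ) (l : List ((TIdx n k × ℕ) →₀ ℕ))
    (v : Aug (ZMod p) (T p n k)) (m : Tens (ZMod p) (Aug (ZMod p) (T p n k)) s) :
    wordCoeff p n k (s + 1) (a :: l)
      (v ⊗ₜ[ZMod p] m : Aug (ZMod p) (T p n k) ⊗[ZMod p] Tens (ZMod p) (Aug (ZMod p) (T p n k)) s) =
      dualCoeff p n k a v * wordCoeff p n k s l m := rfl

theorem augProj_digitMono {a : (TIdx n k × ℕ) →₀ ℕ} (h0 : a ≠ 0) (ha : IsReduced p Set.univ a) :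
    (augProj (ZMod p) (T p n k) (digitMono p n k a) : T p n k) = digitMono p n k a := by
  have h1 : T.counit p n k (digitMono p n k a) = 0 := by
    rw [digitMono, xiMono, mono, Finsupp.prod, map_prod]
    obtain ⟨i, hi⟩ := Finsupp.support_nonempty_iff.2 (digitVal_ne_zero h0 ha)
    refine Finset.prod_eq_zero hi ?_
    have hk := NeZero.ne k
    have hi' := i.2.1
    rw [map_pow, T.counit_xi, if_neg (by omega), zero_pow (Finsupp.mem_support_iff.1 hi)]
  change digitMono p n k a - algebraMap (ZMod p) (T p n k) (T.counit p n k (digitMono p n k a)) = _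
  rw [h1, map_zero, sub_zero]

open Classical in
theorem dualCoeff_dividedPower (a : (TIdx n k × ℕ) →₀ ℕ) {b : (TIdx n k × ℕ) →₀ ℕ} (h0 : b ≠ 0)
    (hb : IsReduced p Set.univ b) :
    dualCoeff p n k a (dividedPower p n k b : T p n k) = if a = b then 1 else 0 := by
  rw [dividedPower, Submodule.coe_smul, map_smul, augProj_digitMono h0 hb, dualCoeff_digitMono _ hb]
  split_ifs with h
  · rw [h, smul_eq_mul, inv_mul_cancel₀ (digitFactorial_ne_zero p hb)]
  · rw [smul_zero]

open Classical in
theorem wordCoeff_wordElt {s : ℕ} (l : List ((TIdx n k × ℕ) →₀ ℕ))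
    {l' : List ((TIdx n k × ℕ) →₀ ℕ)} (hl' : IsWord p n k s l') :
    wordCoeff p n k s l (wordElt p n k s l') = if l = l' then 1 else 0 := by
  induction s generalizing l l' with
  | zero =>
    obtain rfl : l' = [] := List.length_eq_zero_iff.1 hl'.1
    cases l with
    | nil => rw [if_pos rfl]; rfl
    | cons a l => rw [if_neg (by simp)]; rfl
  | succ s ih =>
    rcases l' with _ | ⟨b, l'⟩
    · exact absurd hl'.1 (by simp)
    obtain ⟨h0, hb, hl⟩ := hl'.tail
    cases l with
    | nil => rw [if_neg (by simp)]; rfl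
    | cons a l =>
      refine (wordCoeff_cons_tmul s a l _ _).trans ?_
      rw [dualCoeff_dividedPower a h0 hb, ih l hl]
      by_cases h1 : a = b <;> by_cases h2 : l = l' <;> simp [h1, h2]

theorem smul_tmul_mem {s : ℕ} {a : (TIdx n k × ℕ) →₀ ℕ} (h0 : a ≠ 0) (ha : IsReduced p Set.univ a)
    {t : ℕ} {M : ℤ} {x : Tens (ZMod p) (Aug (ZMod p) (T p n k)) s} (hx : x ∈ cobarFilT p n k s t M) :
    (dividedPower p n k a ⊗ₜ[ZMod p] x :
      Aug (ZMod p) (T p n k) ⊗[ZMod p] Tens (ZMod p) (Aug (ZMod p) (T p n k)) s) ∈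
      cobarFilT p n k (s + 1) (digitDeg p a + t) (mayWt a + M) := by
  have h := tmul_mem_cobarFil (t := digitDeg p a + t) (M := mayWt a + M) (digitVal_ne_zero h0 ha) rfl
    (by rw [monoMay_digitVal (Fact.out : p.Prime).one_lt _ ha]; exact le_rfl) hx
  exact Submodule.smul_mem _ _ h

theorem wordElt_mem {s : ℕ} {l : List ((TIdx n k × ℕ) →₀ ℕ)} (hl : IsWord p n k s l) :
    wordElt p n k s l ∈ cobarFilT p n k s (digitDeg p l.sum) (mayWt l.sum) := by
  induction s generalizing l with
  | zero =>
    obtain rfl : l = [] := List.length_eq_zero_iff.1 hl.1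
    refine Submodule.subset_span ⟨Fin.elim0, fun i => i.elim0, ?_, ?_, rfl⟩
    · simp [digitDeg, monoDeg]
    · simp
  | succ s ih =>
    rcases l with _ | ⟨a, l⟩
    · exact absurd hl.1 (by simp)
    obtain ⟨h0, ha, hl⟩ := hl.tail
    rw [List.sum_cons, digitDeg_add, map_add, Nat.cast_add]
    exact smul_tmul_mem h0 ha (ih hl)

/-- Up to a unit, every bar of monomials is a basis element: its exponents are written `p`-adically. -/
theorem exists_bar_eq_smul_wordElt {s : ℕ} (e : Fin s → (TIdx n k →₀ ℕ)) (he : ∀ l, e l ≠ 0) :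
    ∃ (l : List ((TIdx n k × ℕ) →₀ ℕ)) (c : ZMod p), IsWord p n k s l ∧
      digitDeg p l.sum = ∑ i, monoDeg (fun i : TIdx n k => innerDeg p i.1) (e i) ∧
      mayWt l.sum = ∑ i, monoMay p (fun i : TIdx n k => 2 * i.1 - 1) (e i) ∧
      (bar fun i => augProj (ZMod p) (T p n k) (xiMono p n k (e i)) :
        Tens (ZMod p) (Aug (ZMod p) (T p n k)) s) = c • wordElt p n k s l := by
  induction s with
  | zero => exact ⟨[], 1, ⟨rfl, by simp, by simp⟩, by simp [digitDeg, monoDeg], by simp,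
      (one_smul _ _).symm⟩
  | succ s ih =>
    obtain ⟨l, c, hl, h1, h2, h3⟩ := ih (Fin.tail e) fun i => he _
    obtain ⟨a, ha, hae⟩ := exists_digitVal_eq (Fact.out : p.Prime).one_lt (e 0)
    have h0 : a ≠ 0 := by
      rintro rfl
      exact he 0 (by rw [← hae, map_zero])
    refine ⟨a :: l, digitFactorial p a * c, hl.cons h0 ha, ?_, ?_, ?_⟩
    · rw [List.sum_cons, digitDeg_add, Fin.sum_univ_succ, h1, digitDeg, hae]; rfl
    · rw [List.sum_cons, map_add, Fin.sum_univ_succ, h2, mayWt,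
        ← monoMay_digitVal (Fact.out : p.Prime).one_lt _ ha, hae]; rfl
    · have h4 : augProj (ZMod p) (T p n k) (xiMono p n k (e 0)) =
          digitFactorial p a • dividedPower p n k a := by
        rw [dividedPower, smul_smul, mul_inv_cancel₀ (digitFactorial_ne_zero p ha), one_smul,
          digitMono, hae]
      change (augProj (ZMod p) (T p n k) (xiMono p n k (e 0)) ⊗ₜ[ZMod p]
        (bar fun i => augProj (ZMod p) (T p n k) (xiMono p n k (Fin.tail e i)) :
          Tens (ZMod p) (Aug (ZMod p) (T p n k)) s) :
        Aug (ZMod p) (T p n k) ⊗[ZMod p] Tens (ZMod p) (Aug (ZMod p) (T p n k)) s) = _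
      rw [h3, h4]
      exact TensorProduct.smul_tmul_smul _ _ _ _

theorem fil_le_span (s t : ℕ) (M : ℤ) : cobarFilT p n k s t M ≤ Submodule.span (ZMod p)
    (wordElt p n k s '' {l | IsWord p n k s l ∧ digitDeg p l.sum = t ∧ (mayWt l.sum : ℤ) ≤ M}) := by
  refine Submodule.span_le.2 ?_
  rintro _ ⟨e, h0, h1, h2, rfl⟩
  obtain ⟨l, c, hl, h3, h4, h5⟩ := exists_bar_eq_smul_wordElt (p := p) e h0
  change (bar fun i => augProj (ZMod p) (T p n k) (xiMono p n k (e i)) :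
    Tens (ZMod p) (Aug (ZMod p) (T p n k)) s) ∈ _
  rw [h5]
  refine Submodule.smul_mem _ _ (Submodule.subset_span ⟨l, ⟨hl, h3.trans h1, ?_⟩, rfl⟩)
  rw [h4]; exact h2

theorem wordCoeff_eq_zero {s t : ℕ} {M : ℤ} {x : Tens (ZMod p) (Aug (ZMod p) (T p n k)) s} (hx : x ∈ cobarFilT p n k s t M)
    {l : List ((TIdx n k × ℕ) →₀ ℕ)} (hl : M < mayWt l.sum) : wordCoeff p n k s l x = 0 := by
  suffices h : cobarFilT p n k s t M ≤ LinearMap.ker (wordCoeff p n k s l) from h hx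
  refine (fil_le_span s t M).trans (Submodule.span_le.2 ?_)
  rintro _ ⟨l', ⟨h1, _, h3⟩, rfl⟩
  change wordCoeff p n k s l (wordElt p n k s l') = 0
  rw [wordCoeff_wordElt _ h1, if_neg]
  rintro rfl
  omega

/-- An element whose coordinates in filtration `M` vanish has lower filtration. -/
theorem mem_fil_sub_one {s t : ℕ} {M : ℤ} {x : Tens (ZMod p) (Aug (ZMod p) (T p n k)) s} (hx : x ∈ cobarFilT p n k s t M)
    (h : ∀ l, IsWord p n k s l → digitDeg p l.sum = t → (mayWt l.sum : ℤ) = M →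
      wordCoeff p n k s l x = 0) : x ∈ cobarFilT p n k s t (M - 1) := by
  obtain ⟨f, hf, rfl⟩ := (Finsupp.mem_span_image_iff_linearCombination _).1 (fil_le_span s t M hx)
  have hcoeff : ∀ l ∈ f.support,
      wordCoeff p n k s l (Finsupp.linearCombination (ZMod p) (wordElt p n k s) f) = f l := by
    intro l hl
    rw [Finsupp.linearCombination_apply, Finsupp.sum, map_sum, Finset.sum_eq_single l]
    · rw [map_smul, wordCoeff_wordElt _ (hf hl).1, if_pos rfl, smul_eq_mul, mul_one]
    · intro l' hl' hne
      rw [map_smul, wordCoeff_wordElt _ (hf hl').1, if_neg hne.symm, smul_zero]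
    · exact fun h => absurd hl h
  rw [Finsupp.linearCombination_apply]
  refine Submodule.sum_mem _ fun l hl => Submodule.smul_mem _ _ ?_
  obtain ⟨h1, h2, h3⟩ := hf hl
  have h4 : (mayWt l.sum : ℤ) ≠ M := fun h4 =>
    Finsupp.mem_support_iff.1 hl ((hcoeff l hl).symm.trans (h l h1 h2 h4))
  have h5 := wordElt_mem h1
  rw [h2] at h5
  exact cobarFilT_mono _ _ (by omega) h5

theorem redComul_dividedPower (a : (TIdx n k × ℕ) →₀ ℕ) :
    redComul (ZMod p) (T p n k) (dividedPower p n k a) = (digitFactorial p a)⁻¹ •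
      TensorProduct.map (augProj (ZMod p) (T p n k)) (augProj (ZMod p) (T p n k))
        (T.comul p n k (digitMono p n k a)) := by
  rw [dividedPower, map_smul, redComul_augProj]
  rfl

/-- The May filtration is a filtration by subcomplexes. -/
theorem d_mem_fil {s t : ℕ} {M : ℤ} {x : Tens (ZMod p) (Aug (ZMod p) (T p n k)) s} (hx : x ∈ cobarFilT p n k s t M) :
    cobarD (redComul (ZMod p) (T p n k)) s x ∈ cobarFilT p n k (s + 1) t M := by
  have key : ∀ {s : ℕ} {l : List ((TIdx n k × ℕ) →₀ ℕ)}, IsWord p n k s l →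
      cobarD (redComul (ZMod p) (T p n k)) s (wordElt p n k s l) ∈
        cobarFilT p n k (s + 1) (digitDeg p l.sum) (mayWt l.sum) := by
    intro s
    induction s with
    | zero => intro l _; exact Submodule.zero_mem _
    | succ s ih =>
      intro l hl
      rcases l with _ | ⟨a, l⟩
      · exact absurd hl.1 (by simp)
      obtain ⟨h0, ha, hl⟩ := hl.tail
      rw [List.sum_cons, digitDeg_add, map_add, Nat.cast_add]
      have hd : cobarD (redComul (ZMod p) (T p n k)) (s + 1) (wordElt p n k (s + 1) (a :: l)) =
          cobarStep (redComul (ZMod p) (T p n k)) (cobarD (redComul (ZMod p) (T p n k)) s)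
            (dividedPower p n k a ⊗ₜ[ZMod p] wordElt p n k s l) := rfl
      rw [hd.trans (cobarStep_tmul _ _ _ _)]
      refine Submodule.sub_mem _ (Submodule.neg_mem _ ?_) (smul_tmul_mem h0 ha (ih hl))
      rw [redComul_dividedPower, ← TensorProduct.smul_tmul', map_smul]
      refine Submodule.smul_mem _ _ ?_
      have hm := leadingPart_le_tensorFil a (comul_mem_leadingPart (p := p) a)
      rw [tensorFil] at hm
      generalize T.comul p n k (digitMono p n k a) = y at hm
      induction hm using Submodule.span_induction with
      | zero => simp only [map_zero, TensorProduct.zero_tmul]; exact Submodule.zero_mem _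
      | add u v _ _ hu hv =>
        simp only [map_add, TensorProduct.add_tmul]; exact Submodule.add_mem _ hu hv
      | smul c u _ hu =>
        simp only [map_smul, ← TensorProduct.smul_tmul']; exact Submodule.smul_mem _ _ hu
      | mem u hu =>
        obtain ⟨e, e', h1, h2, rfl⟩ := hu
        rw [TensorProduct.map_tmul, TensorProduct.assoc_tmul]
        by_cases he : e = 0
        · rw [he, xiMono_zero, augProj_one, TensorProduct.zero_tmul]; exact Submodule.zero_mem _
        by_cases he' : e' = 0
        · rw [he', xiMono_zero, augProj_one, TensorProduct.zero_tmul, TensorProduct.tmul_zero]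
          exact Submodule.zero_mem _
        refine tmul_mem_cobarFil he (t' := monoDeg (fun i : TIdx n k => innerDeg p i.1) e' +
          digitDeg p l.sum) (by rw [← h1, add_assoc])
          (M' := monoMay p (fun i : TIdx n k => 2 * i.1 - 1) e' + mayWt l.sum) ?_
          (tmul_mem_cobarFil he' rfl le_rfl (wordElt_mem hl))
        push_cast at h2
        linarith
  suffices h : cobarFilT p n k s t M ≤
    (cobarFilT p n k (s + 1) t M).comap (cobarD (redComul (ZMod p) (T p n k)) s) from h hx
  refine (fil_le_span s t M).trans (Submodule.span_le.2 ?_)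
  rintro _ ⟨l, ⟨h1, rfl, h3⟩, rfl⟩
  exact cobarFilT_mono _ _ h3 (key h1)

variable (p n k) in
open Classical in
/-- The coordinates of an element of the cobar complex, as a cochain with trivial coefficients. -/
noncomputable def toCochain (s : ℕ) (x : Tens (ZMod p) (Aug (ZMod p) (T p n k)) s)
    (l : List ((TIdx n k × ℕ) →₀ ℕ)) (m : (TIdx n k × ℕ) →₀ ℕ) : ZMod p :=
  if m = 0 then wordCoeff p n k s l x else 0

theorem toCochain_zero_right (s : ℕ) (x : Tens (ZMod p) (Aug (ZMod p) (T p n k)) s)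
    (l : List ((TIdx n k × ℕ) →₀ ℕ)) : toCochain p n k s x l 0 = wordCoeff p n k s l x := if_pos rfl

theorem toCochain_of_ne_zero (s : ℕ) (x : Tens (ZMod p) (Aug (ZMod p) (T p n k)) s)
    (l : List ((TIdx n k × ℕ) →₀ ℕ)) {m : (TIdx n k × ℕ) →₀ ℕ} (hm : m ≠ 0) :
    toCochain p n k s x l m = 0 := if_neg hm

theorem wordCoeff_eq_zero_of_not_isReduced {s : ℕ} (x : Tens (ZMod p) (Aug (ZMod p) (T p n k)) s)
    {l : List ((TIdx n k × ℕ) →₀ ℕ)} (hl : ¬∀ f ∈ l, IsReduced p Set.univ f) :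
    wordCoeff p n k s l x = 0 := by
  induction s generalizing l with
  | zero =>
    cases l with
    | nil => exact absurd (by simp) hl
    | cons a l => rfl
  | succ s ih =>
    cases l with
    | nil => rfl
    | cons a l =>
      change wordCoeff p n k (s + 1) (a :: l)
        (show Aug (ZMod p) (T p n k) ⊗[ZMod p] Tens (ZMod p) (Aug (ZMod p) (T p n k)) s from x) = 0
      induction (show Aug (ZMod p) (T p n k) ⊗[ZMod p] Tens (ZMod p) (Aug (ZMod p) (T p n k)) s
        from x) using TensorProduct.induction_on with
      | zero => exact map_zero _
      | add u v hu hv => 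
        exact (map_add (wordCoeff p n k (s + 1) (a :: l)) u v).trans
          ((congrArg₂ (· + ·) hu hv).trans (add_zero 0))
      | tmul v m =>
        refine (wordCoeff_cons_tmul s a l v m).trans ?_
        by_cases ha : IsReduced p Set.univ a
        · rw [ih m fun h => hl (List.forall_mem_cons.2 ⟨ha, h⟩), mul_zero]
        · rw [dualCoeff_of_not_isReduced ha, LinearMap.zero_apply, zero_mul]

theorem isSupported_toCochain (s : ℕ) (x : Tens (ZMod p) (Aug (ZMod p) (T p n k)) s) :
    IsSupported p ∅ (toCochain p n k s x) := by
  intro l m h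
  have hm : m = 0 := by
    by_contra hm
    exact h (toCochain_of_ne_zero s x l hm)
  subst hm
  rw [toCochain_zero_right] at h
  refine ⟨?_, fun x => ⟨(Fact.out : p.Prime).pos, fun _ => rfl⟩⟩
  by_contra h1
  exact h (wordCoeff_eq_zero_of_not_isReduced x h1)

theorem dualPair_redComul_dividedPower {a b c : (TIdx n k × ℕ) →₀ ℕ} (h0 : a ≠ 0)
    (ha : IsReduced p Set.univ a) (hb : b ≠ 0) (hc : c ≠ 0) (hw : mayWt a ≤ mayWt b + mayWt c) :
    LinearMap.mul' (ZMod p) (ZMod p) (TensorProduct.map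
      (dualCoeff p n k b ∘ₗ (Aug (ZMod p) (T p n k)).subtype)
      (dualCoeff p n k c ∘ₗ (Aug (ZMod p) (T p n k)).subtype)
      (redComul (ZMod p) (T p n k) (dividedPower p n k a))) =
    dualCoeff p n k (b + c) (dividedPower p n k a : T p n k) := by
  classical
  have hproj : ∀ b : (TIdx n k × ℕ) →₀ ℕ, b ≠ 0 →
      (dualCoeff p n k b ∘ₗ (Aug (ZMod p) (T p n k)).subtype) ∘ₗ augProj (ZMod p) (T p n k) =
        dualCoeff p n k b := by
    intro b hb
    refine LinearMap.ext fun v => ?_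
    change dualCoeff p n k b (v - algebraMap (ZMod p) (T p n k) (Coalgebra.counit v)) = _
    rw [map_sub, Algebra.algebraMap_eq_smul_one, map_smul, ← digitMono_zero,
      dualCoeff_digitMono b (fun x => ⟨(Fact.out : p.Prime).pos, fun _ => rfl⟩), if_neg hb, smul_zero,
      sub_zero]
  rw [redComul_dividedPower, map_smul, map_smul, ← LinearMap.comp_apply (TensorProduct.map _ _),
    ← TensorProduct.map_comp, hproj b hb, hproj c hc]
  have h1 := dualPair_comul ha b c hw
  rw [dualPair, LinearMap.comp_apply] at h1
  rw [h1, dualCoeff_dividedPower _ h0 ha]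
  split_ifs
  · rw [smul_eq_mul, inv_mul_cancel₀ (digitFactorial_ne_zero p ha)]
  · rw [smul_zero]

/-- In top filtration the cobar differential is the differential on words. -/
theorem wordCoeff_cobarD_wordElt {s : ℕ} {l₀ l : List ((TIdx n k × ℕ) →₀ ℕ)}
    (h₀ : IsWord p n k s l₀) (hl : 0 ∉ l) (hw : mayWt l₀.sum ≤ mayWt l.sum) :
    wordCoeff p n k (s + 1) l (cobarD (redComul (ZMod p) (T p n k)) s (wordElt p n k s l₀)) =
      wordD (toCochain p n k s (wordElt p n k s l₀)) l 0 := by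
  classical
  induction s generalizing l₀ l with
  | zero =>
    have h1 : wordCoeff p n k 1 l (cobarD (redComul (ZMod p) (T p n k)) 0 (wordElt p n k 0 l₀)) = 0 :=
      map_zero (wordCoeff p n k 1 l)
    rw [h1]
    cases l with
    | nil => rfl
    | cons f l =>
      have h2 : (fun l' => toCochain p n k 0 (wordElt p n k 0 l₀) (f :: l')) = fun _ _ => 0 := by
        funext l' m
        by_cases hm : m = 0
        · rw [hm, toCochain_zero_right]; rfl
        · exact toCochain_of_ne_zero _ _ _ hm
      rw [wordD, h2, wordD_zero, sub_zero, eq_comm, neg_eq_zero]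
      cases l with
      | nil => exact toCochain_of_ne_zero _ _ _ fun h => hl (by simp at h; simp [h])
      | cons g l => rw [mergeHead, toCochain_zero_right]; rfl
  | succ s ih =>
    rcases l₀ with _ | ⟨a, l₁⟩
    · exact absurd h₀.1 (by simp)
    obtain ⟨ha0, ha, hl₁⟩ := h₀.tail
    cases l with
    | nil => rfl
    | cons f l =>
      rw [List.mem_cons, not_or] at hl
      rw [List.sum_cons, List.sum_cons, map_add, map_add] at hw
      have hd : cobarD (redComul (ZMod p) (T p n k)) (s + 1) (wordElt p n k (s + 1) (a :: l₁)) =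
          cobarStep (redComul (ZMod p) (T p n k)) (cobarD (redComul (ZMod p) (T p n k)) s)
            (dividedPower p n k a ⊗ₜ[ZMod p] wordElt p n k s l₁) := rfl
      rw [hd.trans (cobarStep_tmul _ _ _ _), wordD]
      refine (map_sub (wordCoeff p n k (s + 2) (f :: l)) _ _).trans (congrArg₂ _ ?_ ?_)
      · refine (map_neg (wordCoeff p n k (s + 2) (f :: l)) _).trans (congrArg _ ?_)
        have hassoc : ∀ (g : (TIdx n k × ℕ) →₀ ℕ) (l : List ((TIdx n k × ℕ) →₀ ℕ))
            (y : Aug (ZMod p) (T p n k) ⊗[ZMod p] Aug (ZMod p) (T p n k))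
            (m : Tens (ZMod p) (Aug (ZMod p) (T p n k)) s),
            wordCoeff p n k (s + 2) (f :: g :: l) (TensorProduct.assoc (ZMod p) _ _ _ (y ⊗ₜ[ZMod p] m)) =
              LinearMap.mul' (ZMod p) (ZMod p) (TensorProduct.map
                (dualCoeff p n k f ∘ₗ (Aug (ZMod p) (T p n k)).subtype)
                (dualCoeff p n k g ∘ₗ (Aug (ZMod p) (T p n k)).subtype) y) * wordCoeff p n k s l m := by
          intro g l y m
          induction y using TensorProduct.induction_on with
          | zero =>
            rw [TensorProduct.zero_tmul, map_zero, map_zero, map_zero, zero_mul]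
            exact map_zero (wordCoeff p n k (s + 2) (f :: g :: l))
          | add y y' h h' =>
            rw [TensorProduct.add_tmul, map_add, map_add, map_add, add_mul, ← h, ← h']
            exact map_add (wordCoeff p n k (s + 2) (f :: g :: l)) _ _
          | tmul v w =>
            exact (mul_assoc (dualCoeff p n k f v) (dualCoeff p n k g w) (wordCoeff p n k s l m)).symm
        cases l with
        | nil =>
          rw [mergeHead, toCochain_of_ne_zero _ _ _ (by simpa using Ne.symm hl.1)]
          generalize redComul (ZMod p) (T p n k) (dividedPower p n k a) = y
          induction y using TensorProduct.induction_on with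
          | zero =>
            rw [TensorProduct.zero_tmul, map_zero]
            exact map_zero (wordCoeff p n k (s + 2) [f])
          | add y y' h h' =>
            rw [TensorProduct.add_tmul, map_add]
            exact (map_add (wordCoeff p n k (s + 2) [f]) _ _).trans (by rw [h, h', add_zero])
          | tmul v w => exact mul_zero _
        | cons g l =>
          rw [List.mem_cons, not_or] at hl
          rw [hassoc, mergeHead, toCochain_zero_right]
          refine Eq.trans ?_ (wordCoeff_cons_tmul s (f + g) l _ _).symm
          by_cases h1 : l = l₁
          · subst h1
            rw [dualPair_redComul_dividedPower ha0 ha (Ne.symm hl.1) (Ne.symm hl.2.1)]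
            rw [List.sum_cons, map_add] at hw
            omega
          · rw [wordCoeff_wordElt l hl₁, if_neg h1, mul_zero, mul_zero]
      · refine (wordCoeff_cons_tmul (s + 1) f l _ _).trans ?_
        have h1 : (fun l' => toCochain p n k (s + 1) (wordElt p n k (s + 1) (a :: l₁)) (f :: l')) =
            fun l' m => dualCoeff p n k f (dividedPower p n k a : T p n k) *
              toCochain p n k s (wordElt p n k s l₁) l' m := by
          funext l' m
          by_cases hm : m = 0
          · rw [hm, toCochain_zero_right, toCochain_zero_right]
            exact wordCoeff_cons_tmul s f l' _ _
          · rw [toCochain_of_ne_zero _ _ _ hm, toCochain_of_ne_zero _ _ _ hm, mul_zero]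
        rw [h1, wordD_const_mul, dualCoeff_dividedPower f ha0 ha]
        split_ifs with h2
        · subst h2
          exact congrArg (1 * ·) (ih hl₁ hl.2 (by omega))
        · rw [zero_mul, zero_mul]

theorem wordD_toCochain_add (s : ℕ) (x y : Tens (ZMod p) (Aug (ZMod p) (T p n k)) s)
    (l : List ((TIdx n k × ℕ) →₀ ℕ)) (m : (TIdx n k × ℕ) →₀ ℕ) :
    wordD (toCochain p n k s (x + y)) l m =
      wordD (toCochain p n k s x) l m + wordD (toCochain p n k s y) l m := by
  have h : toCochain p n k s y = fun l m => toCochain p n k s (x + y) l m - toCochain p n k s x l m := by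
    funext l m
    by_cases hm : m = 0
    · rw [hm, toCochain_zero_right, toCochain_zero_right, toCochain_zero_right, map_add]; ring
    · simp only [toCochain_of_ne_zero _ _ _ hm, sub_zero]
  rw [h, wordD_sub]
  ring

theorem wordD_toCochain_smul (s : ℕ) (c : ZMod p) (x : Tens (ZMod p) (Aug (ZMod p) (T p n k)) s)
    (l : List ((TIdx n k × ℕ) →₀ ℕ)) (m : (TIdx n k × ℕ) →₀ ℕ) :
    wordD (toCochain p n k s (c • x)) l m = c * wordD (toCochain p n k s x) l m := by
  have h : toCochain p n k s (c • x) = fun l m => c * toCochain p n k s x l m := by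
    funext l m
    by_cases hm : m = 0
    · rw [hm, toCochain_zero_right, toCochain_zero_right, map_smul, smul_eq_mul]
    · simp only [toCochain_of_ne_zero _ _ _ hm, mul_zero]
  rw [h, wordD_const_mul]

/-- For `x` of filtration at most `M`, the coordinates of `d x` in filtration at least `M` are given by
`wordD`. -/
theorem wordCoeff_cobarD {s t : ℕ} {M : ℤ} {x : Tens (ZMod p) (Aug (ZMod p) (T p n k)) s}
    (hx : x ∈ cobarFilT p n k s t M) {l : List ((TIdx n k × ℕ) →₀ ℕ)} (hl : 0 ∉ l)
    (hw : M ≤ mayWt l.sum) :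
    wordCoeff p n k (s + 1) l (cobarD (redComul (ZMod p) (T p n k)) s x) =
      wordD (toCochain p n k s x) l 0 := by
  replace hx := fil_le_span s t M hx
  induction hx using Submodule.span_induction with
  | mem x hx =>
    obtain ⟨l₀, ⟨h1, _, h3⟩, rfl⟩ := hx
    exact wordCoeff_cobarD_wordElt h1 hl (by omega)
  | zero =>
    rw [map_zero, map_zero, ← zero_smul (ZMod p) (0 : Tens (ZMod p) (Aug (ZMod p) (T p n k)) s),
      wordD_toCochain_smul, zero_mul]
  | add x y _ _ h h' => rw [map_add, map_add, wordD_toCochain_add, h, h']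
  | smul c x _ h => rw [map_smul, map_smul, wordD_toCochain_smul, h, smul_eq_mul]

end words
end MaySS

namespace MaySS
open Finset

/-! ### Vanishing and infinite cocycles -/

section vanishing
variable {p n k : ℕ}

theorem dvd_digitDeg (a : (TIdx n k × ℕ) →₀ ℕ) : 2 * (p - 1) ∣ digitDeg p a := by
  induction a using finsupp_induction_single with
  | h0 => simp [digitDeg, monoDeg]
  | h1 a x ih =>
    rw [digitDeg_add, digitDeg_single, innerDeg]
    exact dvd_add ih (dvd_mul_of_dvd_right (dvd_mul_right _ _) _)

variable [Fact p.Prime]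

theorem Sd_digitDeg_add_single_le (a : (TIdx n k × ℕ) →₀ ℕ) (x : TIdx n k × ℕ) (m : ℕ) :
    Sd p (digitDeg p (a + Finsupp.single x (p ^ m))) ≤ Sd p (digitDeg p a) + x.1.1 := by
  have hp1 : 1 < p := (Fact.out : p.Prime).one_lt
  have h : digitDeg p (Finsupp.single x (p ^ m)) / (2 * (p - 1)) =
      p ^ (m + x.2) * ∑ l ∈ range x.1.1, p ^ l := by
    rw [digitDeg_single, innerDeg, mul_left_comm, Nat.mul_div_cancel_left _ (by omega), pow_add]
  rw [Sd, Sd, digitDeg_add, Nat.add_div_of_dvd_right (dvd_digitDeg a), h]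
  refine (digits_sum_add_le hp1 _ _).trans (add_le_add le_rfl ?_)
  rw [digits_sum_pow_mul hp1]
  exact digits_sum_repunit_le hp1 _

variable [NeZero k]

theorem mul_pow_le_digitDeg (a : (TIdx n k × ℕ) →₀ ℕ) (x : TIdx n k × ℕ) :
    a x * p ^ x.2 ≤ digitDeg p a := by
  have hp1 : 1 < p := (Fact.out : p.Prime).one_lt
  obtain ⟨c, hc⟩ : ∃ c, a = c + Finsupp.single x (a x) :=
    ⟨a - Finsupp.single x (a x), (tsub_add_cancel_of_le (Finsupp.single_le_iff.2 le_rfl)).symm⟩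
  have h1 : digitDeg p a = digitDeg p c + a x * p ^ x.2 * innerDeg p x.1 := by
    conv_lhs => rw [hc]
    rw [digitDeg_add, digitDeg_single]
  have h2 : 0 < innerDeg p x.1.1 := by
    have hk := NeZero.ne k
    have hi := x.1.2.1
    refine Nat.mul_pos (by omega) (Finset.sum_pos (fun l _ => pow_pos (by omega) _) ?_)
    exact ⟨0, mem_range.2 (by omega)⟩
  have h3 := Nat.le_mul_of_pos_right (a x * p ^ x.2) h2
  omega

/-- A multidegree of inner degree `t` only involves `ξ_i^(p^j)` with `j < t`. -/
theorem apply_eq_zero_of_digitDeg_le {a : (TIdx n k × ℕ) →₀ ℕ} {x : TIdx n k × ℕ}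
    (hx : digitDeg p a ≤ x.2) : a x = 0 := by
  by_contra h
  have h1 := mul_pow_le_digitDeg (p := p) a x
  have h2 := Nat.le_mul_of_pos_left (p ^ x.2) (Nat.pos_of_ne_zero h)
  have h3 : x.2 < p ^ x.2 := Nat.lt_pow_self (Fact.out : p.Prime).one_lt
  omega

theorem finite_setOf_digitDeg_eq (t : ℕ) :
    {a : (TIdx n k × ℕ) →₀ ℕ | digitDeg p a ≤ t}.Finite := by
  classical
  let b : (TIdx n k × ℕ) →₀ ℕ := Finsupp.onFinset (univ ×ˢ range t)
    (fun x => if x.2 < t then t else 0) (by intro x hx; simp at hx; simp [hx.1])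
  refine (Set.finite_Icc 0 b).subset fun a ha => ⟨by simp, fun x => ?_⟩
  change a x ≤ if x.2 < t then t else 0
  split_ifs with h
  · refine le_trans ?_ ((mul_pow_le_digitDeg a x).trans ha)
    exact Nat.le_mul_of_pos_right _ (pow_pos (Fact.out : p.Prime).pos _)
  · exact (apply_eq_zero_of_digitDeg_le (ha.trans (not_lt.1 h))).le

theorem finite_setOf_isWord (s t : ℕ) :
    {l : List ((TIdx n k × ℕ) →₀ ℕ) | IsWord p n k s l ∧ digitDeg p l.sum = t}.Finite := by
  refine (finite_setOf_length_eq (finite_setOf_digitDeg_eq (p := p) t) s).subset ?_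
  rintro l ⟨hl, rfl⟩
  refine ⟨hl.1, fun f hf => ?_⟩
  obtain ⟨l₁, l₂, rfl⟩ := List.append_of_mem hf
  simp only [List.sum_append, List.sum_cons, digitDeg_add, Set.mem_ofPred_eq]
  omega

/-- The associated graded complex of inner degree `t` and filtration `M` is acyclic in degrees below
`2 Sd(t) - M`. -/
theorem isAcyclicAt_T {s t : ℕ} {M : ℤ} (h : M < 2 * (Sd p t : ℤ) - s) :
    IsAcyclicAt (ZMod p) p (∅ : Set (TIdx n k × ℕ))
      {a | digitDeg p a = t ∧ (mayWt a : ℤ) = M} s := by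
  have hp0 : 0 < p := (Fact.out : p.Prime).pos
  have hk := NeZero.ne k
  rw [← Finset.coe_empty]
  refine isAcyclicAt_of_lt hp0 (fun a => 2 * (Sd p (digitDeg p a) : ℤ) - mayWt a) ?_ ?_ ?_
    (univ ×ˢ range t) s ∅ (empty_subset _) _ ?_ ?_
  · simp [digitDeg, monoDeg, Sd]
  · intro a x
    have h1 := Sd_digitDeg_add_single_le (p := p) a x 0
    have h2 := x.1.2.1
    rw [pow_zero] at h1
    rw [map_add, mayWt, digitWt_single]
    push_cast
    omega
  · intro a x
    have h1 := Sd_digitDeg_add_single_le (p := p) a x 1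
    have h2 := x.1.2.1
    rw [pow_one] at h1
    rw [map_add, mayWt, digitWt_single]
    have h3 : 2 * x.1.1 - 1 ≤ p * (2 * x.1.1 - 1) := Nat.le_mul_of_pos_left _ hp0
    generalize p * (2 * x.1.1 - 1) = q at h3 ⊢
    push_cast
    omega
  · rintro a ⟨rfl, _⟩ x hx
    refine apply_eq_zero_of_digitDeg_le (p := p) ?_
    simpa using hx
  · rintro a ⟨rfl, rfl⟩
    omega

/-- In the vanishing range, a cocycle modulo lower filtration is a coboundary modulo lower filtration. -/
theorem exists_mem_dZ_sub_mem {s t : ℕ} {M : ℤ} (h : M < 2 * (Sd p t : ℤ) - s)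
    {x : Tens (ZMod p) (Aug (ZMod p) (T p n k)) s} (hx : x ∈ cobarFilT p n k s t M)
    (hdx : cobarD (redComul (ZMod p) (T p n k)) s x ∈ cobarFilT p n k (s + 1) t (M - 1)) :
    ∃ b : Tens (ZMod p) (Aug (ZMod p) (T p n k)) s,
      b ∈ (mayT p n k).dZ 0 s t M ∧ x - b ∈ cobarFilT p n k s t (M - 1) := by
  classical
  obtain ⟨y, hy, hxy⟩ := isAcyclicAt_T h (toCochain p n k s x) (isSupported_toCochain s x) (by
    intro l m hl hs hP
    by_cases hm : m = 0
    · subst hm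
      rw [add_zero] at hP
      rw [← wordCoeff_cobarD hx hl (le_of_eq hP.2.symm)]
      exact wordCoeff_eq_zero hdx (by rw [hP.2]; omega)
    · have h1 := isSupported_toCochain (p := p) s x
      by_contra h2
      exact hm (Finsupp.ext fun j => ((h1.wordD l m h2).2 j).2 (by simp)))
  -- It suffices to find `Y` of filtration `M` such that `x` and `dY` agree in filtration `M`.
  suffices hY : ∃ b : Tens (ZMod p) (Aug (ZMod p) (T p n k)) s, b ∈ (mayT p n k).dZ 0 s t M ∧
      b ∈ cobarFilT p n k s t M ∧ ∀ l, IsWord p n k s l → digitDeg p l.sum = t →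
        (mayWt l.sum : ℤ) = M → wordCoeff p n k s l b = wordCoeff p n k s l x by
    obtain ⟨b, hb, hbM, hbx⟩ := hY
    exact ⟨b, hb, mem_fil_sub_one (Submodule.sub_mem _ hx hbM) fun l h1 h2 h3 => by
      rw [map_sub, hbx l h1 h2 h3, sub_self]⟩
  rcases s with _ | s
  · refine ⟨0, Submodule.zero_mem _, Submodule.zero_mem _, fun l h1 h2 h3 => ?_⟩
    have h4 := hxy l 0 h1.2.1 h1.1 (by rw [add_zero]; exact ⟨h2, h3⟩)
    rw [toCochain_zero_right] at h4
    obtain rfl : l = [] := List.length_eq_zero_iff.1 h1.1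
    rw [map_zero, h4]
    rfl
  · let W := ((finite_setOf_isWord (n := n) (k := k) (p := p) s t).toFinset).filter
      fun l => (mayWt l.sum : ℤ) = M
    have hW : ∀ l, l ∈ W ↔ (IsWord p n k s l ∧ digitDeg p l.sum = t) ∧ (mayWt l.sum : ℤ) = M := by
      intro l; simp [W]
    let Y := ∑ l ∈ W, y l 0 • wordElt p n k s l
    have hYM : Y ∈ cobarFilT p n k s t M := by
      refine Submodule.sum_mem _ fun l hl => Submodule.smul_mem _ _ ?_
      obtain ⟨⟨h1, h2⟩, h3⟩ := (hW l).1 hl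
      have := wordElt_mem h1
      rwa [h2, h3] at this
    have hdY := d_mem_fil hYM
    have hYl : ∀ l, wordCoeff p n k s l Y = if l ∈ W then y l 0 else 0 := by
      intro l
      rw [map_sum]
      have h1 : ∀ l' ∈ W, wordCoeff p n k s l (y l' 0 • wordElt p n k s l') =
          if l = l' then y l' 0 else 0 := by
        intro l' hl'
        rw [map_smul, wordCoeff_wordElt l ((hW l').1 hl').1.1]
        split_ifs <;> simp
      rw [Finset.sum_congr rfl h1, Finset.sum_ite_eq]
    refine ⟨cobarD (redComul (ZMod p) (T p n k)) s Y, ⟨Y, ⟨hYM, ?_⟩, rfl⟩, hdY,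
      fun l h1 h2 h3 => ?_⟩
    · change cobarD (redComul (ZMod p) (T p n k)) s Y ∈ cobarFilT p n k (s + 1) t (M - 0)
      rwa [sub_zero]
    · rw [wordCoeff_cobarD hYM h1.2.1 h3.ge, ← toCochain_zero_right (s + 1) x l,
        hxy l 0 h1.2.1 h1.1 (by rw [add_zero]; exact ⟨h2, h3⟩)]
      refine wordD_congr h1.2.1 fun l' m h4 h5 h6 _ => ?_
      by_cases hm : m = 0
      · subst hm
        rw [add_zero, add_zero] at h6
        rw [toCochain_zero_right, hYl]
        split_ifs with h7
        · rfl
        · by_contra h8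
          refine h7 ((hW l').2 ⟨⟨⟨by have := h1.1; omega, h4, (hy l' 0 (Ne.symm h8)).1⟩, ?_⟩, ?_⟩)
          · rw [h6, h2]
          · rw [h6, h3]
      · rw [toCochain_of_ne_zero _ _ _ hm]
        by_contra h8
        exact hm (Finsupp.ext fun j => ((hy l' m (Ne.symm h8)).2 j).2 (by simp))

/-- The vanishing line of `E_1 T(n,k)`. -/
theorem subsingleton_page_one {s t : ℕ} {M : ℤ} (h : M < 2 * (Sd p t : ℤ) - s) :
    Subsingleton ((mayT p n k).Page 1 s t M) := by
  refine subsingleton_of_forall_eq 0 fun g => ?_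
  obtain ⟨⟨x, hx, hdx⟩, rfl⟩ := Submodule.Quotient.mk_surjective _ g
  obtain ⟨b, hb, hxb⟩ : ∃ b : (mayT p n k).C s, b ∈ (mayT p n k).dZ 0 s t M ∧
    x - b ∈ (mayT p n k).fil s t (M - 1) := exists_mem_dZ_sub_mem h hx hdx
  have h2 : (mayT p n k).d s (x - b) ∈ (mayT p n k).fil (s + 1) t (M - 1) := d_mem_fil hxb
  refine FilteredCochain.cls_eq_zero.2 (Submodule.mem_sup.2
    ⟨x - b, ⟨hxb, ?_⟩, b, by simpa using hb, sub_add_cancel x b⟩)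
  change (mayT p n k).d s (x - b) ∈ (mayT p n k).fil (s + 1) t (M - 1 - ((1 : ℕ) - 1))
  rwa [Nat.cast_one, sub_self, sub_zero]

/-- A nonzero element of the exterior part has filtration `2 SI - s`. -/
theorem exteriorPart_filtration {s t m : ℕ} {M : ℤ} {g : (mayT p n k).Page 1 s t M}
    (hg : g ∈ exteriorPart p n k s t M m) (h0 : g ≠ 0) : M = 2 * m - s := by
  by_contra hM
  refine h0 ((Submodule.mem_bot (ZMod p)).1 ?_)
  suffices h : exteriorPart p n k s t M m ≤ ⊥ from h hg
  refine Submodule.span_le.2 ?_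
  rintro _ ⟨I, _, hM', hm, _⟩
  refine absurd ?_ hM
  have h1 : ∀ l, ((2 * (I l).1.1 - 1 : ℕ) : ℤ) = 2 * ((I l).1.1 : ℤ) - 1 := by
    intro l
    have := NeZero.ne k
    have := (I l).1.2.1
    omega
  rw [← hM', ← hm]
  push_cast
  rw [Finset.sum_congr rfl fun l _ => h1 l, Finset.sum_sub_distrib, ← Finset.mul_sum]
  simp

theorem isInfiniteCocycle_of_mem_exteriorPart {s t : ℕ} {M : ℤ} {g : (mayT p n k).Page 1 s t M}
    (hg : g ∈ exteriorPart p n k s t M (Sd p t)) (hd : (mayT p n k).pageDiff 1 s t M g = 0) :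
    FilteredCochain.IsInfiniteCocycle g := by
  by_cases h0 : g = 0
  · rw [h0]; exact FilteredCochain.isInfiniteCocycle_zero
  · have hM := exteriorPart_filtration hg h0
    refine FilteredCochain.isInfiniteCocycle_of_subsingleton g hd fun r hr =>
      subsingleton_page_one ?_
    push_cast
    omega

end vanishing
end MaySS

theorem theorem4p9 (p n k : ℕ) [Fact p.Prime] [NeZero n] [NeZero k] (hp : p ≠ 2) :
    (∀ (s t : ℕ) (M : ℤ), 2 * (p - 1) ∣ t → M < 2 * (MaySS.Sd p t : ℤ) - (s : ℤ) →
      Subsingleton ((MaySS.mayT p n k).Page 1 s t M)) ∧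
    (∀ (s t : ℕ) (M : ℤ) (g : (MaySS.mayT p n k).Page 1 s t M),
      g ∈ MaySS.exteriorPart p n k s t M (MaySS.Sd p t) →
      (MaySS.mayT p n k).pageDiff 1 s t M g = 0 →
      MaySS.FilteredCochain.IsInfiniteCocycle g ∧
      MaySS.FilteredCochain.IsInfiniteCocycle ((MaySS.mayPhi p n k).pageMap 1 s t M g)) := by
  refine ⟨fun s t M _ h => MaySS.subsingleton_page_one h, fun s t M g hg hd => ?_⟩
  have h := MaySS.isInfiniteCocycle_of_mem_exteriorPart hg hd
  exact ⟨h, h.pageMap _⟩
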